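/- Let $\mathbb F$ be an algebraically closed field of characteristic $p\ge 0$, let $G$ be a finite group, and let $V_1,\dots,V_r$ be pairwise non-isomorphic simple $\mathbb FG$-modules (for instance, a complete set of representatives). For $m\ge 0$ let $G_m=G^m\rtimes S_m$ be the wreath product, where $S_m$ permutes the factors of $G^m$. If $L$ is an $\mathbb FS_m$-module, then $V_k^{\otimes m}\otimes L$ is regarded as an $\mathbb FG_m$-module: $G^m$ acts factorwise on $V_k^{\otimes m}$ and trivially on $L$, and $S_m$ acts diagonally, permuting the tensor factors of $V_k^{\otimes m}$. For a $p$-regular partition $\mu$ (no $p$ nonzero parts are equal; no condition if $p=0$) let $D^\mu=S^\mu/(S^\mu\cap (S^\mu)^\perp)$ be the corresponding simple $\mathbb FS_{|\mu|}$-module, where $S^\mu$ is the Specht module and $\perp$ refers to the standard bilinear form on the permutation module on $\mu$-tabloids. Let $n\ge 1$ and let $\mu^\centerdot=(\mu^1,\dots,\mu^r)$ be $p$-regular partitions with $\widehat n=(n_1,\dots,n_r)=(|\mu^1|,\dots,|\mu^r|)$ and $n_1+\dots+n_r=n$. Put $G_{\widehat n}=G_{n_1}\times\dots\times G_{n_r}\subseteq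 G_n$ and $$D_{\widehat n}^{\mu^\centerdot}=\mathrm{ind}_{G_{\widehat n}}^{G_n}\bigl((V_1^{\otimes n_1}\otimes D^{\mu^1})\otimes\cdots\otimes(V_r^{\otimes n_r}\otimes D^{\mu^r})\bigr).$$ For $k$ with $n_k>0$ let $\widehat n_k^-=(n_1,\dots,n_k-1,\dots,n_r)$ and $$D_{\widehat n_k^-}^{\mathrm{soc}(\mu^\centerdot)}=\mathrm{ind}_{G_{\widehat n_k^-}}^{G_{n-1}}\bigl((V_1^{\otimes n_1}\otimes D^{\mu^1})\otimes\cdots\otimes(V_k^{\otimes (n_k-1)}\otimes \mathrm{soc}(\mathrm{res}_{S_{n_k-1}}D^{\mu^k}))\otimes\cdots\otimes(V_r^{\otimes n_r}\otimes D^{\mu^r})\bigr).$$ Let $G_{n-1,1}\cong G_{n-1}\times G$ be the subgroup of $G_n$ generated by $G^n$ and $S_{n-1}$. Then each $D_{\widehat n_k^-}^{\mathrm{soc}(\mu^\centerdot)}$ is a semisimple $\mathbb FG_{n-1}$-module, and there is an isomorphism of $\mathbb F G_{n-1,1}$-modules $$\mathrm{soc}\bigl(\mathrm{res}_{G_{n-1,1}}D_{\widehat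 n}^{\mu^\centerdot}\bigr)\cong\bigoplus_{1\le k\le r,\ n_k>0}D_{\widehat n_k^-}^{\mathrm{soc}(\mu^\centerdot)}\otimes V_k ,$$ where $\otimes$ on the right is the outer tensor product of a $G_{n-1}$-module and a $G$-module. -/

import Mathlib

open scoped TensorProduct MonoidAlgebra DirectSum

universe u v w

noncomputable section

/-! ### Wreath products -/

/-- The wreath product `G^ι ⋊ Perm ι`, where `(w · g) i = g (w⁻¹ i)`; the group `G_n` is
`Wreath G (Fin n)`. -/
abbrev Wreath (G : Type v) [Group G] (ι : Type) : Type v :=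
  (ι → G) ⋊[(mulAutArrow : Equiv.Perm ι →* MulAut (ι → G))] Equiv.Perm ι

namespace Wreath

variable {G : Type v} [Group G]

theorem mul_left_apply {ι : Type} (x y : Wreath G ι) (i : ι) :
    (x * y).left i = x.left i * y.left (x.right.symm i) := rfl

theorem mul_right_apply {ι : Type} (x y : Wreath G ι) (i : ι) :
    (x * y).right i = x.right (y.right i) := rfl

/-- Transport of a wreath product along a bijection of the index sets. -/
def reindexHom {α β : Type} (e : α ≃ β) : Wreath G α →* Wreath G β where
  toFun x := ⟨fun b => x.left (e.symm b), e.permCongr x.right⟩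
  map_one' := by
    apply SemidirectProduct.ext
    · rfl
    · ext; simp
  map_mul' x y := by
    apply SemidirectProduct.ext
    · ext b
      rw [mul_left_apply, mul_left_apply]
      exact congrArg (x.left (e.symm b) * y.left ·) (e.symm_apply_apply _).symm
    · ext b; simp

/-- The embedding of a product of wreath products `∏ᵢ Wreath G (β i)` in the wreath product over the
disjoint union of the index sets. -/
def sigmaHom {κ : Type} (β : κ → Type) : (∀ i, Wreath G (β i)) →* Wreath G (Σ i, β i) where
  toFun x := ⟨fun q => (x q.1).left q.2, Equiv.Perm.sigmaCongrRightHom β fun i => (x i).right⟩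
  map_one' := by
    apply SemidirectProduct.ext
    · rfl
    · ext1 q; simp
  map_mul' x y := by
    apply SemidirectProduct.ext
    · ext q
      rw [mul_left_apply]
      simp only [Pi.mul_apply, mul_left_apply]
      rfl
    · ext1 q; simp

/-- The Young-type embedding `G_{n₁} × ⋯ × G_{n_r} → G_n`, `n = n₁ + ⋯ + n_r`, on consecutive
blocks. -/
def youngHom {r n : ℕ} (d : Fin r → ℕ) (h : ∑ i, d i = n) :
    (∀ i, Wreath G (Fin (d i))) →* Wreath G (Fin n) :=
  (reindexHom (finSigmaFinEquiv.trans (finCongr h))).comp (sigmaHom fun i => Fin (d i))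

/-- The embedding `G_n × G → G_{n+1}` whose image `G_{n,1}` consists of all `(g, w)` such that `w`
fixes the last letter; the factor `G` is the last factor of `G^{n+1}`. -/
def lastHom (n : ℕ) : Wreath G (Fin n) × G →* Wreath G (Fin (n + 1)) where
  toFun x := ⟨Fin.snoc x.1.left x.2, Equiv.Perm.viaEmbeddingHom Fin.castSuccEmb x.1.right⟩
  map_one' := by
    apply SemidirectProduct.ext
    · ext i
      refine Fin.lastCases ?_ (fun j => ?_) i <;> simp
    · simp
  map_mul' x y := by
    apply SemidirectProduct.ext
    · have hc : ∀ (e : Equiv.Perm (Fin n)) (j : Fin n),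
          (Equiv.Perm.viaEmbeddingHom Fin.castSuccEmb e).symm j.castSucc = (e.symm j).castSucc :=
        fun e j => by
          rw [Equiv.symm_apply_eq]
          exact (by simp :
            j.castSucc = (e (e.symm j)).castSucc).trans
              (Equiv.Perm.viaEmbedding_apply e Fin.castSuccEmb (e.symm j)).symm
      have hl : ∀ e : Equiv.Perm (Fin n),
          (Equiv.Perm.viaEmbeddingHom Fin.castSuccEmb e).symm (Fin.last n) = Fin.last n :=
        fun e => by
          rw [Equiv.symm_apply_eq]
          exact (Equiv.Perm.viaEmbedding_apply_of_notMem e Fin.castSuccEmb _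
            (by rintro ⟨j, hj⟩; exact (Fin.castSucc_lt_last j).ne hj)).symm
      ext i
      rw [mul_left_apply]
      refine Fin.lastCases ?_ (fun j => ?_) i
      · simp only [hl, Fin.snoc_last, Prod.snd_mul]
      · simp only [hc, Fin.snoc_castSucc, Prod.fst_mul, mul_left_apply]
    · simp

end Wreath

/-! ### Constructions with representations -/

section Reps

variable {F : Type u} [Field F]

/-- The socle: the sum of all simple submodules. -/
def socle {Γ : Type*} [Monoid Γ] {W : Type*} [AddCommGroup W] [Module F W]
    (τ : Representation F Γ W) : Subrepresentation τ :=
  Subrepresentation.ofSubmodule'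
    (sSup {N : Submodule F[Γ] τ.asModule | IsSimpleModule F[Γ] N})

/-- The outer tensor product `W₁ ⊗ W₂` of a `Γ₁`-module and a `Γ₂`-module, a module over
`Γ₁ × Γ₂`. -/
def outerTensor {Γ₁ Γ₂ W₁ W₂ : Type*} [Monoid Γ₁] [Monoid Γ₂] [AddCommGroup W₁] [Module F W₁]
    [AddCommGroup W₂] [Module F W₂] (τ₁ : Representation F Γ₁ W₁) (τ₂ : Representation F Γ₂ W₂) :
    Representation F (Γ₁ × Γ₂) (W₁ ⊗[F] W₂) :=
  Representation.tprod (τ₁.comp (MonoidHom.fst Γ₁ Γ₂)) (τ₂.comp (MonoidHom.snd Γ₁ Γ₂))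

/-- The outer tensor product `⨂ᵢ Wᵢ` of a family of `Γᵢ`-modules, a module over `∏ᵢ Γᵢ`. -/
def outerPiTensor {κ : Type*} {Γ W : κ → Type*} [∀ i, Monoid (Γ i)] [∀ i, AddCommGroup (W i)]
    [∀ i, Module F (W i)] (τ : ∀ i, Representation F (Γ i) (W i)) :
    Representation F (∀ i, Γ i) (⨂[F] i, W i) where
  toFun x := PiTensorProduct.map fun i => τ i (x i)
  map_one' := by simp
  map_mul' x y := by
    simp only [Pi.mul_apply, map_mul]
    exact PiTensorProduct.map_mul _ _

/-- The module `V^{⊗ ι}` over the wreath product `G^ι ⋊ Perm ι`: the base group acts factorwise and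
`Perm ι` permutes the tensor factors, `(g, w) (⨂ vᵢ) = ⨂ gᵢ v_{w⁻¹ i}`. -/
def wreathPower {G : Type v} [Group G] {V : Type w} [AddCommGroup V] [Module F V]
    (ρ : Representation F G V) (ι : Type) : Representation F (Wreath G ι) (⨂[F] _ : ι, V) where
  toFun x := (PiTensorProduct.map fun i => ρ (x.left i)) ∘ₗ
    (PiTensorProduct.reindex F (fun _ => V) x.right).toLinearMap
  map_one' := by
    ext m
    simp
    rfl
  map_mul' x y := by
    ext m
    simp only [LinearMap.compMultilinearMap_apply, LinearMap.comp_apply, LinearEquiv.coe_coe,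
      PiTensorProduct.reindex_tprod, PiTensorProduct.map_tprod, Module.End.mul_apply,
      Wreath.mul_left_apply, map_mul]
    rfl

/-- The module `V^{⊗ ι} ⊗ L` over `G^ι ⋊ Perm ι`, for a `Perm ι`-module `L`: the base group acts on
`V^{⊗ ι}` only, and `Perm ι` acts diagonally. -/
def wreathTensor {G : Type v} [Group G] {V : Type w} [AddCommGroup V] [Module F V]
    (ρ : Representation F G V) {ι : Type} {L : Type*} [AddCommGroup L] [Module F L]
    (τ : Representation F (Equiv.Perm ι) L) :
    Representation F (Wreath G ι) ((⨂[F] _ : ι, V) ⊗[F] L) :=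
  Representation.tprod (wreathPower ρ ι) (τ.comp SemidirectProduct.rightHom)

end Reps

/-! ### Modules over symmetric groups -/

/-- A natural number `deg` together with a module over the symmetric group `S_deg`. -/
structure SymRep (F : Type u) [Field F] where
  deg : ℕ
  carrier : Type u
  [addCommGroup : AddCommGroup carrier]
  [module : Module F carrier]
  rep : Representation F (Equiv.Perm (Fin deg)) carrier

attribute [instance] SymRep.addCommGroup SymRep.module

/-- `soc (res_{S_{m-1}} L)` for an `S_m`-module `L` (used for `m ≥ 1` only), where `S_{m-1}` is the
stabilizer of the last letter in `S_m`. -/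
def SymRep.socRes {F : Type u} [Field F] (L : SymRep F) : SymRep F where
  deg := L.deg - 1
  carrier := (socle (L.rep.comp (Equiv.Perm.viaEmbeddingHom
    (Fin.castLEEmb (Nat.sub_le L.deg 1))))).toSubmodule
  rep := (socle (L.rep.comp (Equiv.Perm.viaEmbeddingHom
    (Fin.castLEEmb (Nat.sub_le L.deg 1))))).toRepresentation

/-! ### The simple modules `D^μ` of symmetric groups -/

/-- A `μ`-tableau, recorded by the map sending each entry to the cell that it occupies. -/
def Tableau (μ : YoungDiagram) : Type := Fin μ.card ≃ μ.cells

namespace Tableau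

variable {μ : YoungDiagram}

/-- The row of the entry `x`. -/
def row (t : Tableau μ) (x : Fin μ.card) : ℕ := (Equiv.toFun t x).1.1

/-- The column of the entry `x`. -/
def col (t : Tableau μ) (x : Fin μ.card) : ℕ := (Equiv.toFun t x).1.2

/-- `σ • t` is obtained from `t` by replacing every entry `x` by `σ x`. -/
instance : MulAction (Equiv.Perm (Fin μ.card)) (Tableau μ) where
  smul σ t := Equiv.trans σ⁻¹ t
  one_smul _ := rfl
  mul_smul _ _ _ := rfl

theorem row_smul (σ : Equiv.Perm (Fin μ.card)) (t : Tableau μ) (x : Fin μ.card) :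
    (σ • t).row x = t.row (σ⁻¹ x) := rfl

theorem col_smul (σ : Equiv.Perm (Fin μ.card)) (t : Tableau μ) (x : Fin μ.card) :
    (σ • t).col x = t.col (σ⁻¹ x) := rfl

/-- Row equivalence of tableaux. -/
instance rowSetoid (μ : YoungDiagram) : Setoid (Tableau μ) where
  r t s := ∀ x, t.row x = s.row x
  iseqv := ⟨fun _ _ => rfl, fun h x => (h x).symm, fun h h' x => (h x).trans (h' x)⟩

end Tableau

/-- A `μ`-tabloid: a row equivalence class of `μ`-tableaux. -/
def Tabloid (μ : YoungDiagram) : Type := Quotient (Tableau.rowSetoid μ)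

namespace Tabloid

variable {μ : YoungDiagram}

/-- The tabloid of a tableau. -/
def mk (t : Tableau μ) : Tabloid μ := Quotient.mk _ t

instance : MulAction (Equiv.Perm (Fin μ.card)) (Tabloid μ) where
  smul σ := Quotient.map (σ • ·) fun _ _ h x => h (σ⁻¹ x)
  one_smul T := Quotient.inductionOn T fun _ => rfl
  mul_smul _ _ T := Quotient.inductionOn T fun _ => rfl

theorem smul_mk (σ : Equiv.Perm (Fin μ.card)) (t : Tableau μ) : σ • mk t = mk (σ • t) := rfl

end Tabloid

section Specht

variable (F : Type u) [Field F] (μ : YoungDiagram)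

/-- The permutation module `M^μ`, with basis the set of `μ`-tabloids. -/
abbrev permModule : Representation F (Equiv.Perm (Fin μ.card)) F[Tabloid μ] :=
  Representation.ofMulAction F (Equiv.Perm (Fin μ.card)) (Tabloid μ)

variable {μ}

/-- The polytabloid `e_t = ∑_σ sgn(σ) {σ t}`, the sum over the column stabilizer of `t`. -/
def polytabloid (t : Tableau μ) : F[Tabloid μ] :=
  ∑ σ : Equiv.Perm (Fin μ.card) with ∀ x, t.col (σ x) = t.col x,
    MonoidAlgebra.single (Tabloid.mk (σ • t)) ((Equiv.Perm.sign σ : ℤ) : F)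

theorem permModule_polytabloid (τ : Equiv.Perm (Fin μ.card)) (t : Tableau μ) :
    permModule F μ τ (polytabloid F t) = polytabloid F (τ • t) := by
  classical
  unfold polytabloid
  rw [map_sum]
  refine Finset.sum_equiv (MulAut.conj τ).toEquiv (fun σ => ?_) (fun σ _ => ?_)
  · rw [Finset.mem_filter, Finset.mem_filter]
    refine and_congr (by simp) ⟨fun h x => ?_, fun h x => ?_⟩
    · simpa [Tableau.col_smul] using h (τ⁻¹ x)
    · simpa [Tableau.col_smul] using h (τ x)
  · have hs : Equiv.Perm.sign ((MulAut.conj τ).toEquiv σ) = Equiv.Perm.sign σ := by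
      change Equiv.Perm.sign (τ * σ * τ⁻¹) = _
      rw [map_mul, map_mul, map_inv, mul_inv_cancel_comm]
    rw [hs, Representation.ofMulAction_single, Tabloid.smul_mk]
    simp [mul_smul]

variable (μ)

/-- The Specht module `S^μ`, spanned by the polytabloids. -/
def specht : Subrepresentation (permModule F μ) where
  toSubmodule := Submodule.span F (Set.range (polytabloid F (μ := μ)))
  apply_mem_toSubmodule τ v hv := by
    have h := Submodule.mem_map_of_mem (f := permModule F μ τ) hv
    rw [Submodule.map_span] at h
    refine Submodule.span_mono ?_ h
    rintro _ ⟨_, ⟨t, rfl⟩, rfl⟩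
    exact ⟨τ • t, (permModule_polytabloid F τ t).symm⟩

variable {F μ} in
/-- The symmetric bilinear form on `M^μ` for which the tabloids are an orthonormal basis. -/
def tabloidForm (a b : F[Tabloid μ]) : F := a.coeff.sum fun T c => c * b.coeff T

variable {F μ} in
theorem tabloidForm_perm (τ : Equiv.Perm (Fin μ.card)) (a b : F[Tabloid μ]) :
    tabloidForm a (permModule F μ τ b) = tabloidForm (permModule F μ τ⁻¹ a) b := by
  unfold tabloidForm
  rw [Representation.ofMulAction_def (g := τ⁻¹)]
  simp only [Representation.coeff_ofMulAction, LinearMap.comp_apply, LinearEquiv.coe_coe,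
    MonoidAlgebra.coeffLinearEquiv_apply, MonoidAlgebra.coeffLinearEquiv_symm_apply,
    Finsupp.lmapDomain_apply]
  rw [Finsupp.sum_mapDomain_index (by simp) (by intros; ring)]

/-- The submodule `S^μ ∩ (S^μ)^⊥` of `S^μ`. -/
def spechtRadical : Submodule F (specht F μ).toSubmodule where
  carrier := {x | ∀ y ∈ specht F μ, tabloidForm y (x : F[Tabloid μ]) = 0}
  zero_mem' := by intro y _; simp [tabloidForm]
  add_mem' {a b} ha hb y hy := by
    have h : tabloidForm y ((a : F[Tabloid μ]) + b) =
        tabloidForm y (a : F[Tabloid μ]) + tabloidForm y (b : F[Tabloid μ]) := by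
      simp [tabloidForm, mul_add, Finsupp.sum_add]
    simpa [ha y hy, hb y hy] using h
  smul_mem' c a ha y hy := by
    have h : tabloidForm y (c • (a : F[Tabloid μ])) = c * tabloidForm y (a : F[Tabloid μ]) := by
      simp [tabloidForm, Finsupp.mul_sum, mul_left_comm]
    simpa [ha y hy] using h

theorem spechtRadical_le_comap (τ : Equiv.Perm (Fin μ.card)) :
    spechtRadical F μ ≤ (spechtRadical F μ).comap ((specht F μ).toRepresentation τ) := by
  intro x hx y hy
  change tabloidForm y (permModule F μ τ x) = 0
  rw [tabloidForm_perm]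
  exact hx _ ((specht F μ).apply_mem_toSubmodule τ⁻¹ hy)

/-- The module `D^μ = S^μ / (S^μ ∩ (S^μ)^⊥)` over the symmetric group of degree `|μ|`, which is
simple if `μ` is `p`-regular, `p` the characteristic of `F`. -/
def dModule : SymRep F where
  deg := μ.card
  carrier := (specht F μ).toSubmodule ⧸ spechtRadical F μ
  rep := (specht F μ).toRepresentation.quotient (spechtRadical F μ) (spechtRadical_le_comap F μ)

end Specht

/-- A partition is `p`-regular if it does not have `p` equal (nonzero) parts; for `p = 0` every
partition is regular. -/
def IsPRegular (p : ℕ) (μ : YoungDiagram) : Prop := p = 0 ∨ ∀ a, μ.rowLens.count a < p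

/-! ### The modules `D_{n̂}` of wreath products -/

section Induced

variable {F : Type u} [Field F] {G : Type v} [Group G] {r : ℕ} {V : Fin r → Type w}
  [∀ i, AddCommGroup (V i)] [∀ i, Module F (V i)]

variable (V) in
/-- The vector space `(V₁^{⊗ n₁} ⊗ L₁) ⊗ ⋯ ⊗ (V_r^{⊗ n_r} ⊗ L_r)`. -/
def YoungSpace (L : Fin r → SymRep F) : Type (max u w) :=
  ⨂[F] i, (⨂[F] _ : Fin (L i).deg, V i) ⊗[F] (L i).carrier

instance (L : Fin r → SymRep F) : AddCommGroup (YoungSpace V L) :=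
  inferInstanceAs (AddCommGroup (⨂[F] i, (⨂[F] _ : Fin (L i).deg, V i) ⊗[F] (L i).carrier))

instance (L : Fin r → SymRep F) : Module F (YoungSpace V L) :=
  inferInstanceAs (Module F (⨂[F] i, (⨂[F] _ : Fin (L i).deg, V i) ⊗[F] (L i).carrier))

/-- The module `(V₁^{⊗ n₁} ⊗ L₁) ⊗ ⋯ ⊗ (V_r^{⊗ n_r} ⊗ L_r)` over `G_{n₁} × ⋯ × G_{n_r}`, where `L_i`
is a module over the symmetric group of degree `n_i`. -/
def youngRep (ρ : ∀ i, Representation F G (V i)) (L : Fin r → SymRep F) :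
    Representation F (∀ i, Wreath G (Fin (L i).deg)) (YoungSpace V L) :=
  outerPiTensor fun i => wreathTensor (ρ i) (L i).rep

/-- The `G_n`-module induced from the module
`(V₁^{⊗ n₁} ⊗ L₁) ⊗ ⋯ ⊗ (V_r^{⊗ n_r} ⊗ L_r)` over `G_{n₁} × ⋯ × G_{n_r}`, where
`n = n₁ + ⋯ + n_r`. -/
def wreathInd (ρ : ∀ i, Representation F G (V i)) (L : Fin r → SymRep F) {n : ℕ}
    (h : ∑ i, (L i).deg = n) :
    Representation F (Wreath G (Fin n))
      (Representation.IndV (Wreath.youngHom (G := G) (fun i => (L i).deg) h) (youngRep ρ L)) :=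
  Representation.ind (Wreath.youngHom (G := G) (fun i => (L i).deg) h) (youngRep ρ L)

/-- The family obtained from `L` by replacing the `k`-th member `L_k`, a module over the symmetric
group of degree `n_k`, by `soc (res L_k)`, a module over the symmetric group of degree `n_k - 1`. -/
def socFamily (L : Fin r → SymRep F) (k : Fin r) : Fin r → SymRep F :=
  Function.update L k (L k).socRes

theorem sum_deg_socFamily (L : Fin r → SymRep F) {n : ℕ} (h : ∑ i, (L i).deg = n + 1) (k : Fin r)
    (hk : 0 < (L k).deg) : ∑ i, (socFamily L k i).deg = n := by
  have h1 := Finset.add_sum_erase Finset.univ (fun i => (L i).deg) (Finset.mem_univ k)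
  have h2 := Finset.add_sum_erase Finset.univ (fun i => (socFamily L k i).deg) (Finset.mem_univ k)
  have h3 : ∑ i ∈ Finset.univ.erase k, (socFamily L k i).deg =
      ∑ i ∈ Finset.univ.erase k, (L i).deg := by
    refine Finset.sum_congr rfl fun i hi => ?_
    rw [socFamily, Function.update_of_ne (Finset.ne_of_mem_erase hi)]
  have h4 : (socFamily L k k).deg = (L k).deg - 1 := by
    rw [socFamily, Function.update_self]; rfl
  omega

end Induced

end

/-! The proof replaces modules by their multiplicity spaces. Let elements e_k of a ring A cut an
A-module X down to spaces e_k X = Y_k. Suppose that the compressions y ↦ e_k a y of the elements a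
of A realise exactly the action of a ring B_k on Y_k, that e_k A Y_l = 0 for k ≠ l, and that the
two-sided ideal generated by the e_k acts unitally on X. As in Morita theory, submodules of X are
then families of submodules of the Y_k (`IsModuleCorner.orderIso`). So semisimplicity and the socle
can be read off from the Y_k, and X is determined up to isomorphism by the e_k, the compressions and
the Y_k (`IsModuleCorner.nonempty_linearEquiv`). The e_k need not be idempotent in A, only their
action on X matters, and compression need not be multiplicative.

By density, F[G] contains elements ε_i that act on V_i as a rank one idempotent x ↦ f_i(x) v_i and
kill V_j for j ≠ i (`exists_rank_one_idempotents`). An induced module is the direct sum of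
translates indexed by the cosets s of the Young subgroup. Consider the tensor in F[G^n] whose j-th
factor is ε_i, where i is the block (colour) of s⁻¹ j. It kills all translates except the one by s,
which it compresses to L_1 ⊗ ⋯ ⊗ L_r; since v_i ⊗ ⋯ ⊗ v_i is invariant under permutations, the Young
subgroup acts there through the L_i alone. For the restriction to a subgroup containing the base
group, one such tensor per double coset suffices, and the multiplicity space is restricted to the
corresponding subgroup of the Young subgroup (`isModuleCorner_wreathInd`). For G_{n,1} the double
cosets correspond to the nonempty blocks k, namely to the block that is sent to the last letter, and
the k-th block loses a letter.

The k-th multiplicity space is thus the outer tensor product of res L_k with the L_i, i ≠ k, which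
are irreducible or zero. Over an algebraically closed field its socle is obtained by passing to the
socle of res L_k (`range_outerPiMap_eq_moduleSocle`). The direct sum in the theorem has these socles
as multiplicity spaces, for the same e_k and the same compressions, so it is isomorphic to the socle
of the restriction. The same description shows that its left-hand factors are semisimple. Finally,
D^μ is irreducible or zero by James's submodule theorem (`eq_top_or_le_spechtRadical`). -/

noncomputable section

/-! ### Modules governed by corners of a ring -/

section Corner

variable {A : Type*} [Ring A] {K : Type*} {B : K → Type*} [∀ k, Ring (B k)]

/-- The `A`-module `X` is governed by the `B k`-modules `Y k` via the elements `e k` of `A`: the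
images of the `Y k` are the spaces `e k • X`, the compression of the action of `a` to `Y k` is
`t k a`, and the two-sided ideal generated by the `e k` acts unitally on `X`. -/
structure IsModuleCorner (e : K → A) (t : ∀ k, A → B k) {X : Type*} [AddCommGroup X] [Module A X]
    {Y : K → Type*} [∀ k, AddCommGroup (Y k)] [∀ k, Module (B k) (Y k)]
    (ι : ∀ k, Y k →+ X) : Prop where
  injective : ∀ k, Function.Injective (ι k)
  surjective : ∀ k, Function.Surjective (t k)
  exists_smul_eq : ∀ k x, ∃ y, e k • x = ι k y
  smul_smul : ∀ k (a : A) (y : Y k), e k • a • ι k y = ι k (t k a • y)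
  smul_smul_of_ne : ∀ k l, k ≠ l → ∀ (a : A) (y : Y l), e k • a • ι l y = 0
  unital : ∀ x : X, ∃ u ∈ TwoSidedIdeal.span (Set.range e), u • x = x

/-- The sum of all simple submodules. -/
def moduleSocle (A X : Type*) [Ring A] [AddCommGroup X] [Module A X] : Submodule A X :=
  sSup {N : Submodule A X | IsSimpleModule A N}

namespace IsModuleCorner

variable {e : K → A} {t : ∀ k, A → B k} {X : Type*} [AddCommGroup X] [Module A X]
  {Y : K → Type*} [∀ k, AddCommGroup (Y k)] [∀ k, Module (B k) (Y k)] {ι : ∀ k, Y k →+ X}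

/-- The submodule of `X` generated by submodules of the `Y k`. -/
def induced (ι : ∀ k, Y k →+ X) (N : ∀ k, Submodule (B k) (Y k)) : Submodule A X :=
  Submodule.span A {x | ∃ k, ∃ y ∈ N k, ι k y = x}

theorem mem_induced (N : ∀ k, Submodule (B k) (Y k)) {k : K} {y : Y k} (hy : y ∈ N k) :
    ι k y ∈ induced (A := A) ι N :=
  Submodule.subset_span ⟨k, y, hy, rfl⟩

/-- The submodule of `Y k` of the elements whose image lies in `M`. -/
def restrict (h : IsModuleCorner e t ι) (M : Submodule A X) (k : K) : Submodule (B k) (Y k) where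
  carrier := {y | ι k y ∈ M}
  zero_mem' := by simp
  add_mem' ha hb := by
    simp only [Set.mem_ofPred_eq, map_add] at *
    exact M.add_mem ha hb
  smul_mem' b y hy := by
    obtain ⟨a, rfl⟩ := h.surjective k b
    change ι k _ ∈ M
    rw [← h.smul_smul]
    exact M.smul_mem _ (M.smul_mem _ hy)

/-- Applying e_k a to the submodule generated by the N l always lands in the image of N k. For an a
whose compression to Y k is 1, this operation returns y itself. -/
theorem mem_induced_iff (h : IsModuleCorner e t ι) (N : ∀ k, Submodule (B k) (Y k)) (k : K)
    (y : Y k) : ι k y ∈ induced (A := A) ι N ↔ y ∈ N k := by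
  refine ⟨fun hy => ?_, mem_induced N⟩
  have key : ∀ x ∈ induced (A := A) ι N, ∀ a : A, ∃ z ∈ N k, e k • a • x = ι k z := by
    intro x hx
    induction hx using Submodule.span_induction with
    | mem x hx =>
      obtain ⟨l, z, hz, rfl⟩ := hx
      intro a
      by_cases hkl : k = l
      · subst hkl
        exact ⟨_, (N k).smul_mem _ hz, h.smul_smul k a z⟩
      · exact ⟨0, (N k).zero_mem, by rw [h.smul_smul_of_ne k l hkl, map_zero]⟩
    | zero => exact fun a => ⟨0, (N k).zero_mem, by simp⟩
    | add x y _ _ hx hy =>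
      intro a
      obtain ⟨z, hz, hz'⟩ := hx a
      obtain ⟨w, hw, hw'⟩ := hy a
      exact ⟨z + w, (N k).add_mem hz hw, by rw [smul_add, smul_add, hz', hw', map_add]⟩
    | smul b x _ hx =>
      intro a
      obtain ⟨z, hz, hz'⟩ := hx (a * b)
      exact ⟨z, hz, by rw [← hz', mul_smul]⟩
  obtain ⟨a, ha⟩ := h.surjective k 1
  obtain ⟨z, hz, hz'⟩ := key _ hy a
  rw [h.smul_smul, ha, one_smul] at hz'
  rwa [h.injective k hz']

theorem restrict_induced (h : IsModuleCorner e t ι) (N : ∀ k, Submodule (B k) (Y k)) (k : K) :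
    h.restrict (induced ι N) k = N k := by
  ext y; exact h.mem_induced_iff N k y

/-- Every x is u • x with u a sum of terms ± c e_k b, and each e_k b x lies both in M and in the
image of Y k. So a submodule is determined by its intersections with these images. -/
theorem le_of_forall_mem (h : IsModuleCorner e t ι) {M M' : Submodule A X}
    (hM : ∀ k y, ι k y ∈ M → ι k y ∈ M') : M ≤ M' := by
  intro x hx
  have key : ∀ u ∈ TwoSidedIdeal.span (Set.range e), ∀ a : A, u • a • x ∈ M' := by
    intro u hu
    rw [TwoSidedIdeal.mem_span_iff_mem_addSubgroup_closure] at hu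
    induction hu using AddSubgroup.closure_induction with
    | mem u hu =>
      intro a
      obtain ⟨_, ⟨c, -, _, ⟨k, rfl⟩, rfl⟩, b, -, rfl⟩ := hu
      obtain ⟨y, hy⟩ := h.exists_smul_eq k (b • a • x)
      simp only [mul_smul]
      rw [hy]
      refine M'.smul_mem _ (hM k y ?_)
      rw [← hy]
      exact M.smul_mem _ (M.smul_mem _ (M.smul_mem _ hx))
    | zero => simp
    | add u v _ _ hu hv => exact fun a => by rw [add_smul]; exact M'.add_mem (hu a) (hv a)
    | neg u _ hu => exact fun a => by rw [neg_smul]; exact M'.neg_mem (hu a)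
  obtain ⟨u, hu, hux⟩ := h.unital x
  simpa [hux] using key u hu 1

theorem induced_restrict (h : IsModuleCorner e t ι) (M : Submodule A X) :
    induced ι (h.restrict M) = M := by
  refine le_antisymm (Submodule.span_le.2 ?_) (h.le_of_forall_mem fun k y hy => mem_induced _ hy)
  rintro _ ⟨k, y, hy, rfl⟩
  exact hy

theorem induced_mono {N N' : ∀ k, Submodule (B k) (Y k)} (hN : N ≤ N') :
    induced (A := A) ι N ≤ induced ι N' :=
  Submodule.span_mono fun _ ⟨k, y, hy, hx⟩ => ⟨k, y, hN k hy, hx⟩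

/-- Submodules of `X` correspond to families of submodules of the `Y k`. -/
def orderIso (h : IsModuleCorner e t ι) : Submodule A X ≃o ∀ k, Submodule (B k) (Y k) where
  toFun M := h.restrict M
  invFun N := induced ι N
  left_inv M := h.induced_restrict M
  right_inv N := funext fun k => h.restrict_induced N k
  map_rel_iff' {M M'} := by
    refine ⟨fun hM => ?_, fun hM k y hy => hM hy⟩
    rw [← h.induced_restrict M, ← h.induced_restrict M']
    exact induced_mono hM

/-- Semisimplicity means that the submodule lattice is complemented, and complements in a product of
lattices are taken coordinatewise. -/
theorem isSemisimpleModule (h : IsModuleCorner e t ι) (hY : ∀ k, IsSemisimpleModule (B k) (Y k)) :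
    IsSemisimpleModule A X := by
  rw [isSemisimpleModule_iff, h.orderIso.complementedLattice_iff]
  choose c hc using fun k => ((isSemisimpleModule_iff (B k) (Y k)).1 (hY k)).exists_isCompl
  exact ⟨fun N => ⟨fun k => c k (N k), Pi.isCompl_iff.2 fun k => hc k (N k)⟩⟩

/-- The socle is the supremum of the atoms, and an atom of a product of lattices is an atom in one
coordinate and ⊥ in the others. -/
theorem moduleSocle_eq (h : IsModuleCorner e t ι) :
    moduleSocle A X = induced ι fun k => moduleSocle (B k) (Y k) := by
  classical
  apply h.orderIso.injective
  have h1 : ∀ N : Submodule A X, IsSimpleModule A N ↔ IsAtom N := fun N => isSimpleModule_iff_isAtom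
  have h2 : ∀ k, ∀ N : Submodule (B k) (Y k), IsSimpleModule (B k) N ↔ IsAtom N :=
    fun k N => isSimpleModule_iff_isAtom
  change _ = h.orderIso (h.orderIso.symm _)
  rw [OrderIso.apply_symm_apply]
  unfold moduleSocle
  rw [OrderIso.map_sSup]
  funext k
  simp only [h1, h2]
  refine le_antisymm ?_ (sSup_le fun N hN => ?_)
  · rw [iSup_apply]
    refine iSup_le fun M => ?_
    rw [iSup_apply]
    refine iSup_le fun hM => ?_
    have hM' : IsAtom (h.orderIso M) := (h.orderIso.isAtom_iff M).2 hM
    obtain ⟨l, hl, hl'⟩ := Pi.isAtom_iff.1 hM'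
    by_cases hkl : k = l
    · subst hkl
      exact le_sSup hl
    · rw [hl' k hkl]
      exact bot_le
  · have hatom : IsAtom (Function.update (⊥ : ∀ k, Submodule (B k) (Y k)) k N) := by
      refine Pi.isAtom_iff.2 ⟨k, by simpa using hN, fun j hj => by simp [hj]⟩
    have hM : IsAtom (h.orderIso.symm (Function.update ⊥ k N)) :=
      (h.orderIso.symm.isAtom_iff _).2 hatom
    have := le_iSup₂ (f := fun M (_ : M ∈ {N : Submodule A X | IsAtom N}) => h.orderIso M) _ hM k
    simpa using this

/-- The submodule generated by the images of injective maps `Y' k → Y k` is governed by the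
modules `Y' k`. -/
theorem induced_range (h : IsModuleCorner e t ι) {Y' : K → Type*} [∀ k, AddCommGroup (Y' k)]
    [∀ k, Module (B k) (Y' k)] (φ : ∀ k, Y' k →ₗ[B k] Y k) (hφ : ∀ k, Function.Injective (φ k)) :
    IsModuleCorner e t (X := induced (A := A) ι fun k => LinearMap.range (φ k)) (fun k =>
      ((ι k).comp (φ k).toAddMonoidHom).codRestrict
        (induced (A := A) ι fun k => LinearMap.range (φ k))
        fun y => mem_induced _ ⟨y, rfl⟩) where
  injective k := fun y z hyz => hφ k (h.injective k (congrArg Subtype.val hyz))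
  surjective := h.surjective
  exists_smul_eq k x := by
    obtain ⟨y, hy⟩ := h.exists_smul_eq k x.1
    have : y ∈ LinearMap.range (φ k) := by
      rw [← h.mem_induced_iff (fun k => LinearMap.range (φ k)), ← hy]
      exact Submodule.smul_mem _ _ x.2
    obtain ⟨z, rfl⟩ := this
    exact ⟨z, Subtype.ext hy⟩
  smul_smul k a y := Subtype.ext <| by
    change e k • a • ι k (φ k y) = ι k (φ k _)
    rw [h.smul_smul, (φ k).map_smul]
  smul_smul_of_ne k l hkl a y := Subtype.ext (h.smul_smul_of_ne k l hkl a (φ l y))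
  unital x := by
    obtain ⟨u, hu, hux⟩ := h.unital x.1
    exact ⟨u, hu, Subtype.ext hux⟩

/-- The element used is 1 - (1 - b)(1 - a), where a fixes x and b fixes x' - a • x'. -/
theorem unital_prod {X' : Type*} [AddCommGroup X'] [Module A X'] (I : TwoSidedIdeal A)
    (hX : ∀ x : X, ∃ u ∈ I, u • x = x) (hX' : ∀ x : X', ∃ u ∈ I, u • x = x) (x : X) (x' : X') :
    ∃ u ∈ I, u • x = x ∧ u • x' = x' := by
  obtain ⟨a, ha, hax⟩ := hX x
  obtain ⟨b, hb, hbx⟩ := hX' (x' - a • x')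
  refine ⟨a + b - b * a, I.sub_mem (I.add_mem ha hb) (I.mul_mem_left _ _ ha), ?_, ?_⟩
  · rw [sub_smul, add_smul, mul_smul, hax]; abel
  · rw [sub_smul, add_smul, mul_smul]
    rw [smul_sub, sub_eq_iff_eq_add] at hbx
    rw [hbx]; abel

/-- Two modules governed by the same data are isomorphic. -/
theorem nonempty_linearEquiv (h : IsModuleCorner e t ι) {X' : Type*} [AddCommGroup X'] [Module A X']
    {ι' : ∀ k, Y k →+ X'} (h' : IsModuleCorner e t ι') : Nonempty (X ≃ₗ[A] X') := by
  have hd : IsModuleCorner e t (X := X × X') (Y := fun k => Y k × Y k)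
      (fun k => (ι k).prodMap (ι' k)) :=
    { injective := fun k => (h.injective k).prodMap (h'.injective k)
      surjective := h.surjective
      exists_smul_eq := fun k x => by
        obtain ⟨y, hy⟩ := h.exists_smul_eq k x.1
        obtain ⟨z, hz⟩ := h'.exists_smul_eq k x.2
        exact ⟨(y, z), Prod.ext hy hz⟩
      smul_smul := fun k a y => Prod.ext (h.smul_smul k a y.1) (h'.smul_smul k a y.2)
      smul_smul_of_ne := fun k l hkl a y =>
        Prod.ext (h.smul_smul_of_ne k l hkl a y.1) (h'.smul_smul_of_ne k l hkl a y.2)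
      unital := fun x => by
        obtain ⟨u, hu, h1, h2⟩ := unital_prod _ h.unital h'.unital x.1 x.2
        exact ⟨u, hu, Prod.ext h1 h2⟩ }
  -- The graph of the desired isomorphism, as in Goursat's lemma: the submodule of X × X' that
  -- corresponds to the diagonals of Y k × Y k. Both projections of D turn out to be bijective.
  let D : Submodule A (X × X') := induced (fun k => (ι k).prodMap (ι' k)) fun k =>
    LinearMap.range ((LinearMap.id : Y k →ₗ[B k] Y k).prod LinearMap.id)
  have hD : ∀ k y z, (ι k y, ι' k z) ∈ D ↔ y = z := fun k y z => by
    refine (hd.mem_induced_iff _ k (y, z)).trans ⟨?_, ?_⟩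
    · rintro ⟨w, hw⟩
      exact (congrArg Prod.fst hw).symm.trans (congrArg Prod.snd hw)
    · rintro rfl
      exact ⟨y, rfl⟩
  let p : D →ₗ[A] X := (LinearMap.fst A X X').comp D.subtype
  let q : D →ₗ[A] X' := (LinearMap.snd A X X').comp D.subtype
  have hp : Function.Bijective p := by
    constructor
    · rw [← LinearMap.ker_eq_bot, LinearMap.ker_eq_bot']
      rintro ⟨⟨x, x'⟩, hx⟩ (rfl : x = 0)
      -- It is enough to test elements (ι y, ι' z): membership in D forces y = z, and vanishing of
      -- the first coordinate forces y = 0.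
      have : D ⊓ Submodule.prod ⊥ ⊤ ≤ ⊥ := hd.le_of_forall_mem <| by
        rintro k ⟨y, z⟩ ⟨h1, h2, -⟩
        have hy : y = 0 := h.injective k (by simpa using! h2)
        have : y = z := (hD k y z).1 h1
        subst this
        subst hy
        simp
      have h0 := this ⟨hx, by simp⟩
      exact Subtype.ext h0
    · rw [← LinearMap.range_eq_top, eq_top_iff]
      exact h.le_of_forall_mem fun k y _ => ⟨⟨(ι k y, ι' k y), (hD k y y).2 rfl⟩, rfl⟩
  have hq : Function.Bijective q := by
    constructor
    · rw [← LinearMap.ker_eq_bot, LinearMap.ker_eq_bot']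
      rintro ⟨⟨x, x'⟩, hx⟩ (rfl : x' = 0)
      have : D ⊓ Submodule.prod ⊤ ⊥ ≤ ⊥ := hd.le_of_forall_mem <| by
        rintro k ⟨y, z⟩ ⟨h1, -, h2⟩
        have hz : z = 0 := h'.injective k (by simpa using! h2)
        have : y = z := (hD k y z).1 h1
        subst this
        subst hz
        simp
      have h0 := this ⟨hx, by simp⟩
      exact Subtype.ext h0
    · rw [← LinearMap.range_eq_top, eq_top_iff]
      exact h'.le_of_forall_mem fun k y _ => ⟨⟨(ι k y, ι' k y), (hD k y y).2 rfl⟩, rfl⟩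
  exact ⟨(LinearEquiv.ofBijective p hp).symm.trans (LinearEquiv.ofBijective q hq)⟩

/-- The socle of a module governed by the `Y k` is determined by the socles of the `Y k`. -/
theorem nonempty_moduleSocle_linearEquiv (h : IsModuleCorner e t ι) {Y' : K → Type*}
    [∀ k, AddCommGroup (Y' k)] [∀ k, Module (B k) (Y' k)] (φ : ∀ k, Y' k →ₗ[B k] Y k)
    (hφ : ∀ k, Function.Injective (φ k))
    (hsoc : ∀ k, LinearMap.range (φ k) = moduleSocle (B k) (Y k)) {X' : Type*} [AddCommGroup X']
    [Module A X'] {ι' : ∀ k, Y' k →+ X'} (h' : IsModuleCorner e t ι') :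
    Nonempty (moduleSocle A X ≃ₗ[A] X') := by
  have : moduleSocle A X = induced ι fun k => LinearMap.range (φ k) := by
    simp only [hsoc]
    exact h.moduleSocle_eq
  rw [this]
  exact (h.induced_range φ hφ).nonempty_linearEquiv h'

/-- A finite direct sum of modules `Z k`, each governed by a single module `Y k`, such that `e k`
kills `Z l` for `l ≠ k`, is governed by the family `Y`. -/
theorem of_directSum [Fintype K] [DecidableEq K] {Z : K → Type*} [∀ k, AddCommGroup (Z k)]
    [∀ k, Module A (Z k)] {ι : ∀ k, Y k →+ Z k}
    (h : ∀ k, IsModuleCorner (K := Unit) (fun _ => e k) (fun _ => t k) (fun _ => ι k))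
    (hne : ∀ k l, k ≠ l → ∀ z : Z l, e k • z = 0) (j : ∀ k, Z k →ₗ[A] X) (p : ∀ k, X →ₗ[A] Z k)
    (hpj : ∀ k z, p k (j k z) = z) (hsum : ∀ x, ∑ k, j k (p k x) = x) :
    IsModuleCorner e t fun k => (j k).toAddMonoidHom.comp (ι k) where
  injective k := (Function.LeftInverse.injective (hpj k)).comp ((h k).injective ())
  surjective k := (h k).surjective ()
  exists_smul_eq k x := by
    obtain ⟨y, hy⟩ := (h k).exists_smul_eq () (p k x)
    refine ⟨y, ?_⟩
    change _ = j k (ι k y)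
    rw [← hy]
    conv_lhs => rw [← hsum x, Finset.smul_sum]
    rw [Finset.sum_eq_single k]
    · rw [map_smul]
    · intro l _ hl
      rw [← map_smul, hne k l hl.symm, map_zero]
    · simp
  smul_smul k a y := by
    change e k • a • j k (ι k y) = j k (ι k _)
    rw [← (h k).smul_smul () a y, map_smul, map_smul]
  smul_smul_of_ne k l hkl a y := by
    change e k • a • j l (ι l y) = 0
    rw [← map_smul, ← map_smul, hne k l hkl, map_zero]
  unital x := by
    -- The summands are fixed one at a time, each new one by the correction 1 - (1 - b)(1 - a); b
    -- kills no information already gained because 1 - a annihilates the earlier summands.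
    have key : ∀ s : Finset K, ∃ u ∈ TwoSidedIdeal.span (Set.range e),
        u • ∑ k ∈ s, j k (p k x) = ∑ k ∈ s, j k (p k x) := by
      intro s
      induction s using Finset.induction_on with
      | empty => exact ⟨0, zero_mem _, by simp⟩
      | insert k s hk ih =>
        obtain ⟨a, ha, hax⟩ := ih
        obtain ⟨b, hb, hbx⟩ := (h k).unital (p k x - a • p k x)
        have hb' : b ∈ TwoSidedIdeal.span (Set.range e) :=
          TwoSidedIdeal.span_mono (by rintro _ ⟨_, rfl⟩; exact ⟨k, rfl⟩) hb
        refine ⟨a + b - b * a, sub_mem (add_mem ha hb') (TwoSidedIdeal.mul_mem_left _ _ _ ha), ?_⟩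
        have hbx' := congrArg (j k) hbx
        simp only [map_smul, map_sub, smul_sub] at hbx'
        rw [Finset.sum_insert hk, smul_add, sub_smul, sub_smul, add_smul, add_smul, mul_smul,
          mul_smul, hax]
        rw [sub_eq_iff_eq_add] at hbx'
        rw [hbx']
        abel
    simpa [hsum] using key Finset.univ

end IsModuleCorner

end Corner

/-! ### Corners for group representations -/

section CornerRep

variable {F : Type*} [Field F] {Γ : Type*}

/-- The linear map between group algebras extending a map on group elements. -/
def groupAlgebraLift {Δ : Type*} (T : Γ → F[Δ]) : F[Γ] →ₗ[F] F[Δ] :=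
  (Finsupp.linearCombination F T).comp (MonoidAlgebra.coeffLinearEquiv F).toLinearMap

@[simp]
theorem groupAlgebraLift_single {Δ : Type*} (T : Γ → F[Δ]) (g : Γ) (c : F) :
    groupAlgebraLift T (MonoidAlgebra.single g c) = c • T g := by
  simp [groupAlgebraLift]

/-- All conditions on the compressions are linear in the element of the group algebra, so they need
to be checked on group elements only. Here T k g is the compression of g. -/
theorem IsModuleCorner.of_rep [Group Γ] {K : Type*} {S : K → Type*} [∀ k, Group (S k)] {X : Type*}
    [AddCommGroup X] [Module F X] (ρ : Representation F Γ X) {Y : K → Type*}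
    [∀ k, AddCommGroup (Y k)] [∀ k, Module F (Y k)] (τ : ∀ k, Representation F (S k) (Y k))
    (e : K → F[Γ]) (T : ∀ k, Γ → F[S k]) (ι : ∀ k, Y k →ₗ[F] X)
    (hinj : ∀ k, Function.Injective (ι k))
    (hsurj : ∀ k (σ : S k), ∃ g, T k g = MonoidAlgebra.single σ 1)
    (hrange : ∀ k x, ∃ y, ρ.asAlgebraHom (e k) x = ι k y)
    (hsame : ∀ k g y, ρ.asAlgebraHom (e k) (ρ g (ι k y)) = ι k ((τ k).asAlgebraHom (T k g) y))
    (hne : ∀ k l, k ≠ l → ∀ g y, ρ.asAlgebraHom (e k) (ρ g (ι l y)) = 0)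
    (hunital : ∀ x, ∃ u ∈ TwoSidedIdeal.span (Set.range e), ρ.asAlgebraHom u x = x) :
    IsModuleCorner e (fun k => groupAlgebraLift (T k)) (X := ρ.asModule)
      (Y := fun k => (τ k).asModule) (fun k => (ι k).toAddMonoidHom) where
  injective := hinj
  surjective k b := by
    induction b using MonoidAlgebra.induction_linear with
    | zero => exact ⟨0, map_zero _⟩
    | add x y hx hy =>
      obtain ⟨a, rfl⟩ := hx
      obtain ⟨b, rfl⟩ := hy
      exact ⟨a + b, map_add _ _ _⟩
    | single σ c =>
      obtain ⟨g, hg⟩ := hsurj k σ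
      exact ⟨MonoidAlgebra.single g c, by simp [hg]⟩
  exists_smul_eq := hrange
  smul_smul k a := by
    suffices ∀ y : Y k, ρ.asAlgebraHom (e k) (ρ.asAlgebraHom a (ι k y)) =
        ι k ((τ k).asAlgebraHom (groupAlgebraLift (T k) a) y) from this
    intro y
    induction a using MonoidAlgebra.induction_linear with
    | zero => simp
    | add a b ha hb => simp only [map_add, LinearMap.add_apply, ha, hb]
    | single g c => simp [hsame]
  smul_smul_of_ne k l hkl a := by
    suffices ∀ y : Y l, ρ.asAlgebraHom (e k) (ρ.asAlgebraHom a (ι l y)) = 0 from this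
    intro y
    induction a using MonoidAlgebra.induction_linear with
    | zero => simp
    | add a b ha hb => simp only [map_add, LinearMap.add_apply, ha, hb, add_zero]
    | single g c => simp [hne k l hkl]
  unital := hunital

end CornerRep

/-! ### Elements of group algebras of products -/

section PureElement

variable {F : Type*} [Field F] {κ : Type*} [Fintype κ] {Γ : κ → Type*}

/-- Multilinear maps on group algebras that agree on group elements are equal. -/
theorem MultilinearMap.ext_groupAlgebra {W : Type*} [AddCommGroup W] [Module F W]
    {f f' : MultilinearMap F (fun i => F[Γ i]) W}
    (h : ∀ g : ∀ i, Γ i, f (fun i => MonoidAlgebra.single (g i) 1) =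
      f' (fun i => MonoidAlgebra.single (g i) 1)) : f = f' := by
  refine Module.Basis.ext_multilinear
    (fun i => Module.Basis.ofRepr (MonoidAlgebra.coeffLinearEquiv F)) fun g => ?_
  have hb : ∀ i, Module.Basis.ofRepr (MonoidAlgebra.coeffLinearEquiv F) (g i) =
      MonoidAlgebra.single (g i) (1 : F) := fun i => rfl
  simpa only [hb] using h g

variable [∀ i, Finite (Γ i)]

/-- The pure tensor `⨂ a i` as an element of the group algebra of `∏ Γ i`. -/
def pureElement : MultilinearMap F (fun i => F[Γ i]) F[∀ i, Γ i] where
  toFun a := .ofCoeff (Finsupp.equivFunOnFinite.symm fun g => ∏ i, (a i).coeff (g i))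
  map_update_add' := by
    intro hκ a i x y
    ext g
    have h : ∀ z : F[Γ i], ∏ j, (Function.update a i z j).coeff (g j) =
        z.coeff (g i) * ∏ j ∈ Finset.univ.erase i, (a j).coeff (g j) := by
      intro z
      rw [← Finset.mul_prod_erase _ _ (Finset.mem_univ i), Function.update_self]
      congr 1
      refine Finset.prod_congr rfl fun j hj => ?_
      rw [Function.update_of_ne (Finset.ne_of_mem_erase hj)]
    simp [h, add_mul]
  map_update_smul' := by
    intro hκ a i c x
    ext g
    have h : ∀ z : F[Γ i], ∏ j, (Function.update a i z j).coeff (g j) =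
        z.coeff (g i) * ∏ j ∈ Finset.univ.erase i, (a j).coeff (g j) := by
      intro z
      rw [← Finset.mul_prod_erase _ _ (Finset.mem_univ i), Function.update_self]
      congr 1
      refine Finset.prod_congr rfl fun j hj => ?_
      rw [Function.update_of_ne (Finset.ne_of_mem_erase hj)]
    simp [h, mul_assoc]

@[simp]
theorem coeff_pureElement (a : ∀ i, F[Γ i]) (g : ∀ i, Γ i) :
    (pureElement a).coeff g = ∏ i, (a i).coeff (g i) := rfl

theorem pureElement_single (g : ∀ i, Γ i) :
    pureElement (fun i => MonoidAlgebra.single (g i) (1 : F)) = MonoidAlgebra.single g 1 := by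
  classical
  ext h
  rw [coeff_pureElement]
  simp only [MonoidAlgebra.coeff_single, Finsupp.single_apply]
  by_cases hgh : g = h
  · subst hgh; simp
  · rw [if_neg hgh]
    obtain ⟨i, hi⟩ := Function.ne_iff.1 hgh
    exact Finset.prod_eq_zero (Finset.mem_univ i) (if_neg hi)

variable [∀ i, Group (Γ i)]

theorem single_mul_pureElement (a : ∀ i, F[Γ i]) (g : ∀ i, Γ i) :
    MonoidAlgebra.single g 1 * pureElement a =
      pureElement fun i => MonoidAlgebra.single (g i) 1 * a i := by
  ext h
  simp [MonoidAlgebra.coeff_single_mul_apply]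

/-- Both sides are multilinear in a, so a may be taken to consist of group elements. -/
theorem pureElement_mul (a b : ∀ i, F[Γ i]) :
    pureElement (fun i => a i * b i) = pureElement a * pureElement b := by
  classical
  have h : ∀ b : ∀ i, F[Γ i], pureElement.compLinearMap (fun i => LinearMap.mulRight F (b i)) =
      (LinearMap.mulRight F (pureElement b)).compMultilinearMap (pureElement (F := F) (Γ := Γ)) := by
    intro b
    refine MultilinearMap.ext_groupAlgebra fun g => ?_
    simp [pureElement_single, single_mul_pureElement]
  exact congrArg (· a) (h b)

/-- The coordinates are treated one at a time. By linearity an element of the ideal generated by b i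
may be replaced by g · b i · h with group elements g and h; once all coordinates have this form, the
pure tensor is a two-sided translate of that of b. -/
theorem pureElement_mem_span {a b : ∀ i, F[Γ i]} (h : ∀ i, a i ∈ TwoSidedIdeal.span {b i}) :
    pureElement a ∈ TwoSidedIdeal.span {pureElement b} := by
  classical
  let I := TwoSidedIdeal.span {pureElement b}
  have hI : ∀ (c : F) x, x ∈ I → c • x ∈ I := fun c x hx => by
    rw [Algebra.smul_def]; exact I.mul_mem_left _ _ hx
  -- The set s consists of the coordinates that still are arbitrary members of their ideals; the
  -- others already have the form g · b i · h.
  have key : ∀ s : Finset κ, ∀ a : ∀ i, F[Γ i], (∀ i ∈ s, a i ∈ TwoSidedIdeal.span {b i}) →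
      (∀ i ∉ s, ∃ g h : Γ i, a i = MonoidAlgebra.single g 1 * b i * MonoidAlgebra.single h 1) →
      pureElement a ∈ I := by
    intro s
    induction s using Finset.induction_on with
    | empty =>
      intro a _ ha
      choose g h hgh using fun i => ha i (Finset.notMem_empty i)
      rw [funext hgh, pureElement_mul, pureElement_mul, pureElement_single, pureElement_single]
      exact I.mul_mem_right _ _ (I.mul_mem_left _ _ (TwoSidedIdeal.subset_span rfl))
    | insert i s hi ih =>
      intro a ha ha'
      suffices ∀ x ∈ TwoSidedIdeal.span {b i}, pureElement (Function.update a i x) ∈ I by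
        simpa using this (a i) (ha i (Finset.mem_insert_self i s))
      intro x hx
      rw [TwoSidedIdeal.mem_span_iff_mem_addSubgroup_closure] at hx
      induction hx using AddSubgroup.closure_induction with
      | zero => rw [MultilinearMap.map_update_zero]; exact I.zero_mem
      | add x y _ _ hx hy => rw [MultilinearMap.map_update_add]; exact I.add_mem hx hy
      | neg x _ hx => rw [MultilinearMap.map_update_neg]; exact I.neg_mem hx
      | mem x hx =>
        obtain ⟨_, ⟨c, -, _, rfl, rfl⟩, d, -, rfl⟩ := hx
        change pureElement (Function.update a i (c * b i * d)) ∈ I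
        induction c using MonoidAlgebra.induction_linear with
        | zero => rw [zero_mul, zero_mul, MultilinearMap.map_update_zero]; exact I.zero_mem
        | add x y hx hy =>
          rw [add_mul, add_mul, MultilinearMap.map_update_add]; exact I.add_mem hx hy
        | single g r =>
          rw [← mul_one r, ← MonoidAlgebra.smul_single', smul_mul_assoc, smul_mul_assoc,
            MultilinearMap.map_update_smul]
          refine hI _ _ ?_
          induction d using MonoidAlgebra.induction_linear with
          | zero => rw [mul_zero, MultilinearMap.map_update_zero]; exact I.zero_mem
          | add x y hx hy => rw [mul_add, MultilinearMap.map_update_add]; exact I.add_mem hx hy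
          | single h r =>
            rw [← mul_one r, ← MonoidAlgebra.smul_single', mul_smul_comm,
              MultilinearMap.map_update_smul]
            refine hI _ _ (ih _ (fun j hj => ?_) fun j hj => ?_)
            · rw [Function.update_of_ne (by rintro rfl; exact hi hj)]
              exact ha j (Finset.mem_insert_of_mem hj)
            · by_cases hji : j = i
              · subst hji
                exact ⟨g, h, by rw [Function.update_self]⟩
              · rw [Function.update_of_ne hji]
                exact ha' j (by simp [hji, hj])
  exact key Finset.univ a (fun i _ => h i) (by simp)

theorem asAlgebraHom_outerPiTensor {W : κ → Type*} [∀ i, AddCommGroup (W i)] [∀ i, Module F (W i)]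
    (τ : ∀ i, Representation F (Γ i) (W i)) (a : ∀ i, F[Γ i]) :
    (outerPiTensor τ).asAlgebraHom (pureElement a) =
      PiTensorProduct.map fun i => (τ i).asAlgebraHom (a i) := by
  have h : (outerPiTensor τ).asAlgebraHom.toLinearMap.compMultilinearMap pureElement =
      (PiTensorProduct.mapMultilinear F W W).compLinearMap
        fun i => (τ i).asAlgebraHom.toLinearMap := by
    refine MultilinearMap.ext_groupAlgebra fun g => ?_
    simp only [LinearMap.compMultilinearMap_apply, pureElement_single, AlgHom.toLinearMap_apply,
      Representation.asAlgebraHom_single_one, MultilinearMap.compLinearMap_apply]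
    rfl
  exact congrArg (· a) h

end PureElement

/-! ### Change of groups and images of two-sided ideals -/

section GroupAlgebraRep

variable {F : Type*} [Field F] {Γ Δ : Type*} [Group Γ] [Group Δ]

theorem Representation.asAlgebraHom_comp {W : Type*} [AddCommGroup W] [Module F W]
    (τ : Representation F Δ W) (φ : Γ →* Δ) (a : F[Γ]) :
    Representation.asAlgebraHom (τ.comp φ : Representation F Γ W) a =
      τ.asAlgebraHom (MonoidAlgebra.mapDomainAlgHom F F φ a) := by
  induction a using MonoidAlgebra.induction_linear with
  | zero => simp
  | add a b ha hb => simp only [map_add, ha, hb]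
  | single g c => simp

theorem TwoSidedIdeal.map_mem_span {R S : Type*} [Ring R] [Ring S] (φ : R →+* S) {s : Set R}
    {x : R} (hx : x ∈ TwoSidedIdeal.span s) : φ x ∈ TwoSidedIdeal.span (φ '' s) := by
  have : TwoSidedIdeal.span s ≤ (TwoSidedIdeal.span (φ '' s)).comap φ :=
    TwoSidedIdeal.span_le.2 fun y hy =>
      (TwoSidedIdeal.mem_comap φ).2 (TwoSidedIdeal.subset_span (Set.mem_image_of_mem φ hy))
  exact (TwoSidedIdeal.mem_comap φ).1 (this hx)

end GroupAlgebraRep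

/-! ### The density theorem for group algebras -/

section Density

variable {F : Type u} [Field F] {G : Type v} [Group G]

/-- A simple module is finitely generated over the finite-dimensional algebra F[G]. -/
theorem Representation.finiteDimensional_of_isIrreducible [Finite G] {W : Type*} [AddCommGroup W]
    [Module F W] (ρ : Representation F G W) [ρ.IsIrreducible] : FiniteDimensional F W := by
  have : IsSimpleModule F[G] ρ.asModule := inferInstance
  have h1 : Module.Finite F F[G] := inferInstance
  have h2 : Module.Finite F[G] ρ.asModule := inferInstance
  have h3 : Module.Finite F ρ.asModule := Module.Finite.trans F[G] ρ.asModule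
  exact h3

variable [IsAlgClosed F] {κ : Type*} [Fintype κ] {V : κ → Type w}
  [∀ i, AddCommGroup (V i)] [∀ i, Module F (V i)] [∀ i, FiniteDimensional F (V i)]

/-- The density theorem for finitely many pairwise non-isomorphic simple modules. -/
theorem exists_smul_eq_of_pairwise_isEmpty {R : Type*} [Ring R] [Algebra F R] [∀ i, Module R (V i)]
    [∀ i, IsScalarTower F R (V i)] [∀ i, IsSimpleModule R (V i)]
    (hne : Pairwise fun i j => IsEmpty (V i ≃ₗ[R] V j)) (i : κ) (f : V i →ₗ[F] V i) :
    ∃ a : R, (∀ x : V i, a • x = f x) ∧ ∀ j, j ≠ i → ∀ x : V j, a • x = 0 := by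
  classical
  let M := ∀ i, V i
  have hss : IsSemisimpleModule R M := inferInstance
  -- Schur's lemma: endomorphisms of the direct sum have no off-diagonal entries, and their diagonal
  -- entries are scalars since F is algebraically closed. Hence the operator T below, f on the i-th
  -- summand and zero elsewhere, commutes with all of them.
  have hzero : ∀ (φ : Module.End R M) (j l : κ), j ≠ l → ∀ x : V j,
      φ (Pi.single j x) l = 0 := by
    intro φ j l hjl x
    have : (LinearMap.proj l).comp (φ.comp (LinearMap.single R _ j)) = (0 : V j →ₗ[R] V l) :=
      (LinearMap.bijective_or_eq_zero _).resolve_left fun hb =>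
        (hne hjl).false (LinearEquiv.ofBijective _ hb)
    exact LinearMap.congr_fun this x
  have hscalar : ∀ φ : Module.End R M, ∃ c : F, ∀ m, φ m i = c • m i := by
    intro φ
    obtain ⟨c, hc⟩ := (IsSimpleModule.algebraMap_end_bijective_of_isAlgClosed F (A := R)
      (V := V i)).2 ((LinearMap.proj i).comp (φ.comp (LinearMap.single R _ i)))
    refine ⟨c, fun m => ?_⟩
    conv_lhs => rw [← Finset.univ_sum_single m, map_sum, Finset.sum_apply]
    rw [Finset.sum_eq_single i (fun j _ hji => hzero φ j i hji _) (by simp)]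
    exact (LinearMap.congr_fun hc (m i)).symm
  let T : M →ₗ[F] M := (LinearMap.single F V i).comp (f.comp (LinearMap.proj i))
  have hTm : ∀ m, T m = Pi.single i (f (m i)) := fun m => rfl
  have hT : ∀ (φ : Module.End R M) m, T (φ m) = φ (T m) := by
    intro φ m
    obtain ⟨c, hc⟩ := hscalar φ
    rw [hTm, hTm, hc]
    funext j
    by_cases hij : i = j
    · subst hij
      rw [hc, Pi.single_eq_same, Pi.single_eq_same, map_smul]
    · rw [hzero φ i j hij, Pi.single_eq_of_ne (Ne.symm hij)]
  let T' : Module.End (Module.End R M) M :=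
    { toFun := T, map_add' := T.map_add, map_smul' := fun φ m => hT φ m }
  -- Jacobson density provides an element of R that agrees with T on a finite set; a finite set
  -- spanning M over F makes them agree everywhere.
  obtain ⟨s, hsp⟩ := (inferInstance : Module.Finite F M).fg_top
  obtain ⟨a, ha⟩ := jacobson_density T' s
  have ha' : ∀ m, T m = a • m := by
    intro m
    have hm : m ∈ Submodule.span F (s : Set M) := hsp ▸ Submodule.mem_top
    induction hm using Submodule.span_induction with
    | mem m hm => exact ha m hm
    | zero => simp
    | add x y _ _ hx hy => rw [map_add, smul_add, hx, hy]
    | smul c x _ hx => rw [map_smul, hx, smul_comm]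
  have hsmul : ∀ (m : M) (j : κ), (a • m) j = a • m j := fun _ _ => rfl
  refine ⟨a, fun x => ?_, fun j hj x => ?_⟩
  · simpa [hTm, hsmul] using (congrFun (ha' (Pi.single i x)) i).symm
  · simpa [hTm, hj, hsmul] using (congrFun (ha' (Pi.single j x)) j).symm

theorem exists_asAlgebraHom_eq (ρ : ∀ i, Representation F G (V i))
    (hirr : ∀ i, (ρ i).IsIrreducible) (hne : Pairwise fun i j => IsEmpty ((ρ i).Equiv (ρ j)))
    (i : κ) (f : V i →ₗ[F] V i) :
    ∃ a : F[G], (ρ i).asAlgebraHom a = f ∧ ∀ j, j ≠ i → (ρ j).asAlgebraHom a = 0 := by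
  have hs : ∀ i, IsSimpleModule F[G] (ρ i).asModule := fun i =>
    ((ρ i).irreducible_iff_isSimpleModule_asModule).1 (hirr i)
  have hfd : ∀ i, FiniteDimensional F (ρ i).asModule := fun i => inferInstance
  obtain ⟨a, ha, ha'⟩ := exists_smul_eq_of_pairwise_isEmpty (F := F) (R := F[G])
    (V := fun i => (ρ i).asModule) (fun j l hjl => ⟨fun e => (hne hjl).false
      (Representation.IntertwiningMap.ofBijective
        ((Representation.IntertwiningMap.equivLinearMapAsModule (ρ j) (ρ l)).symm e.toLinearMap)
        e.bijective)⟩) i f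
  exact ⟨a, LinearMap.ext ha, fun j hj => LinearMap.ext (ha' j hj)⟩

/-- For pairwise non-isomorphic irreducible representations `ρ i`, there are elements of the group
algebra that act on one of them as a rank one idempotent `x ↦ f i x • v i` and as zero on the
others, and the ideals that they generate contain elements acting as the identity. -/
theorem exists_rank_one_idempotents (ρ : ∀ i, Representation F G (V i))
    (hirr : ∀ i, (ρ i).IsIrreducible) (hne : Pairwise fun i j => IsEmpty ((ρ i).Equiv (ρ j))) :
    ∃ (ε u : κ → F[G]) (v : ∀ i, V i) (f : ∀ i, Module.Dual F (V i)),
      (∀ i, f i (v i) = 1) ∧ (∀ i x, (ρ i).asAlgebraHom (ε i) x = f i x • v i) ∧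
      (∀ i j, j ≠ i → (ρ j).asAlgebraHom (ε i) = 0) ∧
      (∀ i, u i ∈ TwoSidedIdeal.span {ε i}) ∧ (∀ i, (ρ i).asAlgebraHom (u i) = 1) ∧
      (∀ i j, j ≠ i → (ρ j).asAlgebraHom (u i) = 0) := by
  have hnt : ∀ i, Nontrivial (V i) := fun i => by
    have : IsSimpleModule F[G] (ρ i).asModule :=
      ((ρ i).irreducible_iff_isSimpleModule_asModule).1 (hirr i)
    exact IsSimpleModule.nontrivial F[G] (ρ i).asModule
  choose v hv using fun i => exists_ne (0 : V i)
  have hdual : ∀ i, ∃ f : Module.Dual F (V i), f (v i) = 1 := fun i => by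
    obtain ⟨f, hf⟩ : ∃ f : Module.Dual F (V i), f (v i) ≠ 0 := by
      by_contra! h
      exact hv i ((Module.forall_dual_apply_eq_zero_iff F (v i)).1 h)
    exact ⟨(f (v i))⁻¹ • f, by simp [hf]⟩
  choose f hf using hdual
  choose a ha ha' using exists_asAlgebraHom_eq ρ hirr hne
  let b := fun i => Module.finBasis F (V i)
  let ε : κ → F[G] := fun i => a i ((f i).smulRight (v i))
  -- With a basis b_s and its coordinate functionals b_s*, the s-th term acts on V i as (b_s ⊗ f)(v
  -- ⊗ f)(v ⊗ b_s*) = b_s ⊗ b_s*, because f(v) = 1. These operators add up to the identity.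
  let u : κ → F[G] := fun i => ∑ s, a i ((f i).smulRight (b i s)) * ε i *
    a i (((b i).coord s).smulRight (v i))
  refine ⟨ε, u, v, f, hf, fun i x => by simp [ε, ha], fun i j hj => ha' _ _ j hj, fun i => ?_,
    fun i => LinearMap.ext fun x => ?_, fun i j hj => ?_⟩
  · exact sum_mem fun s _ => TwoSidedIdeal.mul_mem_right _ _ _
      (TwoSidedIdeal.mul_mem_left _ _ _ (TwoSidedIdeal.subset_span rfl))
  · simp only [u, ε, map_sum, map_mul, ha, LinearMap.sum_apply, Module.End.mul_apply,
      LinearMap.smulRight_apply, map_smul, hf, one_smul]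
    exact (b i).sum_repr x
  · simp [u, ha' i _ j hj]

end Density

/-! ### The socle of an outer tensor product -/

section OuterSocle

variable {F : Type u} [Field F] {κ : Type*}

theorem PiTensorProduct.induction_tprod {W : κ → Type*} [∀ i, AddCommGroup (W i)]
    [∀ i, Module F (W i)] (p : Submodule F (⨂[F] i, W i))
    (h : ∀ x, PiTensorProduct.tprod F x ∈ p) (z : ⨂[F] i, W i) : z ∈ p := by
  have : (⊤ : Submodule F (⨂[F] i, W i)) ≤ p := by
    rw [← PiTensorProduct.span_tprod_eq_top, Submodule.span_le]
    rintro _ ⟨x, rfl⟩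
    exact h x
  exact this Submodule.mem_top

theorem PiTensorProduct.map_injective {W W' : κ → Type*} [∀ i, AddCommGroup (W i)]
    [∀ i, Module F (W i)] [∀ i, AddCommGroup (W' i)] [∀ i, Module F (W' i)]
    (φ : ∀ i, W i →ₗ[F] W' i) (hφ : ∀ i, Function.Injective (φ i)) :
    Function.Injective (PiTensorProduct.map φ) := by
  choose ψ hψ using fun i => (φ i).exists_leftInverse_of_injective (LinearMap.ker_eq_bot.2 (hφ i))
  refine Function.LeftInverse.injective (g := PiTensorProduct.map ψ) fun x => ?_
  rw [← LinearMap.comp_apply, ← PiTensorProduct.map_comp]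
  simp [hψ, PiTensorProduct.map_id]

variable [Fintype κ]

/-- The functional `⨂ xᵢ ↦ ∏ fᵢ xᵢ` on a tensor product. -/
def piTensorDual {W : κ → Type*} [∀ i, AddCommGroup (W i)] [∀ i, Module F (W i)]
    (f : ∀ i, Module.Dual F (W i)) : Module.Dual F (⨂[F] i, W i) :=
  PiTensorProduct.lift ((MultilinearMap.mkPiAlgebra F κ F).compLinearMap f)

@[simp]
theorem piTensorDual_tprod {W : κ → Type*} [∀ i, AddCommGroup (W i)] [∀ i, Module F (W i)]
    (f : ∀ i, Module.Dual F (W i)) (x : ∀ i, W i) :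
    piTensorDual f (PiTensorProduct.tprod F x) = ∏ i, f i (x i) := by
  simp [piTensorDual]

/-- If y is outside the range of φ k, a functional c separates it from that range. The product of c
with the f i, i ≠ k, then vanishes on the range of the tensor map, but has the value c y at the
given pure tensor. -/
theorem tprod_update_mem_range_map_iff [DecidableEq κ] {W W' : κ → Type*}
    [∀ i, AddCommGroup (W i)] [∀ i, Module F (W i)] [∀ i, AddCommGroup (W' i)]
    [∀ i, Module F (W' i)] (φ : ∀ i, W' i →ₗ[F] W i) {k : κ} {l : ∀ i, W i}
    {f : ∀ i, Module.Dual F (W i)} (hlf : ∀ i, i ≠ k → f i (l i) = 1)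
    (hl : ∀ i, i ≠ k → l i ∈ LinearMap.range (φ i)) (y : W k) :
    PiTensorProduct.tprod F (Function.update l k y) ∈ LinearMap.range (PiTensorProduct.map φ) ↔
      y ∈ LinearMap.range (φ k) := by
  constructor
  · rintro ⟨x, hx⟩
    by_contra hy
    obtain ⟨c, hc1, hc2⟩ := Submodule.exists_le_ker_of_notMem hy
    refine hc1 ?_
    have h1 : x ∈ LinearMap.ker ((piTensorDual (Function.update f k c)).comp
        (PiTensorProduct.map φ)) := by
      refine PiTensorProduct.induction_tprod _ (fun x => ?_) x
      rw [LinearMap.mem_ker, LinearMap.comp_apply, PiTensorProduct.map_tprod, piTensorDual_tprod]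
      refine Finset.prod_eq_zero (Finset.mem_univ k) ?_
      rw [Function.update_self]
      exact hc2 ⟨x k, rfl⟩
    rw [LinearMap.mem_ker, LinearMap.comp_apply, hx, piTensorDual_tprod,
      ← Finset.mul_prod_erase _ _ (Finset.mem_univ k), Finset.prod_eq_one, mul_one] at h1
    · simpa using h1
    · intro i h
      rw [Function.update_of_ne (Finset.ne_of_mem_erase h),
        Function.update_of_ne (Finset.ne_of_mem_erase h), hlf i (Finset.ne_of_mem_erase h)]
  · rintro ⟨y', rfl⟩
    have : ∀ i, ∃ l' : W' i, φ i l' = Function.update l k (φ k y') i := fun i => by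
      by_cases hi : i = k
      · subst hi
        exact ⟨y', by rw [Function.update_self]⟩
      · rw [Function.update_of_ne hi]
        exact hl i hi
    choose l' hl' using this
    exact ⟨PiTensorProduct.tprod F l', by rw [PiTensorProduct.map_tprod]; simp only [hl']⟩

variable {S : κ → Type*} [∀ i, Group (S i)] {W W' : κ → Type*} [∀ i, AddCommGroup (W i)]
  [∀ i, Module F (W i)] [∀ i, AddCommGroup (W' i)] [∀ i, Module F (W' i)]
  {τ : ∀ i, Representation F (S i) (W i)} {τ' : ∀ i, Representation F (S i) (W' i)}

/-- The outer tensor product of intertwining maps. -/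
def outerPiMap (φ : ∀ i, (τ i).IntertwiningMap (τ' i)) :
    (outerPiTensor τ).IntertwiningMap (outerPiTensor τ') where
  toLinearMap := PiTensorProduct.map fun i => (φ i).toLinearMap
  isIntertwining' g := by
    change _ ∘ₗ PiTensorProduct.map _ = PiTensorProduct.map _ ∘ₗ _
    rw [← PiTensorProduct.map_comp, ← PiTensorProduct.map_comp]
    congr 1
    funext i
    exact (φ i).isIntertwining' (g i)

/-- The linear map of modules over the group algebra given by an intertwining map. -/
abbrev Representation.IntertwiningMap.asModuleHom {Γ X X' : Type*} [Group Γ] [AddCommGroup X]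
    [Module F X] [AddCommGroup X'] [Module F X'] {ρ : Representation F Γ X}
    {ρ' : Representation F Γ X'} (φ : ρ.IntertwiningMap ρ') : ρ.asModule →ₗ[F[Γ]] ρ'.asModule :=
  Representation.IntertwiningMap.equivLinearMapAsModule ρ ρ' φ

variable [IsAlgClosed F] [∀ i, Finite (S i)] [DecidableEq κ]

variable (τ) in
/-- An outer tensor product in which all factors but the `k`-th one are irreducible is governed by
the `k`-th factor. -/
theorem exists_isModuleCorner_outerPiTensor (k : κ) (hirr : ∀ i, i ≠ k → (τ i).IsIrreducible) :
    ∃ (e : F[∀ i, S i]) (T : (∀ i, S i) → F[S k]) (l : ∀ i, W i) (f : ∀ i, Module.Dual F (W i)),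
      (∀ i, i ≠ k → f i (l i) = 1) ∧
      IsModuleCorner (K := Unit) (fun _ => e) (fun _ => groupAlgebraLift T)
        (X := (outerPiTensor τ).asModule) (Y := fun _ => (τ k).asModule)
        (fun _ => ((PiTensorProduct.tprod F).toLinearMap l k).toAddMonoidHom) := by
  have hfd : ∀ i, i ≠ k → FiniteDimensional F (W i) := fun i hi =>
    have := hirr i hi
    (τ i).finiteDimensional_of_isIrreducible
  -- The k-th factor is left untouched by taking ε = 1 there, while each other factor is compressed
  -- to a line.
  have hex : ∀ i, ∃ (ε u : F[S i]) (l : W i) (f : Module.Dual F (W i)),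
      u ∈ TwoSidedIdeal.span {ε} ∧ (τ i).asAlgebraHom u = 1 ∧ (i = k → ε = 1) ∧
      (i ≠ k → f l = 1 ∧ ∀ x, (τ i).asAlgebraHom ε x = f x • l) := by
    intro i
    by_cases hi : i = k
    · exact ⟨1, 1, 0, 0, TwoSidedIdeal.subset_span rfl, map_one _, fun _ => rfl,
        fun h => absurd hi h⟩
    · have := hfd i hi
      obtain ⟨ε, u, l, f, h1, h2, -, h4, h5, -⟩ := exists_rank_one_idempotents (κ := Unit)
        (fun _ => τ i) (fun _ => hirr i hi) (fun a b hab => absurd (Subsingleton.elim a b) hab)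
      exact ⟨ε (), u (), l (), f (), h4 (), h5 (), fun h => absurd h hi,
        fun _ => ⟨h1 (), h2 ()⟩⟩
  choose ε u l f hu hu' hk hi using hex
  -- The irreducible factors contribute only the matrix coefficients f i (g i • l i).
  let T : (∀ i, S i) → F[S k] := fun g =>
    MonoidAlgebra.single (g k) (∏ i ∈ Finset.univ.erase k, f i (τ i (g i) (l i)))
  have he : ∀ x : ∀ i, W i, (outerPiTensor τ).asAlgebraHom (pureElement ε)
      (PiTensorProduct.tprod F x) = (∏ i ∈ Finset.univ.erase k, f i (x i)) •
        PiTensorProduct.tprod F (Function.update l k (x k)) := by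
    intro x
    rw [asAlgebraHom_outerPiTensor, PiTensorProduct.map_tprod]
    have : (fun i => (τ i).asAlgebraHom (ε i) (x i)) = fun i =>
        (if i = k then (1 : F) else f i (x i)) • Function.update l k (x k) i := by
      funext i
      by_cases h : i = k
      · subst h; simp [hk i rfl]
      · simp [h, (hi i h).2]
    rw [this, MultilinearMap.map_smul_univ]
    congr 1
    rw [← Finset.mul_prod_erase _ _ (Finset.mem_univ k), if_pos rfl, one_mul]
    exact Finset.prod_congr rfl fun i h => if_neg (Finset.ne_of_mem_erase h)
  have hprod : ∀ (g : ∀ i, S i) y, ∏ i ∈ Finset.univ.erase k,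
      f i (τ i (g i) (Function.update l k y i)) =
        ∏ i ∈ Finset.univ.erase k, f i (τ i (g i) (l i)) := fun g y =>
    Finset.prod_congr rfl fun i h => by rw [Function.update_of_ne (Finset.ne_of_mem_erase h)]
  refine ⟨pureElement ε, T, l, f, fun i h => (hi i h).1, ?_⟩
  refine IsModuleCorner.of_rep (K := Unit) (S := fun _ => S k) (outerPiTensor τ)
    (Y := fun _ => W k) (fun _ => τ k) (fun _ => pureElement ε) (fun _ => T)
    (fun _ => (PiTensorProduct.tprod F).toLinearMap l k) (fun _ => ?_) (fun _ σ => ?_)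
    (fun _ x => ?_) (fun _ g y => ?_) (fun a b hab => absurd rfl hab) fun x => ?_
  · rw [← LinearMap.ker_eq_bot, LinearMap.ker_eq_bot']
    intro y hy
    rw [← Module.forall_dual_apply_eq_zero_iff F]
    intro c
    have := congrArg (piTensorDual (Function.update f k c)) hy
    rw [MultilinearMap.toLinearMap_apply, piTensorDual_tprod, map_zero,
      ← Finset.mul_prod_erase _ _ (Finset.mem_univ k), Finset.prod_eq_one, mul_one] at this
    · simpa using this
    · intro i h
      rw [Function.update_of_ne (Finset.ne_of_mem_erase h),
        Function.update_of_ne (Finset.ne_of_mem_erase h), (hi i (Finset.ne_of_mem_erase h)).1]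
  · refine ⟨Pi.mulSingle k σ, ?_⟩
    simp only [T, Pi.mulSingle_eq_same]
    congr 1
    refine Finset.prod_eq_one fun i h => ?_
    rw [Pi.mulSingle_eq_of_ne (Finset.ne_of_mem_erase h), map_one, Module.End.one_apply,
      (hi i (Finset.ne_of_mem_erase h)).1]
  · suffices x ∈ (LinearMap.range ((PiTensorProduct.tprod F).toLinearMap l k)).comap
        ((outerPiTensor τ).asAlgebraHom (pureElement ε)) by
      obtain ⟨y, hy⟩ := this
      exact ⟨y, hy.symm⟩
    refine PiTensorProduct.induction_tprod _ (fun x => ?_) x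
    rw [Submodule.mem_comap, he]
    exact Submodule.smul_mem _ _ ⟨x k, rfl⟩
  · have : (outerPiTensor τ) g ((PiTensorProduct.tprod F).toLinearMap l k y) =
        PiTensorProduct.tprod F fun i => τ i (g i) (Function.update l k y i) :=
      PiTensorProduct.map_tprod _ _
    rw [this, he, hprod]
    simp [T]
  · refine ⟨pureElement u, ?_, ?_⟩
    · simpa using pureElement_mem_span hu
    · rw [asAlgebraHom_outerPiTensor]
      simp only [hu', PiTensorProduct.map_one, Module.End.one_apply]

/-- The socle of an outer tensor product, all of whose factors but the `k`-th one are irreducible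
or zero, is obtained by passing to the socle in the `k`-th factor. -/
theorem range_outerPiMap_eq_moduleSocle (φ : ∀ i, (τ' i).IntertwiningMap (τ i)) (k : κ)
    (hirr : ∀ i, i ≠ k → (τ i).IsIrreducible ∨ Subsingleton (W i))
    (hφ : ∀ i, i ≠ k → Function.Bijective (φ i))
    (hk : LinearMap.range (φ k).asModuleHom = moduleSocle F[S k] (τ k).asModule) :
    LinearMap.range (outerPiMap φ).asModuleHom =
      moduleSocle F[∀ i, S i] (outerPiTensor τ).asModule := by
  -- A zero factor makes the whole tensor product zero, so both submodules coincide.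
  by_cases hsub : ∃ i, i ≠ k ∧ Subsingleton (W i)
  · obtain ⟨i, -, hi⟩ := hsub
    have : Subsingleton (⨂[F] i, W i) := by
      refine subsingleton_of_forall_eq 0 fun x => ?_
      rw [← Submodule.mem_bot F]
      refine PiTensorProduct.induction_tprod _ (fun x => ?_) x
      rw [Submodule.mem_bot]
      exact MultilinearMap.map_coord_zero _ i (Subsingleton.elim _ _)
    have : Subsingleton (outerPiTensor τ).asModule := this
    exact Subsingleton.elim _ _
  push Not at hsub
  obtain ⟨e, T, l, f, hlf, hc⟩ := exists_isModuleCorner_outerPiTensor τ k fun i hi =>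
    (hirr i hi).resolve_right (not_subsingleton_iff_nontrivial.2 (hsub i hi))
  rw [← hc.induced_restrict (LinearMap.range (outerPiMap φ).asModuleHom), hc.moduleSocle_eq]
  congr 1
  funext _
  rw [← hk]
  ext y
  exact tprod_update_mem_range_map_iff (fun i => (φ i).toLinearMap) hlf
    (fun i hi => (hφ i hi).2 (l i)) y

theorem moduleSocle_isSemisimpleModule (A X : Type*) [Ring A] [AddCommGroup X] [Module A X] :
    IsSemisimpleModule A (moduleSocle A X) := by
  unfold moduleSocle
  rw [sSup_eq_iSup]
  refine isSemisimpleModule_biSup_of_isSemisimpleModule_submodule fun N hN => ?_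
  have : IsSimpleModule A N := hN
  infer_instance

end OuterSocle

/-! ### Induced modules -/

section Ind

theorem Representation.ind_mk_one_eq {k G H A : Type*} [CommRing k] [Group G] [Group H]
    (φ : G →* H) [AddCommGroup A] [Module k A] (ρ : Representation k G A) (g : G) (x : A) :
    Representation.ind φ ρ (φ g) (Representation.IndV.mk φ ρ 1 x) =
      Representation.IndV.mk φ ρ 1 (ρ g x) := by
  rw [Representation.ind_mk, one_mul]
  have := Representation.Coinvariants.mk_self_apply
    (Representation.tprod ((Representation.leftRegular k H).comp φ) ρ) g
    (MonoidAlgebra.single (φ g)⁻¹ 1 ⊗ₜ x)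
  rw [Representation.tprod_apply, TensorProduct.map_tmul] at this
  simpa using this.symm

theorem Representation.ind_induction {k G H A : Type*} [CommRing k] [Group G] [Group H]
    (φ : G →* H) [AddCommGroup A] [Module k A] (ρ : Representation k G A)
    (p : Submodule k (Representation.IndV φ ρ))
    (h : ∀ g x, Representation.ind φ ρ g (Representation.IndV.mk φ ρ 1 x) ∈ p)
    (z : Representation.IndV φ ρ) : z ∈ p := by
  have h0 : p.mkQ = 0 := by
    refine Representation.IndV.hom_ext φ ρ fun g => LinearMap.ext fun x => ?_
    have := h g⁻¹ x
    rw [Representation.ind_mk, one_mul, inv_inv] at this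
    simpa [Submodule.Quotient.mk_eq_zero] using this
  have := LinearMap.congr_fun h0 z
  simpa [Submodule.Quotient.mk_eq_zero] using this

/-- A left inverse comes from the map H → End A that is φ g ↦ ρ g⁻¹ on the image of φ and zero off
it; it is compatible with the relations defining the coinvariants. -/
theorem Representation.indV_mk_one_injective {k G H A : Type*} [CommRing k] [Group G] [Group H]
    {φ : G →* H} (hφ : Function.Injective φ) [AddCommGroup A] [Module k A]
    (ρ : Representation k G A) : Function.Injective (Representation.IndV.mk φ ρ 1) := by
  classical
  let c : H → A →ₗ[k] A := fun x => if hx : ∃ g, φ g = x then ρ hx.choose⁻¹ else 0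
  have hc : ∀ g, c (φ g) = ρ g⁻¹ := fun g => by
    have hx : ∃ g', φ g' = φ g := ⟨g, rfl⟩
    have : c (φ g) = ρ hx.choose⁻¹ := dif_pos hx
    rw [this, hφ hx.choose_spec]
  have hc' : ∀ g x, (c (φ g * x)) ∘ₗ ρ g = c x := fun g x => by
    by_cases hx : ∃ g', φ g' = x
    · obtain ⟨g', rfl⟩ := hx
      rw [← map_mul, hc, hc, ← Module.End.mul_eq_comp, ← map_mul]
      simp
    · have hx' : ¬ ∃ g', φ g' = φ g * x := by
        rintro ⟨g', hg'⟩
        exact hx ⟨g⁻¹ * g', by rw [map_mul, hg', map_inv, inv_mul_cancel_left]⟩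
      have h1 : c x = 0 := dif_neg hx
      have h2 : c (φ g * x) = 0 := dif_neg hx'
      rw [h1, h2, LinearMap.zero_comp]
  let R : (MonoidAlgebra k H) ⊗[k] A →ₗ[k] A :=
    TensorProduct.lift ((Finsupp.linearCombination k c).comp
      (MonoidAlgebra.coeffLinearEquiv k).toLinearMap)
  have hR : ∀ x a, R (MonoidAlgebra.single x 1 ⊗ₜ a) = c x a := fun x a => by simp [R]
  let R' := Representation.Coinvariants.lift
    (Representation.tprod ((Representation.leftRegular k H).comp φ) ρ) R fun g => by
      refine TensorProduct.ext (MonoidAlgebra.lhom_ext' fun x => LinearMap.ext_ring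
        (LinearMap.ext fun a => ?_))
      have := LinearMap.congr_fun (hc' g x) a
      simpa [hR] using this
  refine Function.LeftInverse.injective (g := R') fun a => ?_
  change R (MonoidAlgebra.single 1 1 ⊗ₜ a) = a
  rw [hR, ← map_one φ, hc]
  simp

theorem MonoidAlgebra.coeff_mapDomainAlgHom_of_injective {F Γ Δ : Type*} [Field F] [Group Γ]
    [Group Δ] {φ : Γ →* Δ} (hφ : Function.Injective φ) (x : F[Γ]) (g : Γ) :
    (MonoidAlgebra.mapDomainAlgHom F F φ x).coeff (φ g) = x.coeff g := by
  induction x using MonoidAlgebra.induction_linear with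
  | zero => simp
  | add x y hx hy =>
    rw [map_add, MonoidAlgebra.coeff_add, MonoidAlgebra.coeff_add, Finsupp.add_apply,
      Finsupp.add_apply, hx, hy]
  | single h c =>
    have : MonoidAlgebra.mapDomainAlgHom F F φ (MonoidAlgebra.single h c) =
      MonoidAlgebra.single (φ h) c := by simp
    classical
    rw [this, MonoidAlgebra.coeff_single, MonoidAlgebra.coeff_single, Finsupp.single_apply,
      Finsupp.single_apply]
    simp only [hφ.eq_iff]

end Ind

/-! ### The tensor product of the modules over the blocks -/

section Blocks

variable {F : Type u} [Field F] {G : Type v} [Group G]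

theorem wreathPower_inl {V : Type w} [AddCommGroup V] [Module F V] (ρ : Representation F G V)
    {ι : Type} (g : ι → G) : wreathPower ρ ι (SemidirectProduct.inl g) =
      PiTensorProduct.map fun i => ρ (g i) := by
  refine PiTensorProduct.ext (MultilinearMap.ext fun x => ?_)
  change PiTensorProduct.map _ (PiTensorProduct.reindex F _ _ (PiTensorProduct.tprod F x)) = _
  rw [PiTensorProduct.reindex_tprod]
  rfl

theorem wreathPower_inr {V : Type w} [AddCommGroup V] [Module F V] (ρ : Representation F G V)
    {ι : Type} (w : Equiv.Perm ι) (x : ι → V) :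
    wreathPower ρ ι (SemidirectProduct.inr w) (PiTensorProduct.tprod F x) =
      PiTensorProduct.tprod F fun i => x (w.symm i) := by
  change PiTensorProduct.map _ (PiTensorProduct.reindex F _ _ (PiTensorProduct.tprod F x)) = _
  rw [PiTensorProduct.reindex_tprod, PiTensorProduct.map_tprod]
  simp

theorem asAlgebraHom_wreathTensor_inl [Finite G] {V : Type w} [AddCommGroup V] [Module F V]
    (ρ : Representation F G V) {ι : Type} [Fintype ι] {L : Type*} [AddCommGroup L] [Module F L]
    (τ : Representation F (Equiv.Perm ι) L) (a : ι → F[G]) :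
    Representation.asAlgebraHom ((wreathTensor ρ τ).comp SemidirectProduct.inl :
      Representation F (ι → G) _) (pureElement a) =
        TensorProduct.map (PiTensorProduct.map fun i => ρ.asAlgebraHom (a i)) LinearMap.id := by
  have h : ∀ z : F[ι → G], Representation.asAlgebraHom ((wreathTensor ρ τ).comp
      SemidirectProduct.inl : Representation F (ι → G) _) z =
        TensorProduct.map ((outerPiTensor fun _ : ι => ρ).asAlgebraHom z) LinearMap.id := by
    intro z
    induction z using MonoidAlgebra.induction_linear with
    | zero => simp
    | add x y hx hy => rw [map_add, hx, hy, map_add, TensorProduct.map_add_left]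
    | single g c =>
      rw [Representation.asAlgebraHom_single, Representation.asAlgebraHom_single,
        TensorProduct.map_smul_left]
      congr 1
      change TensorProduct.map (wreathPower ρ ι (SemidirectProduct.inl g))
        (τ (SemidirectProduct.rightHom (SemidirectProduct.inl g))) = _
      rw [wreathPower_inl, SemidirectProduct.rightHom_inl, map_one]
      rfl
  rw [h, asAlgebraHom_outerPiTensor]

variable {r : ℕ} {V : Fin r → Type w} [∀ i, AddCommGroup (V i)] [∀ i, Module F (V i)]

variable (G) in
/-- The embedding of `G^n` in `∏ G_{n_i}`, for a bijection of the index sets. -/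
def blockBase {d : Fin r → ℕ} {n : ℕ} (e : (Σ i, Fin (d i)) ≃ Fin n) :
    (Fin n → G) →* ∀ i, Wreath G (Fin (d i)) where
  toFun g i := SemidirectProduct.inl fun x => g (e ⟨i, x⟩)
  map_one' := rfl
  map_mul' g g' := by
    funext i
    exact map_mul SemidirectProduct.inl (fun x => g (e ⟨i, x⟩)) (fun x => g' (e ⟨i, x⟩))

variable (G) in
/-- The embedding of `∏ S_{n_i}` in `∏ G_{n_i}`. -/
def blockPerm (d : Fin r → ℕ) :
    (∀ i, Equiv.Perm (Fin (d i))) →* ∀ i, Wreath G (Fin (d i)) where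
  toFun w i := SemidirectProduct.inr (w i)
  map_one' := rfl
  map_mul' w w' := by
    funext i
    exact map_mul SemidirectProduct.inr (w i) (w' i)

variable (ρ : ∀ i, Representation F G (V i)) (L : Fin r → SymRep F)

variable {L} in
/-- The tensor product of endomorphisms of the factors of `YoungSpace V L`. -/
def youngMap (φ : ∀ i, ((⨂[F] _ : Fin (L i).deg, V i) ⊗[F] (L i).carrier) →ₗ[F]
    (⨂[F] _ : Fin (L i).deg, V i) ⊗[F] (L i).carrier) : YoungSpace V L →ₗ[F] YoungSpace V L :=
  PiTensorProduct.map φ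

variable {L} in
/-- Pure tensors in `YoungSpace V L`. -/
def youngTprod (z : ∀ i, (⨂[F] _ : Fin (L i).deg, V i) ⊗[F] (L i).carrier) : YoungSpace V L :=
  PiTensorProduct.tprod F z

/-- Sorting the coordinates of G^n by blocks is a group isomorphism that carries a pure tensor to a
pure tensor of pure tensors. -/
theorem asAlgebraHom_youngRep_blockBase [Finite G] {n : ℕ} (e : (Σ i, Fin (L i).deg) ≃ Fin n)
    (a : Fin n → F[G]) :
    Representation.asAlgebraHom ((youngRep ρ L).comp (blockBase G e) :
      Representation F (Fin n → G) _) (pureElement a) =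
      youngMap (V := V) (L := L) fun i => TensorProduct.map
        (PiTensorProduct.map fun x => (ρ i).asAlgebraHom (a (e ⟨i, x⟩))) LinearMap.id := by
  let c : (Fin n → G) →* ∀ i, Fin (L i).deg → G :=
    { toFun := fun g i x => g (e ⟨i, x⟩), map_one' := rfl, map_mul' := fun _ _ => rfl }
  have hc : Function.Injective c := fun g g' h => by
    funext j
    obtain ⟨⟨i, x⟩, rfl⟩ := e.surjective j
    exact congrFun (congrFun h i) x
  have hc' : Function.Surjective c := fun g => ⟨fun j => g (e.symm j).1 (e.symm j).2, by
    funext i x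
    change g (e.symm (e ⟨i, x⟩)).1 (e.symm (e ⟨i, x⟩)).2 = _
    rw [e.symm_apply_apply]⟩
  have h1 : MonoidAlgebra.mapDomainAlgHom F F c (pureElement a) =
      pureElement fun i => pureElement fun x => a (e ⟨i, x⟩) := by
    ext g
    obtain ⟨g, rfl⟩ := hc' g
    rw [MonoidAlgebra.coeff_mapDomainAlgHom_of_injective hc, coeff_pureElement, coeff_pureElement]
    simp only [coeff_pureElement]
    rw [← e.prod_comp, Fintype.prod_sigma]
    rfl
  have h2 : (((youngRep ρ L).comp (blockBase G e) : Representation F (Fin n → G) _)) =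
      (outerPiTensor fun i => ((wreathTensor (ρ i) (L i).rep).comp
        SemidirectProduct.inl : Representation F (Fin (L i).deg → G) _)).comp c := rfl
  rw [h2]
  refine (Representation.asAlgebraHom_comp _ c _).trans ?_
  rw [h1]
  refine (asAlgebraHom_outerPiTensor _ _).trans ?_
  unfold youngMap
  congr 1
  funext i
  exact asAlgebraHom_wreathTensor_inl (ρ i) (L i).rep _

variable {ρ L}

/-- The embedding `⨂ lᵢ ↦ ⨂ (vᵢ^{⊗ nᵢ} ⊗ lᵢ)`. -/
def blockEmb (v : ∀ i, V i) : (⨂[F] i, (L i).carrier) →ₗ[F] YoungSpace V L :=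
  PiTensorProduct.map fun i => TensorProduct.mk F (⨂[F] _ : Fin (L i).deg, V i) (L i).carrier
    (PiTensorProduct.tprod F fun _ => v i)

/-- The projection `⨂ (xᵢ ⊗ lᵢ) ↦ ∏ fᵢ^{⊗ nᵢ} xᵢ • ⨂ lᵢ`. -/
def blockProj (f : ∀ i, Module.Dual F (V i)) : YoungSpace V L →ₗ[F] ⨂[F] i, (L i).carrier :=
  PiTensorProduct.map fun i => (TensorProduct.lid F (L i).carrier).toLinearMap ∘ₗ
    TensorProduct.map (piTensorDual fun _ : Fin (L i).deg => f i) LinearMap.id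

theorem blockEmb_tprod (v : ∀ i, V i) (l : ∀ i, (L i).carrier) :
    blockEmb v (PiTensorProduct.tprod F l) = youngTprod (V := V) (L := L) fun i =>
      (PiTensorProduct.tprod F fun _ : Fin (L i).deg => v i) ⊗ₜ[F] l i := by
  unfold blockEmb
  exact PiTensorProduct.map_tprod (R := F) _ _

theorem blockProj_youngTprod (f : ∀ i, Module.Dual F (V i))
    (z : ∀ i, (⨂[F] _ : Fin (L i).deg, V i) ⊗[F] (L i).carrier) :
    blockProj f (youngTprod z) = PiTensorProduct.tprod F fun i =>
      (TensorProduct.lid F (L i).carrier).toLinearMap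
        (TensorProduct.map (piTensorDual fun _ : Fin (L i).deg => f i) LinearMap.id (z i)) := by
  unfold blockProj youngTprod
  exact PiTensorProduct.map_tprod (R := F) _ _

theorem youngMap_youngTprod (φ : ∀ i, ((⨂[F] _ : Fin (L i).deg, V i) ⊗[F] (L i).carrier) →ₗ[F]
    (⨂[F] _ : Fin (L i).deg, V i) ⊗[F] (L i).carrier)
    (z : ∀ i, (⨂[F] _ : Fin (L i).deg, V i) ⊗[F] (L i).carrier) :
    youngMap φ (youngTprod z) = youngTprod fun i => φ i (z i) := by
  unfold youngMap youngTprod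
  exact PiTensorProduct.map_tprod (R := F) _ _

theorem youngSpace_hom_ext {W : Type*} [AddCommGroup W] [Module F W]
    {φ φ' : YoungSpace V L →ₗ[F] W} (h : ∀ z, φ (youngTprod z) = φ' (youngTprod z)) : φ = φ' :=
  PiTensorProduct.ext (R := F) (MultilinearMap.ext h)

/-- The base group does not act on the L i, so its compression to the multiplicity space is a
scalar: a product of matrix coefficients at the vectors v i. -/
theorem blockProj_blockBase_blockEmb {n : ℕ} (e : (Σ i, Fin (L i).deg) ≃ Fin n) (v : ∀ i, V i)
    (f : ∀ i, Module.Dual F (V i)) (g : Fin n → G) (y : ⨂[F] i, (L i).carrier) :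
    blockProj f (youngRep ρ L (blockBase G e g) (blockEmb v y)) =
      (∏ q : Σ i, Fin (L i).deg, f q.1 (ρ q.1 (g (e q)) (v q.1))) • y := by
  suffices (blockProj f ∘ₗ youngRep ρ L (blockBase G e g)) ∘ₗ blockEmb v =
      (∏ q : Σ i, Fin (L i).deg, f q.1 (ρ q.1 (g (e q)) (v q.1))) • LinearMap.id from
    LinearMap.congr_fun this y
  refine PiTensorProduct.ext (MultilinearMap.ext fun l => ?_)
  have h2 : youngRep ρ L (blockBase G e g) (youngTprod fun i =>
      (PiTensorProduct.tprod F fun _ : Fin (L i).deg => v i) ⊗ₜ[F] l i) =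
      youngTprod (V := V) (L := L) fun i =>
        (PiTensorProduct.tprod F fun x : Fin (L i).deg => ρ i (g (e ⟨i, x⟩)) (v i)) ⊗ₜ[F] l i := by
    refine (PiTensorProduct.map_tprod _ _).trans (congrArg (PiTensorProduct.tprod F) ?_)
    funext i
    refine (TensorProduct.map_tmul _ _ _ _).trans ?_
    change (wreathPower (ρ i) _ (SemidirectProduct.inl _) _) ⊗ₜ (L i).rep 1 (l i) = _
    rw [wreathPower_inl, PiTensorProduct.map_tprod, map_one]
    rfl
  simp only [LinearMap.compMultilinearMap_apply, LinearMap.comp_apply, blockEmb_tprod, h2,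
    LinearMap.smul_apply, LinearMap.id_apply]
  rw [blockProj_youngTprod]
  simp only [TensorProduct.map_tmul, piTensorDual_tprod, LinearMap.id_apply,
    LinearEquiv.coe_coe, TensorProduct.lid_tmul]
  rw [MultilinearMap.map_smul_univ, Fintype.prod_sigma]

/-- Permuting equal tensor factors v i ⊗ ⋯ ⊗ v i changes nothing, so permutations act through the L
i alone. -/
theorem youngRep_blockPerm_blockEmb (v : ∀ i, V i) (w : ∀ i, Equiv.Perm (Fin (L i).deg))
    (y : ⨂[F] i, (L i).carrier) :
    youngRep ρ L (blockPerm G (fun i => (L i).deg) w) (blockEmb v y) =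
      blockEmb v (outerPiTensor (fun i => (L i).rep) w y) := by
  suffices youngRep ρ L (blockPerm G (fun i => (L i).deg) w) ∘ₗ blockEmb v =
      blockEmb v ∘ₗ outerPiTensor (fun i => (L i).rep) w from LinearMap.congr_fun this y
  refine PiTensorProduct.ext (MultilinearMap.ext fun l => ?_)
  have h2 : outerPiTensor (fun i => (L i).rep) w (PiTensorProduct.tprod F l) =
    PiTensorProduct.tprod F fun i => (L i).rep (w i) (l i) := PiTensorProduct.map_tprod _ _
  simp only [LinearMap.compMultilinearMap_apply, LinearMap.comp_apply, blockEmb_tprod, h2]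
  refine (PiTensorProduct.map_tprod _ _).trans ?_
  congr 1
  funext i
  refine (TensorProduct.map_tmul _ _ _ _).trans ?_
  change (wreathPower (ρ i) _ (SemidirectProduct.inr _) _) ⊗ₜ _ = _
  rw [wreathPower_inr]
  rfl

/-- A tensor product of the rank one operators x ↦ f i x • v i factors through the multiplicity
space. -/
theorem asAlgebraHom_blockBase_eq_blockEmb_blockProj [Finite G] {n : ℕ}
    (e : (Σ i, Fin (L i).deg) ≃ Fin n) {ε : Fin r → F[G]} {v : ∀ i, V i}
    {f : ∀ i, Module.Dual F (V i)} (hε : ∀ i x, (ρ i).asAlgebraHom (ε i) x = f i x • v i)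
    (a : Fin n → F[G]) (ha : ∀ q, a (e q) = ε q.1) (m : YoungSpace V L) :
    Representation.asAlgebraHom ((youngRep ρ L).comp (blockBase G e) :
      Representation F (Fin n → G) _) (pureElement a) m = blockEmb v (blockProj f m) := by
  rw [asAlgebraHom_youngRep_blockBase]
  refine LinearMap.congr_fun (f := youngMap _) (g := blockEmb v ∘ₗ blockProj f)
    (youngSpace_hom_ext fun z => ?_) m
  rw [LinearMap.comp_apply, youngMap_youngTprod, blockProj_youngTprod, blockEmb_tprod]
  congr 1
  funext i
  refine LinearMap.congr_fun (g := (TensorProduct.mk F _ (L i).carrier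
    (PiTensorProduct.tprod F fun _ : Fin (L i).deg => v i)) ∘ₗ
    (TensorProduct.lid F (L i).carrier).toLinearMap ∘ₗ
      TensorProduct.map (piTensorDual fun _ : Fin (L i).deg => f i) LinearMap.id) ?_ (z i)
  refine TensorProduct.ext (PiTensorProduct.ext (MultilinearMap.ext fun x =>
    LinearMap.ext fun l => ?_))
  change TensorProduct.map (PiTensorProduct.map _) LinearMap.id (PiTensorProduct.tprod F x ⊗ₜ l) =
    (PiTensorProduct.tprod F fun _ => v i) ⊗ₜ TensorProduct.lid F (L i).carrier
      (TensorProduct.map (piTensorDual fun _ => f i) LinearMap.id (PiTensorProduct.tprod F x ⊗ₜ l))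
  simp only [TensorProduct.map_tmul, PiTensorProduct.map_tprod, ha, hε, LinearMap.id_apply,
    piTensorDual_tprod, TensorProduct.lid_tmul]
  rw [MultilinearMap.map_smul_univ, TensorProduct.tmul_smul, TensorProduct.smul_tmul']

end Blocks

/-! ### Permutations of the blocks -/

section YoungPerm

variable {r n : ℕ} (d : Fin r → ℕ) (h : ∑ i, d i = n)

/-- The decomposition of `Fin n` into consecutive blocks of lengths `d i`. -/
def youngEquiv : (Σ i, Fin (d i)) ≃ Fin n := finSigmaFinEquiv.trans (finCongr h)

/-- The block containing a letter. -/
def youngColour (j : Fin n) : Fin r := ((youngEquiv d h).symm j).1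

/-- The embedding of `∏ S_{d i}` in `S_n`. -/
def youngPerm : (∀ i, Equiv.Perm (Fin (d i))) →* Equiv.Perm (Fin n) :=
  (youngEquiv d h).permCongrHom.toMonoidHom.comp
    (Equiv.Perm.sigmaCongrRightHom fun i => Fin (d i))

variable {d}

@[simp]
theorem youngColour_youngEquiv (q : Σ i, Fin (d i)) :
    youngColour d h (youngEquiv d h q) = q.1 := by
  simp [youngColour]

theorem youngPerm_youngEquiv (w : ∀ i, Equiv.Perm (Fin (d i))) (q : Σ i, Fin (d i)) :
    youngPerm d h w (youngEquiv d h q) = youngEquiv d h ⟨q.1, w q.1 q.2⟩ := by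
  change youngEquiv d h (Equiv.Perm.sigmaCongrRight w ((youngEquiv d h).symm _)) = _
  rw [Equiv.symm_apply_apply]
  rfl

@[simp]
theorem youngColour_youngPerm (w : ∀ i, Equiv.Perm (Fin (d i))) (j : Fin n) :
    youngColour d h (youngPerm d h w j) = youngColour d h j := by
  obtain ⟨q, rfl⟩ := (youngEquiv d h).surjective j
  rw [youngPerm_youngEquiv, youngColour_youngEquiv, youngColour_youngEquiv]

theorem youngPerm_injective : Function.Injective (youngPerm d h) := by
  intro w w' hw
  funext i
  refine Equiv.ext fun x => ?_
  have := congrArg (fun τ => τ (youngEquiv d h ⟨i, x⟩)) hw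
  simp only [youngPerm_youngEquiv] at this
  simpa using (youngEquiv d h).injective this

/-- The Young subgroup is the full stabilizer of the colouring of the letters by blocks. Cosets of
the Young subgroup can therefore be told apart by colourings. -/
theorem exists_youngPerm_eq (w : Equiv.Perm (Fin n))
    (hw : ∀ j, youngColour d h (w j) = youngColour d h j) : ∃ w', w = youngPerm d h w' := by
  have key : ∀ i (x : Fin (d i)), ∃ y : Fin (d i),
      w (youngEquiv d h ⟨i, x⟩) = youngEquiv d h ⟨i, y⟩ := fun i x => by
    obtain ⟨⟨i', y⟩, hq⟩ := (youngEquiv d h).surjective (w (youngEquiv d h ⟨i, x⟩))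
    obtain rfl : i' = i := by
      have := hw (youngEquiv d h ⟨i, x⟩)
      rwa [← hq, youngColour_youngEquiv, youngColour_youngEquiv] at this
    exact ⟨y, hq.symm⟩
  choose y hy using key
  have hinj : ∀ i, Function.Injective (y i) := fun i x x' hx => by
    have : w (youngEquiv d h ⟨i, x⟩) = w (youngEquiv d h ⟨i, x'⟩) := by rw [hy, hy, hx]
    simpa using (youngEquiv d h).injective (w.injective this)
  refine ⟨fun i => Equiv.ofBijective (y i) (Finite.injective_iff_bijective.1 (hinj i)),
    Equiv.ext fun j => ?_⟩
  obtain ⟨⟨i, x⟩, rfl⟩ := (youngEquiv d h).surjective j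
  rw [youngPerm_youngEquiv, hy]
  rfl

variable {G : Type v} [Group G]

theorem youngHom_blockBase (g : Fin n → G) :
    Wreath.youngHom d h (blockBase G (youngEquiv d h) g) = SemidirectProduct.inl g := by
  refine SemidirectProduct.ext ?_ ?_
  · funext j
    exact congrArg g ((youngEquiv d h).apply_symm_apply j)
  · exact map_one (youngPerm d h)

theorem youngHom_blockPerm (w : ∀ i, Equiv.Perm (Fin (d i))) :
    Wreath.youngHom d h (blockPerm G d w) = SemidirectProduct.inr (youngPerm d h w) := rfl

theorem youngHom_injective : Function.Injective (Wreath.youngHom (G := G) d h) := by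
  intro x y hxy
  have hl := congrArg SemidirectProduct.left hxy
  have hr := congrArg SemidirectProduct.right hxy
  have hr' : (fun i => (x i).right) = fun i => (y i).right := youngPerm_injective h hr
  funext i
  refine SemidirectProduct.ext (funext fun a => ?_) (congrFun hr' i)
  have h1 : (x ((youngEquiv d h).symm (youngEquiv d h ⟨i, a⟩)).1).left
      ((youngEquiv d h).symm (youngEquiv d h ⟨i, a⟩)).2 =
    (y ((youngEquiv d h).symm (youngEquiv d h ⟨i, a⟩)).1).left
      ((youngEquiv d h).symm (youngEquiv d h ⟨i, a⟩)).2 :=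
    congrFun hl (youngEquiv d h ⟨i, a⟩)
  rwa [Equiv.symm_apply_apply] at h1

theorem Wreath.inl_mul_inr {ι : Type} (g : ι → G) (w : Equiv.Perm ι) :
    (SemidirectProduct.inl g * SemidirectProduct.inr w : Wreath G ι) =
      SemidirectProduct.inr w * SemidirectProduct.inl (g ∘ w) := by
  refine SemidirectProduct.ext (funext fun i => ?_) (by simp)
  simp [Wreath.mul_left_apply]

end YoungPerm

/-! ### The corners of the induced modules -/

section WreathCorner

variable {F : Type u} [Field F] {G : Type v} [Group G] {r : ℕ} {V : Fin r → Type w}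
  [∀ i, AddCommGroup (V i)] [∀ i, Module F (V i)] (ρ : ∀ i, Representation F G (V i))
  (L : Fin r → SymRep F) {n : ℕ} (h : ∑ i, (L i).deg = n)

/-- The canonical map from a module to the induced module. -/
def wreathEmb : YoungSpace V L →ₗ[F]
    Representation.IndV (Wreath.youngHom (G := G) (fun i => (L i).deg) h) (youngRep ρ L) :=
  Representation.IndV.mk _ _ 1

theorem wreathInd_youngHom (x : ∀ i, Wreath G (Fin (L i).deg)) (m : YoungSpace V L) :
    wreathInd ρ L h (Wreath.youngHom (fun i => (L i).deg) h x) (wreathEmb ρ L h m) =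
      wreathEmb ρ L h (youngRep ρ L x m) :=
  Representation.ind_mk_one_eq _ _ _ _

theorem wreathInd_inl (g : Fin n → G) (m : YoungSpace V L) :
    wreathInd ρ L h (SemidirectProduct.inl g) (wreathEmb ρ L h m) =
      wreathEmb ρ L h (youngRep ρ L (blockBase G (youngEquiv _ h) g) m) := by
  rw [← wreathInd_youngHom, youngHom_blockBase]

theorem wreathInd_inr_youngPerm (w : ∀ i, Equiv.Perm (Fin (L i).deg)) (m : YoungSpace V L) :
    wreathInd ρ L h (SemidirectProduct.inr (youngPerm _ h w)) (wreathEmb ρ L h m) =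
      wreathEmb ρ L h (youngRep ρ L (blockPerm G _ w) m) := by
  rw [← wreathInd_youngHom, youngHom_blockPerm]

theorem wreathInd_inl_inr (g : Fin n → G) (w : Equiv.Perm (Fin n)) (m : YoungSpace V L) :
    wreathInd ρ L h (SemidirectProduct.inl g)
        (wreathInd ρ L h (SemidirectProduct.inr w) (wreathEmb ρ L h m)) =
      wreathInd ρ L h (SemidirectProduct.inr w)
        (wreathEmb ρ L h (youngRep ρ L (blockBase G (youngEquiv _ h) (g ∘ w)) m)) := by
  rw [← wreathInd_inl, ← Module.End.mul_apply, ← map_mul, Wreath.inl_mul_inr, map_mul,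
    Module.End.mul_apply]

theorem wreathInd_induction
    (p : Submodule F (Representation.IndV (Wreath.youngHom (G := G) (fun i => (L i).deg) h)
      (youngRep ρ L)))
    (hp : ∀ w m, wreathInd ρ L h (SemidirectProduct.inr w) (wreathEmb ρ L h m) ∈ p)
    (x : Representation.IndV (Wreath.youngHom (G := G) (fun i => (L i).deg) h)
      (youngRep ρ L)) : x ∈ p := by
  refine Representation.ind_induction _ _ p (fun γ m => ?_) x
  have := hp γ.right (youngRep ρ L (blockBase G (youngEquiv _ h) (γ.left ∘ γ.right)) m)
  rw [← wreathInd_inl_inr, ← Module.End.mul_apply, ← map_mul,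
    SemidirectProduct.inl_left_mul_inr_right] at this
  exact this

variable [Finite G]

/-- Moving a permutation past the base group permutes the factors of a pure tensor, so its action on
a translate reduces to the action on the inducing module. -/
theorem asAlgebraHom_wreathInd_inl (a : Fin n → F[G]) (w : Equiv.Perm (Fin n))
    (m : YoungSpace V L) :
    Representation.asAlgebraHom ((wreathInd ρ L h).comp SemidirectProduct.inl :
        Representation F (Fin n → G) _) (pureElement a)
        (wreathInd ρ L h (SemidirectProduct.inr w) (wreathEmb ρ L h m)) =
      wreathInd ρ L h (SemidirectProduct.inr w) (wreathEmb ρ L h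
        (Representation.asAlgebraHom ((youngRep ρ L).comp (blockBase G (youngEquiv _ h)) :
          Representation F (Fin n → G) _) (pureElement (a ∘ w)) m)) := by
  let c : (Fin n → G) →* (Fin n → G) :=
    { toFun := fun g => g ∘ w, map_one' := rfl, map_mul' := fun _ _ => rfl }
  have hc : Function.Injective c := w.surjective.injective_comp_right
  have h1 : MonoidAlgebra.mapDomainAlgHom F F c (pureElement a) =
      pureElement (a ∘ w) := by
    ext g
    obtain ⟨g, rfl⟩ : ∃ g', c g' = g := ⟨g ∘ w.symm, by
      funext j; exact congrArg g (w.symm_apply_apply j)⟩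
    rw [MonoidAlgebra.coeff_mapDomainAlgHom_of_injective hc, coeff_pureElement, coeff_pureElement]
    exact (Equiv.prod_comp w fun j => (a j).coeff (g j)).symm
  rw [← h1]
  generalize pureElement a = z
  induction z using MonoidAlgebra.induction_linear with
  | zero => simp
  | add x y hx hy => simp only [map_add, LinearMap.add_apply, hx, hy]
  | single g s =>
    have h2 : MonoidAlgebra.mapDomainAlgHom F F c (MonoidAlgebra.single g s) =
      MonoidAlgebra.single (g ∘ w) s := by simp [c]
    rw [h2, Representation.asAlgebraHom_single, Representation.asAlgebraHom_single,
      LinearMap.smul_apply, LinearMap.smul_apply, map_smul, map_smul]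
    congr 1
    exact wreathInd_inl_inr ρ L h g w m

variable {ρ L}

/-- One factor of the tensor that annihilates the V at its position is enough to kill the translate.
-/
theorem asAlgebraHom_wreathInd_inl_eq_zero {a : Fin n → F[G]} {w : Equiv.Perm (Fin n)}
    {q : Σ i, Fin (L i).deg} (hq : (ρ q.1).asAlgebraHom (a (w (youngEquiv _ h q))) = 0)
    (m : YoungSpace V L) :
    Representation.asAlgebraHom ((wreathInd ρ L h).comp SemidirectProduct.inl :
        Representation F (Fin n → G) _) (pureElement a)
        (wreathInd ρ L h (SemidirectProduct.inr w) (wreathEmb ρ L h m)) = 0 := by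
  rw [asAlgebraHom_wreathInd_inl, asAlgebraHom_youngRep_blockBase]
  have h1 : (PiTensorProduct.map fun x => (ρ q.1).asAlgebraHom
      ((a ∘ w) (youngEquiv _ h ⟨q.1, x⟩))) = 0 := by
    refine PiTensorProduct.ext (MultilinearMap.ext fun z => ?_)
    simp only [LinearMap.compMultilinearMap_apply, PiTensorProduct.map_tprod]
    refine MultilinearMap.map_coord_zero _ q.2 ?_
    change (ρ q.1).asAlgebraHom (a (w (youngEquiv _ h q))) _ = 0
    rw [hq, LinearMap.zero_apply]
  have h2 : (youngMap (V := V) (L := L) fun i => TensorProduct.map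
        (PiTensorProduct.map fun x => (ρ i).asAlgebraHom ((a ∘ w) (youngEquiv _ h ⟨i, x⟩)))
          LinearMap.id) = 0 := by
    refine youngSpace_hom_ext fun z => ?_
    rw [youngMap_youngTprod, LinearMap.zero_apply]
    refine MultilinearMap.map_coord_zero (PiTensorProduct.tprod F) q.1 ?_
    rw [h1, TensorProduct.map_zero_left, LinearMap.zero_apply]
  rw [h2, LinearMap.zero_apply, map_zero, map_zero]

theorem asAlgebraHom_wreathInd_inl_eq_self {a : Fin n → F[G]} {w : Equiv.Perm (Fin n)}
    (hq : ∀ q : Σ i, Fin (L i).deg, (ρ q.1).asAlgebraHom (a (w (youngEquiv _ h q))) = 1)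
    (m : YoungSpace V L) :
    Representation.asAlgebraHom ((wreathInd ρ L h).comp SemidirectProduct.inl :
        Representation F (Fin n → G) _) (pureElement a)
        (wreathInd ρ L h (SemidirectProduct.inr w) (wreathEmb ρ L h m)) =
      wreathInd ρ L h (SemidirectProduct.inr w) (wreathEmb ρ L h m) := by
  rw [asAlgebraHom_wreathInd_inl, asAlgebraHom_youngRep_blockBase]
  have h2 : (youngMap (V := V) (L := L) fun i => TensorProduct.map
        (PiTensorProduct.map fun x => (ρ i).asAlgebraHom ((a ∘ w) (youngEquiv _ h ⟨i, x⟩)))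
          LinearMap.id) = LinearMap.id := by
    refine youngSpace_hom_ext fun z => ?_
    rw [youngMap_youngTprod, LinearMap.id_apply]
    refine congrArg (youngTprod (V := V) (L := L)) (funext fun i => ?_)
    have : ∀ x, (ρ i).asAlgebraHom ((a ∘ w) (youngEquiv _ h ⟨i, x⟩)) = LinearMap.id :=
      fun x => hq ⟨i, x⟩
    simp only [this, PiTensorProduct.map_id, TensorProduct.map_id, LinearMap.id_apply]
  rw [h2, LinearMap.id_apply]

theorem asAlgebraHom_wreathInd_inl_eq_blockEmb {ε : Fin r → F[G]} {v : ∀ i, V i}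
    {f : ∀ i, Module.Dual F (V i)} (hε : ∀ i x, (ρ i).asAlgebraHom (ε i) x = f i x • v i)
    (s : Equiv.Perm (Fin n)) (m : YoungSpace V L) :
    Representation.asAlgebraHom ((wreathInd ρ L h).comp SemidirectProduct.inl :
        Representation F (Fin n → G) _)
        (pureElement fun j => ε (youngColour _ h (s.symm j)))
        (wreathInd ρ L h (SemidirectProduct.inr s) (wreathEmb ρ L h m)) =
      wreathInd ρ L h (SemidirectProduct.inr s)
        (wreathEmb ρ L h (blockEmb v (blockProj f m))) := by
  rw [asAlgebraHom_wreathInd_inl,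
    asAlgebraHom_blockBase_eq_blockEmb_blockProj (youngEquiv _ h) hε]
  intro q
  simp

theorem blockProj_blockEmb {v : ∀ i, V i} {f : ∀ i, Module.Dual F (V i)}
    (hf : ∀ i, f i (v i) = 1) (y : ⨂[F] i, (L i).carrier) :
    blockProj f (blockEmb v y) = y := by
  suffices blockProj f ∘ₗ blockEmb v = LinearMap.id from LinearMap.congr_fun this y
  refine PiTensorProduct.ext (MultilinearMap.ext fun l => ?_)
  simp [blockEmb_tprod, blockProj_youngTprod, piTensorDual_tprod, hf]

theorem asAlgebraHom_wreathInd_inl_inr_mul_youngPerm {ε : Fin r → F[G]} {v : ∀ i, V i}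
    {f : ∀ i, Module.Dual F (V i)} (hε : ∀ i x, (ρ i).asAlgebraHom (ε i) x = f i x • v i)
    (s : Equiv.Perm (Fin n)) (w : ∀ i, Equiv.Perm (Fin (L i).deg)) (m : YoungSpace V L) :
    Representation.asAlgebraHom ((wreathInd ρ L h).comp SemidirectProduct.inl :
        Representation F (Fin n → G) _)
        (pureElement fun j => ε (youngColour _ h (s.symm j)))
        (wreathInd ρ L h (SemidirectProduct.inr (s * youngPerm _ h w)) (wreathEmb ρ L h m)) =
      wreathInd ρ L h (SemidirectProduct.inr s) (wreathEmb ρ L h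
        (blockEmb v (blockProj f (youngRep ρ L (blockPerm G _ w) m)))) := by
  rw [map_mul, map_mul, Module.End.mul_apply, wreathInd_inr_youngPerm,
    asAlgebraHom_wreathInd_inl_eq_blockEmb h hε]

/-- Different cosets of the Young subgroup have different colourings, so at some position an ε i
meets a V j with j ≠ i. -/
theorem asAlgebraHom_wreathInd_inl_inr_of_ne {ε : Fin r → F[G]}
    (hε0 : ∀ i j, j ≠ i → (ρ j).asAlgebraHom (ε i) = 0) (s w : Equiv.Perm (Fin n))
    (hw : ∀ w', w ≠ s * youngPerm _ h w') (m : YoungSpace V L) :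
    Representation.asAlgebraHom ((wreathInd ρ L h).comp SemidirectProduct.inl :
        Representation F (Fin n → G) _)
        (pureElement fun j => ε (youngColour _ h (s.symm j)))
        (wreathInd ρ L h (SemidirectProduct.inr w) (wreathEmb ρ L h m)) = 0 := by
  by_cases hc : ∀ j, youngColour _ h ((s⁻¹ * w) j) = youngColour _ h j
  · obtain ⟨w', hw'⟩ := exists_youngPerm_eq h _ hc
    exact absurd (by rw [← hw', mul_inv_cancel_left]) (hw w')
  · push Not at hc
    obtain ⟨j, hj⟩ := hc
    obtain ⟨q, rfl⟩ := (youngEquiv (fun i => (L i).deg) h).surjective j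
    rw [youngColour_youngEquiv, Equiv.Perm.mul_apply, Equiv.Perm.inv_def] at hj
    have := hε0 _ _ hj.symm
    exact asAlgebraHom_wreathInd_inl_eq_zero h
      (a := fun j => ε (youngColour _ h (s.symm j))) (q := q) this m

theorem asAlgebraHom_wreathInd_inl_mem_range {ε : Fin r → F[G]} {v : ∀ i, V i}
    {f : ∀ i, Module.Dual F (V i)} (hε : ∀ i x, (ρ i).asAlgebraHom (ε i) x = f i x • v i)
    (hε0 : ∀ i j, j ≠ i → (ρ j).asAlgebraHom (ε i) = 0) (s : Equiv.Perm (Fin n))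
    (x : Representation.IndV (Wreath.youngHom (G := G) (fun i => (L i).deg) h)
      (youngRep ρ L)) :
    ∃ y, Representation.asAlgebraHom ((wreathInd ρ L h).comp SemidirectProduct.inl :
        Representation F (Fin n → G) _)
        (pureElement fun j => ε (youngColour _ h (s.symm j))) x =
      (wreathInd ρ L h (SemidirectProduct.inr s) ∘ₗ wreathEmb ρ L h ∘ₗ blockEmb v) y := by
  have := wreathInd_induction ρ L h (Submodule.comap
      (Representation.asAlgebraHom ((wreathInd ρ L h).comp SemidirectProduct.inl :
        Representation F (Fin n → G) _)
        (pureElement fun j => ε (youngColour _ h (s.symm j))))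
      (LinearMap.range (wreathInd ρ L h (SemidirectProduct.inr s) ∘ₗ
        wreathEmb ρ L h ∘ₗ blockEmb v))) (fun w m => ?_) x
  · obtain ⟨y, hy⟩ := this
    exact ⟨y, hy.symm⟩
  · rw [Submodule.mem_comap]
    by_cases hw : ∃ w', w = s * youngPerm _ h w'
    · obtain ⟨w', rfl⟩ := hw
      rw [asAlgebraHom_wreathInd_inl_inr_mul_youngPerm h hε]
      exact ⟨_, rfl⟩
    · push Not at hw
      rw [asAlgebraHom_wreathInd_inl_inr_of_ne h hε0 s w hw]
      exact zero_mem _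

/-- The compression formula. Write γ s' as s times a base element times a Young permutation w: then
w passes to the multiplicity space, and the base element contributes its product of matrix
coefficients. -/
theorem asAlgebraHom_wreathInd_inl_wreathInd {ε : Fin r → F[G]} {v : ∀ i, V i}
    {f : ∀ i, Module.Dual F (V i)} (hε : ∀ i x, (ρ i).asAlgebraHom (ε i) x = f i x • v i)
    {s s' : Equiv.Perm (Fin n)} {γ : Wreath G (Fin n)} {w : ∀ i, Equiv.Perm (Fin (L i).deg)}
    (hw : γ.right * s' = s * youngPerm _ h w) (y : ⨂[F] i, (L i).carrier) :
    Representation.asAlgebraHom ((wreathInd ρ L h).comp SemidirectProduct.inl :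
        Representation F (Fin n → G) _)
        (pureElement fun j => ε (youngColour _ h (s.symm j)))
        (wreathInd ρ L h γ (wreathInd ρ L h (SemidirectProduct.inr s')
          (wreathEmb ρ L h (blockEmb v y)))) =
      wreathInd ρ L h (SemidirectProduct.inr s) (wreathEmb ρ L h (blockEmb v
        ((∏ j, f (youngColour _ h (s.symm j))
          (ρ _ (γ.left j) (v (youngColour _ h (s.symm j))))) •
            outerPiTensor (fun i => (L i).rep) w y))) := by
  have h1 : wreathInd ρ L h γ (wreathInd ρ L h (SemidirectProduct.inr s')
          (wreathEmb ρ L h (blockEmb v y))) =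
      wreathInd ρ L h (SemidirectProduct.inr s) (wreathEmb ρ L h
        (youngRep ρ L (blockBase G (youngEquiv _ h) (γ.left ∘ s))
          (blockEmb v (outerPiTensor (fun i => (L i).rep) w y)))) := by
    rw [← youngRep_blockPerm_blockEmb (ρ := ρ), ← wreathInd_inl_inr, ← wreathInd_inr_youngPerm,
      ← Module.End.mul_apply (wreathInd ρ L h (SemidirectProduct.inr s)), ← map_mul, ← map_mul,
      ← hw, map_mul, ← Module.End.mul_apply, ← map_mul, ← Module.End.mul_apply, ← map_mul,
      ← mul_assoc, SemidirectProduct.inl_left_mul_inr_right]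
  rw [h1, asAlgebraHom_wreathInd_inl_eq_blockEmb h hε, blockProj_blockBase_blockEmb]
  refine congrArg (fun c : F => wreathInd ρ L h (SemidirectProduct.inr s) (wreathEmb ρ L h
    (blockEmb v (c • outerPiTensor (fun i => (L i).rep) w y)))) ?_
  rw [← Equiv.prod_comp ((youngEquiv _ h).trans s)]
  refine Finset.prod_congr rfl fun q _ => ?_
  have : youngColour (fun i => (L i).deg) h (s.symm (((youngEquiv _ h).trans s) q)) = q.1 := by simp
  rw [this]
  rfl

theorem asAlgebraHom_wreathInd_inl_wreathInd_of_ne {ε : Fin r → F[G]}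
    (hε0 : ∀ i j, j ≠ i → (ρ j).asAlgebraHom (ε i) = 0)
    {s s' : Equiv.Perm (Fin n)} {γ : Wreath G (Fin n)}
    (hw : ∀ w, γ.right * s' ≠ s * youngPerm _ h w) (m : YoungSpace V L) :
    Representation.asAlgebraHom ((wreathInd ρ L h).comp SemidirectProduct.inl :
        Representation F (Fin n → G) _)
        (pureElement fun j => ε (youngColour _ h (s.symm j)))
        (wreathInd ρ L h γ (wreathInd ρ L h (SemidirectProduct.inr s')
          (wreathEmb ρ L h m))) = 0 := by
  have h1 : wreathInd ρ L h γ (wreathInd ρ L h (SemidirectProduct.inr s') (wreathEmb ρ L h m)) =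
      wreathInd ρ L h (SemidirectProduct.inr (γ.right * s')) (wreathEmb ρ L h
        (youngRep ρ L (blockBase G (youngEquiv _ h) (γ.left ∘ ⇑(γ.right * s'))) m)) := by
    rw [← wreathInd_inl_inr, ← Module.End.mul_apply, ← map_mul, ← Module.End.mul_apply, ← map_mul,
      map_mul SemidirectProduct.inr, ← mul_assoc, SemidirectProduct.inl_left_mul_inr_right]
  rw [h1, asAlgebraHom_wreathInd_inl_inr_of_ne h hε0 s _ hw]

/-- Sums of conjugates of the elements `u` act as the identity on an induced module. -/
theorem exists_sum_wreathInd_eq {u : Fin r → F[G]} (hu1 : ∀ i, (ρ i).asAlgebraHom (u i) = 1)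
    (hu0 : ∀ i j, j ≠ i → (ρ j).asAlgebraHom (u i) = 0) {Γ : Type*}
    (U : Γ → Module.End F (Representation.IndV (Wreath.youngHom (G := G) (fun i => (L i).deg) h)
      (youngRep ρ L)))
    (hU : ∀ w, ∃ γ τ s w', w = τ * s * youngPerm _ h w' ∧
      U γ = wreathInd ρ L h (SemidirectProduct.inr τ) *
        Representation.asAlgebraHom ((wreathInd ρ L h).comp SemidirectProduct.inl :
          Representation F (Fin n → G) _) (pureElement fun j => u (youngColour _ h (s.symm j))) *
        wreathInd ρ L h (SemidirectProduct.inr τ⁻¹)) :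
    ∃ (S : Finset (Fin n → Fin r)) (p : (Fin n → Fin r) → Γ), ∑ y ∈ S, U (p y) = 1 := by
  classical
  choose γ τ s w' hw hUγ using hU
  -- The colouring c w determines the coset of w. The operator U (γ w) is the projection onto the
  -- translates of colouring c w, so choosing one w per colouring makes these projections add up to
  -- 1 without repetition.
  let c : Equiv.Perm (Fin n) → Fin n → Fin r := fun w j => youngColour _ h (w.symm j)
  have hact : ∀ w w₁ m, U (γ w) (wreathInd ρ L h (SemidirectProduct.inr w₁)
      (wreathEmb ρ L h m)) = if c w = c w₁ then wreathInd ρ L h (SemidirectProduct.inr w₁)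
      (wreathEmb ρ L h m) else 0 := by
    intro w w₁ m
    have h1 : wreathInd ρ L h (SemidirectProduct.inr (τ w)⁻¹)
        (wreathInd ρ L h (SemidirectProduct.inr w₁) (wreathEmb ρ L h m)) =
        wreathInd ρ L h (SemidirectProduct.inr ((τ w)⁻¹ * w₁)) (wreathEmb ρ L h m) := by
      rw [← Module.End.mul_apply, ← map_mul, ← map_mul]
    have h2 : ∀ j, youngColour (fun i => (L i).deg) h ((s w).symm (((τ w)⁻¹ * w₁) j)) =
        c w (w₁ j) := fun j => by
      have : ((s w).symm (((τ w)⁻¹ * w₁) j)) = youngPerm _ h (w' w) (w.symm (w₁ j)) := by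
        obtain ⟨x, hx⟩ := w.surjective (w₁ j)
        rw [Equiv.Perm.mul_apply, ← hx, Equiv.symm_apply_apply, Equiv.symm_apply_eq,
          Equiv.Perm.inv_eq_iff_eq]
        exact congrArg (fun σ : Equiv.Perm (Fin n) => σ x) (hw w)
      rw [this, youngColour_youngPerm]
    rw [hUγ, Module.End.mul_apply, Module.End.mul_apply, h1]
    split_ifs with hc
    · rw [asAlgebraHom_wreathInd_inl_eq_self h (fun q => ?_), ← Module.End.mul_apply, ← map_mul,
        ← map_mul, mul_inv_cancel_left]
      rw [h2, hc]
      simp [c, hu1]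
    · obtain ⟨j, hj⟩ : ∃ j, c w (w₁ j) ≠ c w₁ (w₁ j) := by
        by_contra! hcon
        exact hc (funext fun j => by simpa using hcon (w₁.symm j))
      obtain ⟨q, rfl⟩ := (youngEquiv (fun i => (L i).deg) h).surjective j
      have h3 : c w₁ (w₁ (youngEquiv _ h q)) = q.1 := by simp [c]
      have h4 := hu0 _ _ (h3 ▸ hj.symm)
      rw [← h2] at h4
      rw [asAlgebraHom_wreathInd_inl_eq_zero h
        (a := fun j => u (youngColour _ h ((s w).symm j))) (q := q) h4, map_zero]
  choose! p hp using fun (y : Fin n → Fin r) (hy : y ∈ Finset.univ.image c) =>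
    (Finset.mem_image.1 hy).imp fun _ h => h.2
  refine ⟨Finset.univ.image c, fun y => γ (p y), LinearMap.ext fun x => ?_⟩
  refine wreathInd_induction ρ L h (LinearMap.eqLocus
    (∑ y ∈ Finset.univ.image c, U (γ (p y))) 1) (fun w m => ?_) x
  rw [LinearMap.mem_eqLocus, LinearMap.sum_apply, Module.End.one_apply]
  have hcw : c w ∈ Finset.univ.image c := Finset.mem_image_of_mem c (Finset.mem_univ w)
  rw [Finset.sum_eq_single (c w) (fun y hy hyw => ?_) (fun hw => absurd hcw hw), hact,
    if_pos (hp _ hcw)]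
  rw [hact, if_neg (by rwa [hp y hy])]

set_option maxHeartbeats 1000000 in
/-- The corners of an induced module, restricted along `θ`. -/
theorem isModuleCorner_wreathInd {Γ : Type*} [Group Γ] (θ : Γ →* Wreath G (Fin n))
    (b : (Fin n → G) →* Γ) (hb : ∀ g, θ (b g) = SemidirectProduct.inl g)
    {ε u : Fin r → F[G]} {v : ∀ i, V i} {f : ∀ i, Module.Dual F (V i)} (hf : ∀ i, f i (v i) = 1)
    (hε : ∀ i x, (ρ i).asAlgebraHom (ε i) x = f i x • v i)
    (hε0 : ∀ i j, j ≠ i → (ρ j).asAlgebraHom (ε i) = 0)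
    (hu : ∀ i, u i ∈ TwoSidedIdeal.span {ε i}) (hu1 : ∀ i, (ρ i).asAlgebraHom (u i) = 1)
    (hu0 : ∀ i j, j ≠ i → (ρ j).asAlgebraHom (u i) = 0)
    {K : Type*} (s : K → Equiv.Perm (Fin n)) {Q : K → Type*} [∀ k, Group (Q k)]
    (q : ∀ k, Q k →* ∀ i, Equiv.Perm (Fin (L i).deg)) (T : ∀ k, Γ → F[Q k])
    (hT : ∀ k γ σ, (θ γ).right * s k = s k * youngPerm _ h (q k σ) →
      T k γ = MonoidAlgebra.single σ (∏ j, f (youngColour _ h ((s k).symm j))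
        (ρ _ ((θ γ).left j) (v (youngColour _ h ((s k).symm j))))))
    (hT0 : ∀ k γ, (∀ σ, (θ γ).right * s k ≠ s k * youngPerm _ h (q k σ)) → T k γ = 0)
    (H1 : ∀ k l γ w, (θ γ).right * s l = s k * youngPerm _ h w → k = l ∧ w ∈ (q k).range)
    (H2 : ∀ k σ, ∃ γ, θ γ = SemidirectProduct.inr (s k * youngPerm _ h (q k σ) * (s k)⁻¹))
    (H3 : ∀ w, ∃ k γ τ w', θ γ = SemidirectProduct.inr τ ∧ w = τ * s k * youngPerm _ h w') :
    IsModuleCorner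
      (fun k => MonoidAlgebra.mapDomainAlgHom F F b
        (pureElement fun j => ε (youngColour _ h ((s k).symm j))))
      (fun k => groupAlgebraLift (T k))
      (X := Representation.asModule ((wreathInd ρ L h).comp θ : Representation F Γ _))
      (Y := fun k => Representation.asModule
        ((outerPiTensor fun i => (L i).rep).comp (q k) : Representation F (Q k) _))
      (fun k => (wreathInd ρ L h (SemidirectProduct.inr (s k)) ∘ₗ
        wreathEmb ρ L h ∘ₗ blockEmb v).toAddMonoidHom) := by
  classical
  have hθb : ∀ z, Representation.asAlgebraHom ((wreathInd ρ L h).comp θ : Representation F Γ _)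
      (MonoidAlgebra.mapDomainAlgHom F F b z) =
      Representation.asAlgebraHom ((wreathInd ρ L h).comp SemidirectProduct.inl :
        Representation F (Fin n → G) _) z := fun z => by
    rw [← Representation.asAlgebraHom_comp]
    have : (((wreathInd ρ L h).comp θ).comp b : Representation F (Fin n → G) _) =
        (wreathInd ρ L h).comp SemidirectProduct.inl :=
      MonoidHom.ext fun g => congrArg (wreathInd ρ L h) (hb g)
    rw [this]
  -- The permutations s k represent the double cosets of the image of θ and the Young subgroup: `H3`
  -- says that all are met and `H1` that they are distinct. By `H1` and `H2`, the image of q k is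
  -- the part of the Young subgroup which s k conjugates into the image of θ.
  refine IsModuleCorner.of_rep (S := Q) (Y := fun _ => ⨂[F] i, (L i).carrier)
    ((wreathInd ρ L h).comp θ : Representation F Γ _)
    (fun k => ((outerPiTensor fun i => (L i).rep).comp (q k) :
      Representation F (Q k) (⨂[F] i, (L i).carrier)))
    (fun k => MonoidAlgebra.mapDomainAlgHom F F b
        (pureElement fun j => ε (youngColour _ h ((s k).symm j)))) T
    (fun k => wreathInd ρ L h (SemidirectProduct.inr (s k)) ∘ₗ
        wreathEmb ρ L h ∘ₗ blockEmb v) (fun k => ?_) (fun k σ => ?_) (fun k x => ?_)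
    (fun k γ y => ?_) (fun k l hkl γ y => ?_) (fun x => ?_)
  · refine (((wreathInd ρ L h).apply_bijective _).1.comp
      (Representation.indV_mk_one_injective (youngHom_injective h) _)).comp ?_
    exact Function.LeftInverse.injective (blockProj_blockEmb hf)
  · obtain ⟨γ, hγ⟩ := H2 k σ
    refine ⟨γ, ?_⟩
    rw [hT k γ σ (by rw [hγ]; simp [mul_assoc]), hγ]
    simp [hf]
  · rw [hθb]
    exact asAlgebraHom_wreathInd_inl_mem_range h hε hε0 (s k) x
  · rw [hθb]
    change Representation.asAlgebraHom ((wreathInd ρ L h).comp SemidirectProduct.inl :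
        Representation F (Fin n → G) _) _ (wreathInd ρ L h (θ γ) (wreathInd ρ L h
          (SemidirectProduct.inr (s k)) (wreathEmb ρ L h (blockEmb v y)))) =
      wreathInd ρ L h (SemidirectProduct.inr (s k)) (wreathEmb ρ L h (blockEmb v _))
    by_cases hσ : ∃ σ, (θ γ).right * s k = s k * youngPerm _ h (q k σ)
    · obtain ⟨σ, hσ⟩ := hσ
      rw [hT k γ σ hσ, Representation.asAlgebraHom_single,
        asAlgebraHom_wreathInd_inl_wreathInd h hε hσ]
      rfl
    · push Not at hσ
      rw [hT0 k γ hσ, asAlgebraHom_wreathInd_inl_wreathInd_of_ne h hε0 (fun w hw => ?_)]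
      · simp
      · obtain ⟨σ, rfl⟩ := (H1 k k γ w hw).2
        exact hσ σ hw
  · rw [hθb]
    exact asAlgebraHom_wreathInd_inl_wreathInd_of_ne h hε0
      (fun w hw => hkl (H1 k l γ w hw).1) (blockEmb v y)
  -- Conjugates under Γ of the tensors of the u i: one conjugate for each coset in the double cosets
  -- of the s k is needed to reach every translate.
  · let a : Γ × K → F[Γ] := fun z => MonoidAlgebra.single z.1 1 *
      MonoidAlgebra.mapDomainAlgHom F F b
        (pureElement fun j => u (youngColour _ h ((s z.2).symm j))) *
      MonoidAlgebra.single z.1⁻¹ 1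
    obtain ⟨S, p, hSp⟩ := exists_sum_wreathInd_eq h hu1 hu0
      (fun z => Representation.asAlgebraHom ((wreathInd ρ L h).comp θ : Representation F Γ _) (a z))
      (fun w => by
        obtain ⟨k, γ, τ, w', hγ, hw⟩ := H3 w
        refine ⟨(γ, k), τ, s k, w', hw, ?_⟩
        simp only [a, map_mul, hθb, Representation.asAlgebraHom_single_one]
        rw [MonoidHom.comp_apply, MonoidHom.comp_apply, map_inv, hγ, map_inv SemidirectProduct.inr])
    refine ⟨∑ y ∈ S, a (p y), sum_mem fun y _ => ?_, ?_⟩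
    · refine TwoSidedIdeal.mul_mem_right _ _ _ (TwoSidedIdeal.mul_mem_left _ _ _ ?_)
      have h1 := TwoSidedIdeal.map_mem_span (MonoidAlgebra.mapDomainAlgHom F F b).toRingHom
        (pureElement_mem_span fun j => hu (youngColour _ h ((s (p y).2).symm j)))
      rw [Set.image_singleton] at h1
      refine TwoSidedIdeal.span_mono (Set.singleton_subset_iff.2 ?_) h1
      exact ⟨(p y).2, rfl⟩
    · rw [map_sum, hSp, Module.End.one_apply]

end WreathCorner

/-! ### Corners of outer tensor products -/

section OuterTensor

/-- Local units: the correction 1 - (1 - u')(1 - u) keeps the vectors fixed by u and adds one more.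
-/
theorem exists_forall_smul_eq {A X : Type*} [Ring A] [AddCommGroup X] [Module A X]
    {I : TwoSidedIdeal A} (hI : ∀ x : X, ∃ u ∈ I, u • x = x) (S : Finset X) :
    ∃ u ∈ I, ∀ x ∈ S, u • x = x := by
  classical
  induction S using Finset.induction_on with
  | empty => exact ⟨0, I.zero_mem, by simp⟩
  | insert x S _ ih =>
    obtain ⟨u, hu, hS⟩ := ih
    obtain ⟨u', hu', hx⟩ := hI (x - u • x)
    refine ⟨u + (u' - u' * u), I.add_mem hu (I.sub_mem hu' (I.mul_mem_left _ _ hu)),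
      fun y hy => ?_⟩
    rw [add_smul, sub_smul, mul_smul, ← smul_sub]
    obtain rfl | hy := Finset.mem_insert.1 hy
    · rw [hx, add_sub_cancel]
    · rw [hS y hy, sub_self, smul_zero, add_zero]

variable {F : Type*} [Field F] {Γ H X W : Type*} [Group Γ] [Group H] [AddCommGroup X] [Module F X]
  [AddCommGroup W] [Module F W] (R : Representation F Γ X) (ρ : Representation F H W)

theorem asAlgebraHom_outerTensor_inl (a : F[Γ]) :
    (outerTensor R ρ).asAlgebraHom
      (MonoidAlgebra.mapDomainAlgHom F F (MonoidHom.inl Γ H) a) =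
        TensorProduct.map (R.asAlgebraHom a) LinearMap.id := by
  induction a using MonoidAlgebra.induction_linear with
  | zero => simp
  | add x y hx hy => rw [map_add, map_add, hx, hy, map_add, TensorProduct.map_add_left]
  | single g c =>
    have h : MonoidAlgebra.mapDomainAlgHom F F (MonoidHom.inl Γ H) (MonoidAlgebra.single g c) =
      MonoidAlgebra.single (g, 1) c := by simp
    rw [h, Representation.asAlgebraHom_single, Representation.asAlgebraHom_single,
      TensorProduct.map_smul_left]
    congr 1
    change TensorProduct.map (R g) (ρ 1) = _
    rw [map_one]
    rfl

theorem asAlgebraHom_outerTensor_inr (a : F[H]) :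
    (outerTensor R ρ).asAlgebraHom
      (MonoidAlgebra.mapDomainAlgHom F F (MonoidHom.inr Γ H) a) =
        TensorProduct.map LinearMap.id (ρ.asAlgebraHom a) := by
  induction a using MonoidAlgebra.induction_linear with
  | zero => simp
  | add x y hx hy => rw [map_add, map_add, hx, hy, map_add, TensorProduct.map_add_right]
  | single g c =>
    have h : MonoidAlgebra.mapDomainAlgHom F F (MonoidHom.inr Γ H) (MonoidAlgebra.single g c) =
      MonoidAlgebra.single (1, g) c := by simp
    rw [h, Representation.asAlgebraHom_single, Representation.asAlgebraHom_single,
      TensorProduct.map_smul_right]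
    congr 1
    change TensorProduct.map (R 1) (ρ g) = _
    rw [map_one]
    rfl

/-- The images of F[Γ] and F[H] commute, so a product of c e d and a ε b regroups as (c a)(e ε)(d
b). -/
theorem map_inl_mul_map_inr_mem_span {e u : F[Γ]} {ε u' : F[H]}
    (hu : u ∈ TwoSidedIdeal.span {e}) (hu' : u' ∈ TwoSidedIdeal.span {ε}) :
    MonoidAlgebra.mapDomainAlgHom F F (MonoidHom.inl Γ H) u *
        MonoidAlgebra.mapDomainAlgHom F F (MonoidHom.inr Γ H) u' ∈
      TwoSidedIdeal.span {MonoidAlgebra.mapDomainAlgHom F F (MonoidHom.inl Γ H) e *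
        MonoidAlgebra.mapDomainAlgHom F F (MonoidHom.inr Γ H) ε} := by
  set φ := MonoidAlgebra.mapDomainAlgHom F F (MonoidHom.inl Γ H)
  set ψ := MonoidAlgebra.mapDomainAlgHom F F (MonoidHom.inr Γ H)
  have hcomm : ∀ a b, φ a * ψ b = ψ b * φ a := fun a b => by
    induction a using MonoidAlgebra.induction_linear with
    | zero => simp
    | add x y hx hy => rw [map_add, add_mul, mul_add, hx, hy]
    | single g c =>
      induction b using MonoidAlgebra.induction_linear with
      | zero => simp
      | add x y hx hy => rw [map_add, add_mul, mul_add, hx, hy]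
      | single h d => simp [φ, ψ, mul_comm c d]
  set I := TwoSidedIdeal.span {φ e * ψ ε}
  rw [TwoSidedIdeal.mem_span_iff_mem_addSubgroup_closure] at hu
  induction hu using AddSubgroup.closure_induction with
  | zero => rw [map_zero, zero_mul]; exact I.zero_mem
  | add x y _ _ hx hy => rw [map_add, add_mul]; exact I.add_mem hx hy
  | neg x _ hx => rw [map_neg, neg_mul]; exact I.neg_mem hx
  | mem x hx =>
    obtain ⟨_, ⟨c, -, e', he, rfl⟩, d, -, rfl⟩ := hx
    rw [TwoSidedIdeal.mem_span_iff_mem_addSubgroup_closure] at hu'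
    induction hu' using AddSubgroup.closure_induction with
    | zero => rw [map_zero, mul_zero]; exact I.zero_mem
    | add x y _ _ hx hy => rw [map_add, mul_add]; exact I.add_mem hx hy
    | neg x _ hx => rw [map_neg, mul_neg]; exact I.neg_mem hx
    | mem y hy =>
      obtain ⟨_, ⟨a, -, ε', hε, rfl⟩, b, -, rfl⟩ := hy
      obtain rfl : e' = e := he
      obtain rfl : ε' = ε := hε
      have : φ (c * e' * d) * ψ (a * ε' * b) = φ c * ψ a * (φ e' * ψ ε') * (φ d * ψ b) := by
        simp only [map_mul]
        calc φ c * φ e' * φ d * (ψ a * ψ ε' * ψ b)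
            = φ c * φ e' * (φ d * (ψ a * ψ ε')) * ψ b := by simp only [mul_assoc]
          _ = φ c * (φ e' * ψ a) * ψ ε' * (φ d * ψ b) := by
            rw [← map_mul ψ a, hcomm d, map_mul]
            simp only [mul_assoc]
          _ = _ := by rw [hcomm e' a]; simp only [mul_assoc]
      refine this ▸ I.mul_mem_right _ _ (I.mul_mem_left _ _ (TwoSidedIdeal.subset_span rfl))

variable {R ρ}

/-- Since ε has rank one on W, tensoring with W leaves the multiplicity space unchanged; the action
of H enters the compression only through the matrix coefficient at v. -/
theorem IsModuleCorner.outerTensor {S Y : Type*} [Group S] [AddCommGroup Y] [Module F Y]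
    {τ : Representation F S Y} {e : F[Γ]} {T : Γ → F[S]} {ι : Y →ₗ[F] X}
    (h : IsModuleCorner (K := Unit) (fun _ => e) (fun _ => groupAlgebraLift T) (X := R.asModule)
      (Y := fun _ => τ.asModule) (fun _ => ι.toAddMonoidHom))
    (hT : ∀ σ, ∃ g, T g = MonoidAlgebra.single σ 1) {ε u : F[H]} {v : W} {f : Module.Dual F W}
    (hf : f v = 1) (hε : ∀ x, ρ.asAlgebraHom ε x = f x • v) (hu : u ∈ TwoSidedIdeal.span {ε})
    (hu1 : ρ.asAlgebraHom u = 1) :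
    IsModuleCorner (K := Unit)
      (fun _ => MonoidAlgebra.mapDomainAlgHom F F (MonoidHom.inl Γ H) e *
        MonoidAlgebra.mapDomainAlgHom F F (MonoidHom.inr Γ H) ε)
      (fun _ => groupAlgebraLift fun x : Γ × H => f (ρ x.2 v) • T x.1)
      (X := (outerTensor R ρ).asModule) (Y := fun _ => τ.asModule)
      (fun _ => ((TensorProduct.mk F X W).flip v ∘ₗ ι).toAddMonoidHom) := by
  have hact : ∀ (a : F[Γ]) (b : F[H]) x w, (_root_.outerTensor R ρ).asAlgebraHom
      (MonoidAlgebra.mapDomainAlgHom F F (MonoidHom.inl Γ H) a *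
        MonoidAlgebra.mapDomainAlgHom F F (MonoidHom.inr Γ H) b) (x ⊗ₜ w) =
      R.asAlgebraHom a x ⊗ₜ ρ.asAlgebraHom b w := fun a b x w => by
    rw [map_mul, asAlgebraHom_outerTensor_inl, asAlgebraHom_outerTensor_inr]
    rfl
  refine IsModuleCorner.of_rep (K := Unit) (_root_.outerTensor R ρ) (fun _ => τ)
    (fun _ => MonoidAlgebra.mapDomainAlgHom F F (MonoidHom.inl Γ H) e *
        MonoidAlgebra.mapDomainAlgHom F F (MonoidHom.inr Γ H) ε)
    (fun _ x => f (ρ x.2 v) • T x.1) (fun _ => (TensorProduct.mk F X W).flip v ∘ₗ ι)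
    (fun _ => ?_) (fun _ σ => ?_) (fun _ z => ?_) (fun _ g y => ?_) (fun k l hkl => ?_)
    (fun z => ?_)
  · have hinj : Function.Injective ι := h.injective ()
    refine Function.Injective.of_comp (f := (TensorProduct.rid F X).toLinearMap ∘ₗ
      TensorProduct.map LinearMap.id f) ?_
    convert hinj using 1
    funext y
    simp [hf]
  · obtain ⟨g, hg⟩ := hT σ
    exact ⟨(g, 1), by simp [hg, hf]⟩
  · induction z using TensorProduct.induction_on with
    | zero => exact ⟨0, by simp⟩
    | add x y hx hy =>
      obtain ⟨a, ha⟩ := hx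
      obtain ⟨b, hb⟩ := hy
      exact ⟨a + b, by rw [map_add, map_add, ha, hb]⟩
    | tmul x w =>
      obtain ⟨y, hy⟩ : ∃ y, R.asAlgebraHom e x = ι y := h.exists_smul_eq () x
      refine ⟨f w • y, ?_⟩
      rw [hact, hy, hε]
      simp [TensorProduct.smul_tmul']
  · have h1 : R.asAlgebraHom e (R.asAlgebraHom (MonoidAlgebra.single g.1 1) (ι y)) =
        ι (τ.asAlgebraHom (groupAlgebraLift T (MonoidAlgebra.single g.1 1)) y) :=
      h.smul_smul () (MonoidAlgebra.single g.1 1) y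
    rw [Representation.asAlgebraHom_single_one, groupAlgebraLift_single, one_smul] at h1
    change _ = (ι _) ⊗ₜ[F] v
    rw [show _root_.outerTensor R ρ g (((TensorProduct.mk F X W).flip v ∘ₗ ι) y) =
      R g.1 (ι y) ⊗ₜ ρ g.2 v from rfl, hact, h1, hε]
    simp [TensorProduct.smul_tmul']
  · exact absurd rfl hkl
  · obtain ⟨S, rfl⟩ := TensorProduct.exists_finset z
    classical
    -- A tensor has finitely many left components, which a single element of the ideal can fix
    -- simultaneously.
    obtain ⟨a, ha, haS⟩ := exists_forall_smul_eq (A := F[Γ]) (X := R.asModule) h.unital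
      (S.image Prod.fst)
    rw [Set.range_const] at ha ⊢
    refine ⟨_, map_inl_mul_map_inr_mem_span ha hu, ?_⟩
    rw [map_sum]
    refine Finset.sum_congr rfl fun s hs => ?_
    rw [hact, hu1, Module.End.one_apply]
    congr 1
    exact haS s.1 (Finset.mem_image_of_mem _ hs)

end OuterTensor

/-! ### The submodule theorem -/

namespace Tableau

variable {μ : YoungDiagram}

theorem mk_row_col_mem (t : Tableau μ) (x : Fin μ.card) : (t.row x, t.col x) ∈ μ :=
  (YoungDiagram.mem_cells _).1 (Equiv.toFun t x).2

theorem exists_row_col_eq (t : Tableau μ) {i j : ℕ} (h : (i, j) ∈ μ) :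
    ∃ x, t.row x = i ∧ t.col x = j := by
  obtain ⟨x, hx⟩ := Equiv.surjective t ⟨(i, j), (YoungDiagram.mem_cells _).2 h⟩
  have hx' : (Equiv.toFun t x).1 = (i, j) := congrArg Subtype.val hx
  exact ⟨x, congrArg Prod.fst hx', congrArg Prod.snd hx'⟩

theorem exists_smul_eq (t s : Tableau μ) : ∃ σ : Equiv.Perm (Fin μ.card), σ • t = s :=
  ⟨Equiv.trans t (Equiv.symm s), Equiv.ext fun x => by
    change Equiv.toFun t (Equiv.invFun t (Equiv.toFun s x)) = Equiv.toFun s x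
    exact Equiv.apply_symm_apply t _⟩

theorem card_col_lt_eq (t s : Tableau μ) (j : ℕ) :
    Finset.card {x | t.col x < j} = Finset.card {x | s.col x < j} := by
  refine Finset.card_equiv (Equiv.trans t (Equiv.symm s)) fun x => ?_
  have : s.col (Equiv.trans t (Equiv.symm s) x) = t.col x :=
    congrArg (fun c : μ.cells => c.1.2) (Equiv.apply_symm_apply s (Equiv.toFun t x))
  simp [this]

/-- If no two entries lie in the same row of `s` and in the same column of `t`, then the rows of `s`
and the columns of `t` of the entries determine cells of the diagram. -/
theorem mk_row_col_mem_of_injective {t s : Tableau μ}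
    (h : ∀ x y, s.row x = s.row y → t.col x = t.col y → x = y) (x : Fin μ.card) :
    (s.row x, t.col x) ∈ μ := by
  classical
  -- The right side is the minimum of j and the length of row i. The left side is at most j because
  -- columns of t are distinct along a row of s, and at most the row length trivially.
  have hle : ∀ i j, Finset.card {x | t.col x < j ∧ s.row x = i} ≤
      Finset.card {x | s.col x < j ∧ s.row x = i} := by
    intro i j
    rcases le_total j (μ.rowLen i) with hj | hj
    · refine le_trans (b := (Finset.range j).card) ?_ ?_
      · refine Finset.card_le_card_of_injOn t.col (fun x hx => ?_) fun x hx y hy hxy => ?_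
        · simpa using (Finset.mem_filter.1 hx).2.1
        · exact h x y ((Finset.mem_filter.1 hx).2.2.trans (Finset.mem_filter.1 hy).2.2.symm) hxy
      · refine Finset.card_le_card_of_surjOn s.col fun c hc => ?_
        have hc' : c < j := by simpa using hc
        obtain ⟨x, hx, hx'⟩ := s.exists_row_col_eq
          (YoungDiagram.mem_iff_lt_rowLen.2 (hc'.trans_le hj))
        exact ⟨x, by simp [hx, hx', hc'], hx'⟩
    · refine Finset.card_le_card fun x hx => ?_
      obtain ⟨-, -, hx⟩ := Finset.mem_filter.1 hx
      have := YoungDiagram.mem_iff_lt_rowLen.1 (s.mk_row_col_mem x)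
      rw [hx] at this
      simp [hx, this.trans_le hj]
  have hsum : ∀ (u : Tableau μ) j, Finset.card {x | u.col x < j} =
      ∑ i ∈ Finset.univ.image s.row, Finset.card {x | u.col x < j ∧ s.row x = i} := by
    intro u j
    rw [Finset.card_eq_sum_card_fiberwise (f := s.row) (t := Finset.univ.image s.row)
      fun x _ => Finset.mem_image_of_mem _ (Finset.mem_univ x)]
    simp only [Finset.filter_filter]
  -- Summed over the rows, both counts give the number of cells in columns below j, so equality
  -- holds in each row. Taking j to be the length of the row of x shows that all entries of this row
  -- lie in columns of t below its length.
  have heq := (Finset.sum_eq_sum_iff_of_le fun i _ => hle i (μ.rowLen (s.row x))).1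
    (((hsum t _).symm.trans (card_col_lt_eq t s _)).trans (hsum s _)) (s.row x)
    (Finset.mem_image_of_mem _ (Finset.mem_univ x))
  have hrow : Finset.filter (fun y => s.col y < μ.rowLen (s.row x) ∧ s.row y = s.row x)
      Finset.univ = Finset.filter (fun y => s.row y = s.row x) Finset.univ := by
    refine Finset.filter_congr fun y _ => ⟨fun hy => hy.2, fun hy => ⟨?_, hy⟩⟩
    rw [← hy]
    exact YoungDiagram.mem_iff_lt_rowLen.1 (s.mk_row_col_mem y)
  rw [hrow] at heq
  have := Finset.eq_of_subset_of_card_le (fun y hy => by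
    simp only [Finset.mem_filter, Finset.mem_univ, true_and] at hy ⊢
    exact hy.2) heq.ge
  have hx : x ∈ Finset.filter (fun y => s.row y = s.row x) Finset.univ := by simp
  rw [← this] at hx
  exact YoungDiagram.mem_iff_lt_rowLen.2 (Finset.mem_filter.1 hx).2.1

/-- Each x is matched with the entry of t in row `s.row x` and column `t.col x`; the cell exists by
the preceding lemma. The inverse of this matching is the required permutation. -/
theorem exists_col_perm {t s : Tableau μ}
    (h : ∀ x y, s.row x = s.row y → t.col x = t.col y → x = y) :
    ∃ σ : Equiv.Perm (Fin μ.card), (∀ x, t.col (σ x) = t.col x) ∧ Tabloid.mk (σ • t) =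
      Tabloid.mk s := by
  choose φ hr hc using fun x => t.exists_row_col_eq (mk_row_col_mem_of_injective h x)
  have hφ : Function.Injective φ := fun x y hxy =>
    h x y (by rw [← hr x, ← hr y, hxy]) (by rw [← hc x, ← hc y, hxy])
  let e := Equiv.ofBijective φ (Finite.injective_iff_bijective.1 hφ)
  refine ⟨e⁻¹, fun x => ?_, Quotient.sound fun x => ?_⟩
  · obtain ⟨y, rfl⟩ := e.surjective x
    rw [Equiv.Perm.inv_def, Equiv.symm_apply_apply]
    exact (hc y).symm
  · rw [row_smul, inv_inv]
    exact hr x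

end Tableau

section Submodule

variable {F : Type u} [Field F] {μ : YoungDiagram}

variable (F) in
/-- The signed column sum of a tableau. -/
def columnAntisymmetrizer (t : Tableau μ) : F[Tabloid μ] →ₗ[F] F[Tabloid μ] :=
  ∑ σ : Equiv.Perm (Fin μ.card) with ∀ x, t.col (σ x) = t.col x,
    ((Equiv.Perm.sign σ : ℤ) : F) • permModule F μ σ

theorem columnAntisymmetrizer_single (t : Tableau μ) (T : Tabloid μ) :
    columnAntisymmetrizer F t (MonoidAlgebra.single T 1) =
      ∑ σ : Equiv.Perm (Fin μ.card) with ∀ x, t.col (σ x) = t.col x,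
        MonoidAlgebra.single (σ • T) ((Equiv.Perm.sign σ : ℤ) : F) := by
  simp [columnAntisymmetrizer, LinearMap.sum_apply, Representation.ofMulAction_single]

theorem columnAntisymmetrizer_mk_self (t : Tableau μ) :
    columnAntisymmetrizer F t (MonoidAlgebra.single (Tabloid.mk t) 1) = polytabloid F t :=
  columnAntisymmetrizer_single t _

/-- James's argument for a tabloid {s}. If two entries share a row of s and a column of t, their
transposition pairs off the terms of the sum with opposite signs. Otherwise {s} is a column
permutation of {t}, and the sum is ± the polytabloid. -/
theorem exists_columnAntisymmetrizer_eq (t : Tableau μ) (u : F[Tabloid μ]) :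
    ∃ c : F, columnAntisymmetrizer F t u = c • polytabloid F t := by
  classical
  induction u using MonoidAlgebra.induction_linear with
  | zero => exact ⟨0, by simp⟩
  | add x y hx hy =>
    obtain ⟨a, ha⟩ := hx
    obtain ⟨b, hb⟩ := hy
    exact ⟨a + b, by rw [map_add, ha, hb, add_smul]⟩
  | single T c =>
    suffices ∃ b : F, columnAntisymmetrizer F t (MonoidAlgebra.single T 1) = b • polytabloid F t by
      obtain ⟨b, hb⟩ := this
      refine ⟨c * b, ?_⟩
      rw [← mul_one c, ← MonoidAlgebra.smul_single', map_smul, hb, mul_one, smul_smul]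
    induction T using Quotient.inductionOn with | _ s
    change ∃ b : F, columnAntisymmetrizer F t (MonoidAlgebra.single (Tabloid.mk s) 1) = _
    by_cases h : ∀ x y, s.row x = s.row y → t.col x = t.col y → x = y
    · obtain ⟨σ, hσ, hs⟩ := Tableau.exists_col_perm h
      refine ⟨((Equiv.Perm.sign σ : ℤ) : F), ?_⟩
      rw [← hs, columnAntisymmetrizer_single, polytabloid, Finset.smul_sum]
      refine Finset.sum_equiv (Equiv.mulRight σ) (fun π => ?_) fun π _ => ?_
      · simp only [Finset.mem_filter, Finset.mem_univ, true_and, Equiv.coe_mulRight,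
          Equiv.Perm.mul_apply]
        refine ⟨fun hπ x => by rw [hπ, hσ], fun hπ x => ?_⟩
        have := hπ (σ⁻¹ x)
        rw [Equiv.Perm.inv_def, Equiv.apply_symm_apply] at this
        rw [this, ← hσ, Equiv.apply_symm_apply]
      · rw [Tabloid.smul_mk, ← mul_smul, Equiv.coe_mulRight, MonoidAlgebra.smul_single']
        congr 1
        have : ((Equiv.Perm.sign σ : ℤ) : F) * ((Equiv.Perm.sign σ : ℤ) : F) = 1 := by
          rcases Int.units_eq_one_or (Equiv.Perm.sign σ) with h | h <;> simp [h]
        rw [Equiv.Perm.sign_mul, mul_comm]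
        push_cast
        rw [mul_assoc, this, mul_one]
    · push Not at h
      obtain ⟨x, y, hr, hc, hxy⟩ := h
      refine ⟨0, ?_⟩
      rw [zero_smul, columnAntisymmetrizer_single]
      have hcol : ∀ z, t.col (Equiv.swap x y z) = t.col z := fun z => by
        rw [Equiv.swap_apply_def]
        split_ifs with h1 h2
        · rw [h1, hc]
        · rw [h2, hc]
        · rfl
      have hmk : Equiv.swap x y • Tabloid.mk s = Tabloid.mk s := by
        rw [Tabloid.smul_mk]
        refine Quotient.sound fun z => ?_
        rw [Tableau.row_smul, Equiv.swap_inv, Equiv.swap_apply_def]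
        split_ifs with h1 h2
        · rw [h1, hr]
        · rw [h2, hr]
        · rfl
      refine Finset.sum_involution (fun π _ => π * Equiv.swap x y) (fun π _ => ?_)
        (fun π _ _ h => hxy ?_) (fun π hπ => ?_) (fun π _ => by simp [mul_assoc])
      · rw [mul_smul, hmk, ← MonoidAlgebra.single_add, Equiv.Perm.sign_mul,
          Equiv.Perm.sign_swap hxy]
        simp
      · have := congrArg (fun τ : Equiv.Perm (Fin μ.card) => τ y) (mul_eq_left.1 h)
        simpa using this
      · simp only [Finset.mem_filter, Finset.mem_univ, true_and, Equiv.Perm.mul_apply] at hπ ⊢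
        exact fun z => by rw [hπ, hcol]

theorem tabloidForm_add_right (a b c : F[Tabloid μ]) :
    tabloidForm a (b + c) = tabloidForm a b + tabloidForm a c := by
  simp [tabloidForm, mul_add, Finsupp.sum_add]

theorem tabloidForm_smul_right (a b : F[Tabloid μ]) (c : F) :
    tabloidForm a (c • b) = c * tabloidForm a b := by
  simp [tabloidForm, Finsupp.mul_sum, mul_left_comm]

theorem tabloidForm_add_left (a b c : F[Tabloid μ]) :
    tabloidForm (a + b) c = tabloidForm a c + tabloidForm b c := by
  classical
  rw [tabloidForm, MonoidAlgebra.coeff_add, Finsupp.sum_add_index' (by simp) (by intros; ring)]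
  rfl

theorem tabloidForm_smul_left (a b : F[Tabloid μ]) (c : F) :
    tabloidForm (c • a) b = c * tabloidForm a b := by
  rw [tabloidForm, MonoidAlgebra.coeff_smul, Finsupp.sum_smul_index (by simp)]
  simp [tabloidForm, Finsupp.mul_sum, mul_assoc]

variable (F μ) in
/-- The standard form as a bilinear map. -/
def tabloidBilin : F[Tabloid μ] →ₗ[F] F[Tabloid μ] →ₗ[F] F :=
  LinearMap.mk₂ F tabloidForm tabloidForm_add_left (fun c a b => tabloidForm_smul_left a b c)
    tabloidForm_add_right fun c a b => tabloidForm_smul_right a b c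

/-- The form is invariant, and σ ↦ σ⁻¹ preserves both the sign and the column stabilizer. -/
theorem tabloidForm_columnAntisymmetrizer (t : Tableau μ) (a b : F[Tabloid μ]) :
    tabloidForm (columnAntisymmetrizer F t a) b = tabloidForm a (columnAntisymmetrizer F t b) := by
  change tabloidBilin F μ _ b = tabloidBilin F μ a _
  simp only [columnAntisymmetrizer, LinearMap.sum_apply, map_sum, LinearMap.smul_apply, map_smul]
  refine Finset.sum_equiv (Equiv.inv _) (fun σ => ?_) fun σ _ => ?_
  · simp only [Finset.mem_filter, Finset.mem_univ, true_and, Equiv.inv_apply]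
    refine ⟨fun h x => ?_, fun h x => ?_⟩
    · rw [← h, Equiv.Perm.inv_def, Equiv.apply_symm_apply]
    · rw [← h, Equiv.Perm.inv_def, Equiv.symm_apply_apply]
  · rw [Equiv.inv_apply, Equiv.Perm.sign_inv]
    congr 1
    change tabloidForm _ b = tabloidForm a _
    rw [tabloidForm_perm, inv_inv]

/-- The submodule theorem for submodules of the Specht module. -/
theorem eq_top_or_le_spechtRadical (U : Submodule F (specht F μ).toSubmodule)
    (hU : ∀ σ, ∀ x ∈ U, (specht F μ).toRepresentation σ x ∈ U) :
    U = ⊤ ∨ U ≤ spechtRadical F μ := by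
  -- If all column sums kill U, then U is orthogonal to every polytabloid by self-adjointness.
  -- Otherwise some column sum of an element of U is a nonzero multiple of a polytabloid, whose
  -- translates span the Specht module.
  by_cases h : ∀ x ∈ U, ∀ t, columnAntisymmetrizer F t (x : F[Tabloid μ]) = 0
  · refine Or.inr fun x hx y hy => ?_
    change y ∈ Submodule.span F (Set.range (polytabloid F (μ := μ))) at hy
    induction hy using Submodule.span_induction with
    | mem y hy =>
      obtain ⟨t, rfl⟩ := hy
      rw [← columnAntisymmetrizer_mk_self, tabloidForm_columnAntisymmetrizer, h x hx t]
      exact map_zero (tabloidBilin F μ _)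
    | zero => exact LinearMap.map_zero₂ (tabloidBilin F μ) (x : F[Tabloid μ])
    | add a b _ _ ha hb => rw [tabloidForm_add_left, ha, hb, add_zero]
    | smul c a _ ha => rw [tabloidForm_smul_left, ha, mul_zero]
  · push Not at h
    obtain ⟨x, hx, t, ht⟩ := h
    obtain ⟨c, hc⟩ := exists_columnAntisymmetrizer_eq t (x : F[Tabloid μ])
    have hc0 : c ≠ 0 := by
      rintro rfl
      exact ht (by rw [hc, zero_smul])
    let U' : Submodule F F[Tabloid μ] := U.map (specht F μ).toSubmodule.subtype
    have hU' : ∀ σ, ∀ y ∈ U', permModule F μ σ y ∈ U' := by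
      rintro σ _ ⟨y, hy, rfl⟩
      exact ⟨_, hU σ y hy, rfl⟩
    have h1 : columnAntisymmetrizer F t (x : F[Tabloid μ]) ∈ U' := by
      simp only [columnAntisymmetrizer, LinearMap.sum_apply, LinearMap.smul_apply]
      exact sum_mem fun σ _ => U'.smul_mem _ (hU' σ _ ⟨x, hx, rfl⟩)
    have h2 : polytabloid F t ∈ U' := by
      rw [hc] at h1
      exact (U'.smul_mem_iff hc0).1 h1
    have h3 : (specht F μ).toSubmodule ≤ U' := by
      refine Submodule.span_le.2 ?_
      rintro _ ⟨s, rfl⟩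
      obtain ⟨σ, rfl⟩ := t.exists_smul_eq s
      rw [← permModule_polytabloid]
      exact hU' σ _ h2
    refine Or.inl (eq_top_iff.2 fun y _ => ?_)
    obtain ⟨z, hz, hzy⟩ := h3 y.2
    obtain rfl : z = y := Subtype.ext hzy
    exact hz

variable (F μ) in
/-- The module `D^μ` is irreducible or zero. -/
theorem dModule_isIrreducible_or_subsingleton :
    (dModule F μ).rep.IsIrreducible ∨ Subsingleton (dModule F μ).carrier := by
  rcases subsingleton_or_nontrivial (dModule F μ).carrier with h | h
  · exact Or.inr h
  refine Or.inl ?_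
  have hnt : Nontrivial (Subrepresentation (dModule F μ).rep) := by
    refine ⟨⊥, ⊤, fun h0 => ?_⟩
    obtain ⟨x, hx⟩ := exists_ne (0 : (dModule F μ).carrier)
    have : x ∈ (⊤ : Subrepresentation (dModule F μ).rep) := trivial
    rw [← h0] at this
    exact hx this
  refine { eq_bot_or_eq_top := fun N => ?_ }
  let q : (specht F μ).toSubmodule →ₗ[F] (dModule F μ).carrier := (spechtRadical F μ).mkQ
  have hq : Function.Surjective q := (spechtRadical F μ).mkQ_surjective
  rcases eq_top_or_le_spechtRadical (N.toSubmodule.comap q)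
    (fun σ x hx => N.apply_mem_toSubmodule σ hx) with h1 | h1
  · refine Or.inr (SetLike.ext fun x => ⟨fun _ => trivial, fun _ => ?_⟩)
    obtain ⟨y, rfl⟩ := hq x
    have : y ∈ N.toSubmodule.comap q := h1 ▸ Submodule.mem_top
    exact this
  · refine Or.inl (SetLike.ext fun x => ⟨fun hx => ?_, ?_⟩)
    · obtain ⟨y, rfl⟩ := hq x
      have : y ∈ spechtRadical F μ := h1 hx
      exact (Submodule.Quotient.mk_eq_zero _).2 this
    · intro hx
      obtain rfl : x = 0 := hx
      exact zero_mem N.toSubmodule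

end Submodule

/-! ### Branching -/

section BranchPerm

/-- The image of the symmetric group on α consists of the permutations of β that preserve the range
of κ and fix its complement. -/
theorem exists_viaEmbeddingHom_eq {α β : Type*} [Finite α] (κ : α ↪ β) (w : Equiv.Perm β)
    (hw : ∀ x, w (κ x) ∈ Set.range κ) (hw' : ∀ y ∉ Set.range κ, w y = y) :
    ∃ σ, Equiv.Perm.viaEmbeddingHom κ σ = w := by
  choose σ hσ using hw
  have hinj : Function.Injective σ := fun x y hxy => by
    apply κ.injective
    apply w.injective
    rw [← hσ, ← hσ, hxy]
  refine ⟨Equiv.ofBijective σ (Finite.injective_iff_bijective.1 hinj), Equiv.ext fun y => ?_⟩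
  rw [Equiv.Perm.viaEmbeddingHom_apply]
  by_cases hy : y ∈ Set.range κ
  · obtain ⟨x, rfl⟩ := hy
    rw [Equiv.Perm.viaEmbedding_apply]
    exact hσ x
  · rw [Equiv.Perm.viaEmbedding_apply_of_notMem _ _ _ hy, hw' y hy]

theorem viaEmbeddingHom_apply_of_notMem {α β : Type*} (κ : α ↪ β) (σ : Equiv.Perm α) {y : β}
    (hy : y ∉ Set.range κ) : Equiv.Perm.viaEmbeddingHom κ σ y = y :=
  Equiv.Perm.viaEmbedding_apply_of_notMem σ κ y hy

theorem viaEmbeddingHom_apply_image {α β : Type*} (κ : α ↪ β) (σ : Equiv.Perm α) (x : α) :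
    Equiv.Perm.viaEmbeddingHom κ σ (κ x) = κ (σ x) :=
  Equiv.Perm.viaEmbedding_apply σ κ x

theorem viaEmbeddingHom_castSucc_last {n : ℕ} (σ : Equiv.Perm (Fin n)) :
    Equiv.Perm.viaEmbeddingHom Fin.castSuccEmb σ (Fin.last n) = Fin.last n :=
  viaEmbeddingHom_apply_of_notMem _ _ (by
    rintro ⟨j, hj⟩
    exact (Fin.castSucc_lt_last j).ne hj)

theorem exists_viaEmbeddingHom_castSucc_eq {n : ℕ} {w : Equiv.Perm (Fin (n + 1))}
    (hw : w (Fin.last n) = Fin.last n) :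
    ∃ σ, Equiv.Perm.viaEmbeddingHom Fin.castSuccEmb σ = w := by
  refine exists_viaEmbeddingHom_eq _ w (fun x => ?_) fun y hy => ?_
  · obtain ⟨y, hy⟩ := Fin.exists_castSucc_eq.2 (fun h : w x.castSucc = Fin.last n =>
      (Fin.castSucc_lt_last x).ne (w.injective (h.trans hw.symm)))
    exact ⟨y, hy⟩
  · obtain rfl : y = Fin.last n := by
      by_contra h
      exact hy (Fin.exists_castSucc_eq.2 h)
    exact hw

variable {r n : ℕ} {d d' : Fin r → ℕ} (h : ∑ i, d i = n + 1) (h' : ∑ i, d' i = n)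

/-- The removal of the letter `z` of the `k`-th block matches with the removal of the last letter
up to a permutation `s` of the letters. -/
structure IsBranching (κ : ∀ i, Fin (d' i) ↪ Fin (d i)) (k : Fin r) (z : Fin (d k))
    (s : Equiv.Perm (Fin (n + 1))) : Prop where
  surjective : ∀ i, i ≠ k → Function.Surjective (κ i)
  mem_range_iff : ∀ x, x ∈ Set.range (κ k) ↔ x ≠ z
  apply_of_mem : ∀ q : Σ i, Fin (d' i),
    s (youngEquiv d h ⟨q.1, κ q.1 q.2⟩) = (youngEquiv d' h' q).castSucc
  apply_removed : s (youngEquiv d h ⟨k, z⟩) = Fin.last n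

theorem exists_isBranching (κ : ∀ i, Fin (d' i) ↪ Fin (d i)) (k : Fin r) (z : Fin (d k))
    (hκ : ∀ i, i ≠ k → Function.Surjective (κ i)) (hz : ∀ x, x ∈ Set.range (κ k) ↔ x ≠ z) :
    ∃ s, IsBranching h h' κ k z s := by
  -- The inverse of the permutation s: the last letter goes to the removed letter, and the others go
  -- to their places in the larger blocks.
  let t : Fin (n + 1) → Fin (n + 1) := Fin.lastCases (youngEquiv d h ⟨k, z⟩) fun j =>
    youngEquiv d h ⟨((youngEquiv d' h').symm j).1, κ _ ((youngEquiv d' h').symm j).2⟩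
  have ht : ∀ q, t (youngEquiv d' h' q).castSucc = youngEquiv d h ⟨q.1, κ q.1 q.2⟩ := fun q => by
    simp only [t, Fin.lastCases_castSucc]
    rw [Equiv.symm_apply_apply]
  have ht' : t (Fin.last n) = youngEquiv d h ⟨k, z⟩ := Fin.lastCases_last
  have hne : ∀ q : Σ i, Fin (d' i), (⟨q.1, κ q.1 q.2⟩ : Σ i, Fin (d i)) ≠ ⟨k, z⟩ := by
    rintro ⟨i, x⟩ hq
    obtain rfl : i = k := congrArg Sigma.fst hq
    exact (hz _).1 ⟨x, rfl⟩ (by simpa using hq)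
  have hinj : Function.Injective t := by
    intro a b hab
    induction a using Fin.lastCases with
    | last =>
      induction b using Fin.lastCases with
      | last => rfl
      | cast b =>
        obtain ⟨q, rfl⟩ := (youngEquiv d' h').surjective b
        rw [ht, ht'] at hab
        exact absurd ((youngEquiv d h).injective hab).symm (hne q)
    | cast a =>
      obtain ⟨q, rfl⟩ := (youngEquiv d' h').surjective a
      induction b using Fin.lastCases with
      | last =>
        rw [ht, ht'] at hab
        exact absurd ((youngEquiv d h).injective hab) (hne q)
      | cast b =>
        obtain ⟨q', rfl⟩ := (youngEquiv d' h').surjective b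
        rw [ht, ht] at hab
        have := (youngEquiv d h).injective hab
        obtain ⟨i, x⟩ := q
        obtain ⟨i', x'⟩ := q'
        obtain rfl : i = i' := congrArg Sigma.fst this
        obtain rfl : x = x' := (κ i).injective (by simpa using this)
        rfl
  let e := Equiv.ofBijective t (Finite.injective_iff_bijective.1 hinj)
  refine ⟨e.symm, hκ, hz, fun q => ?_, ?_⟩
  · rw [Equiv.symm_apply_eq]
    exact (ht q).symm
  · rw [Equiv.symm_apply_eq]
    exact ht'.symm

/-- The embedding of `∏ S_{d' i}` in `∏ S_{d i}`. -/
def branchHom (κ : ∀ i, Fin (d' i) ↪ Fin (d i)) :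
    (∀ i, Equiv.Perm (Fin (d' i))) →* ∀ i, Equiv.Perm (Fin (d i)) where
  toFun σ i := Equiv.Perm.viaEmbeddingHom (κ i) (σ i)
  map_one' := funext fun _ => map_one _
  map_mul' _ _ := funext fun _ => map_mul _ _ _

variable {h h'}

namespace IsBranching

variable {κ : ∀ i, Fin (d' i) ↪ Fin (d i)} {k : Fin r} {z : Fin (d k)}
  {s : Equiv.Perm (Fin (n + 1))}

theorem branchHom_apply_removed (hs : IsBranching h h' κ k z s)
    (σ : ∀ i, Equiv.Perm (Fin (d' i))) : branchHom κ σ k z = z :=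
  viaEmbeddingHom_apply_of_notMem _ _ fun hz => (hs.mem_range_iff z).1 hz rfl

/-- Conjugation by s carries the smaller Young subgroup inside ∏ S_{d i} to the one inside the
stabilizer of the last letter. -/
theorem mul_youngPerm (hs : IsBranching h h' κ k z s) (σ : ∀ i, Equiv.Perm (Fin (d' i))) :
    s * youngPerm d h (branchHom κ σ) =
      Equiv.Perm.viaEmbeddingHom Fin.castSuccEmb (youngPerm d' h' σ) * s := by
  refine Equiv.ext fun j => ?_
  obtain ⟨j, rfl⟩ := s.symm.surjective j
  rw [Equiv.Perm.mul_apply, Equiv.Perm.mul_apply, Equiv.apply_symm_apply]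
  induction j using Fin.lastCases with
  | last =>
    rw [← hs.apply_removed, Equiv.symm_apply_apply, youngPerm_youngEquiv,
      hs.branchHom_apply_removed, hs.apply_removed, viaEmbeddingHom_castSucc_last]
  | cast j =>
    obtain ⟨q, rfl⟩ := (youngEquiv d' h').surjective j
    have h1 := viaEmbeddingHom_apply_image Fin.castSuccEmb (youngPerm d' h' σ)
      (youngEquiv d' h' q)
    rw [Fin.coe_castSuccEmb, youngPerm_youngEquiv] at h1
    rw [h1, ← hs.apply_of_mem, ← hs.apply_of_mem, Equiv.symm_apply_apply, youngPerm_youngEquiv]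
    congr 3
    exact viaEmbeddingHom_apply_image (κ q.1) (σ q.1) q.2

theorem mul_eq_mul_iff (hs : IsBranching h h' κ k z s) (τ : Equiv.Perm (Fin n))
    (σ : ∀ i, Equiv.Perm (Fin (d' i))) :
    Equiv.Perm.viaEmbeddingHom Fin.castSuccEmb τ * s = s * youngPerm d h (branchHom κ σ) ↔
      τ = youngPerm d' h' σ := by
  rw [hs.mul_youngPerm, mul_left_inj, (Equiv.Perm.viaEmbeddingHom_injective _).eq_iff]

theorem colour_castSucc (hs : IsBranching h h' κ k z s) (j : Fin n) :
    youngColour d h (s.symm j.castSucc) = youngColour d' h' j := by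
  obtain ⟨q, rfl⟩ := (youngEquiv d' h').surjective j
  rw [← hs.apply_of_mem, Equiv.symm_apply_apply, youngColour_youngEquiv, youngColour_youngEquiv]

theorem colour_last (hs : IsBranching h h' κ k z s) :
    youngColour d h (s.symm (Fin.last n)) = k := by
  rw [← hs.apply_removed, Equiv.symm_apply_apply, youngColour_youngEquiv]

theorem mem_range_branchHom (hs : IsBranching h h' κ k z s) {w : ∀ i, Equiv.Perm (Fin (d i))}
    (hw : w k z = z) : w ∈ (branchHom κ).range := by
  have : ∀ i, ∃ σ, Equiv.Perm.viaEmbeddingHom (κ i) σ = w i := fun i => by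
    by_cases hi : i = k
    · subst hi
      refine exists_viaEmbeddingHom_eq _ _ (fun x => ?_) fun y hy => ?_
      · rw [hs.mem_range_iff]
        intro hx
        exact (hs.mem_range_iff _).1 ⟨x, rfl⟩ ((w i).injective (hx.trans hw.symm))
      · rw [hs.mem_range_iff, not_not] at hy
        rw [hy, hw]
    · exact exists_viaEmbeddingHom_eq _ _ (fun x => hs.surjective i hi _)
        fun y hy => absurd (hs.surjective i hi y) hy
  choose σ hσ using this
  exact ⟨σ, funext hσ⟩

/-- Both sides are evaluated at the letter removed for s'. The left side yields the last letter, so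
w sends the removed letter of block l to that of block k. As w preserves blocks and both letters are
the last of their blocks, k = l and w fixes z. -/
theorem eq_and_mem_range (hs : IsBranching h h' κ k z s) {d'' : Fin r → ℕ}
    {h'' : ∑ i, d'' i = n} {κ' : ∀ i, Fin (d'' i) ↪ Fin (d i)} {l : Fin r} {y : Fin (d l)}
    {s' : Equiv.Perm (Fin (n + 1))} (hs' : IsBranching h h'' κ' l y s') {τ : Equiv.Perm (Fin n)}
    {w : ∀ i, Equiv.Perm (Fin (d i))}
    (hz : (z : ℕ) + 1 = d k) (hy : (y : ℕ) + 1 = d l)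
    (hw : Equiv.Perm.viaEmbeddingHom Fin.castSuccEmb τ * s' = s * youngPerm d h w) :
    k = l ∧ w ∈ (branchHom κ).range := by
  have h1 := congrArg (fun σ : Equiv.Perm (Fin (n + 1)) => σ (youngEquiv d h ⟨l, y⟩)) hw
  simp only [Equiv.Perm.mul_apply] at h1
  rw [hs'.apply_removed, viaEmbeddingHom_castSucc_last, youngPerm_youngEquiv,
    ← hs.apply_removed] at h1
  have h2 := (youngEquiv d h).injective (s.injective h1)
  obtain rfl : k = l := congrArg Sigma.fst h2
  have h3 : z = w k y := by simpa using h2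
  obtain rfl : z = y := Fin.ext (by omega)
  exact ⟨rfl, hs.mem_range_branchHom h3.symm⟩

/-- The double coset of w is determined by the block whose letter is sent to the last one: a
transposition within this block moves that letter to z, and what remains after dividing by s fixes
the last letter. -/
theorem exists_eq_mul (hs : IsBranching h h' κ k z s) {w : Equiv.Perm (Fin (n + 1))} {y : Fin (d k)}
    (hw : w (youngEquiv d h ⟨k, y⟩) = Fin.last n) :
    ∃ τ w', w = Equiv.Perm.viaEmbeddingHom Fin.castSuccEmb τ * s * youngPerm d h w' := by
  let w' : ∀ i, Equiv.Perm (Fin (d i)) := Pi.mulSingle k (Equiv.swap z y)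
  have hw' : (youngPerm d h w')⁻¹ (youngEquiv d h ⟨k, z⟩) = youngEquiv d h ⟨k, y⟩ := by
    rw [Equiv.Perm.inv_def, Equiv.symm_apply_eq, youngPerm_youngEquiv]
    simp [w']
  obtain ⟨τ, hτ⟩ := exists_viaEmbeddingHom_castSucc_eq (w := w * (youngPerm d h w')⁻¹ * s⁻¹) (by
    rw [Equiv.Perm.mul_apply, Equiv.Perm.mul_apply, ← hs.apply_removed, Equiv.Perm.inv_def s,
      Equiv.symm_apply_apply, hw', hw, hs.apply_removed])
  exact ⟨τ, w', by rw [hτ, inv_mul_cancel_right, inv_mul_cancel_right]⟩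

end IsBranching

end BranchPerm

/-! ### Inclusion of the socle in one block -/

section SocleFamily

variable {F : Type u} [Field F]

/-- The inclusion of a subrepresentation. -/
def Subrepresentation.subtype {Γ W : Type*} [Group Γ] [AddCommGroup W] [Module F W]
    {τ : Representation F Γ W} (N : Subrepresentation τ) :
    N.toRepresentation.IntertwiningMap τ where
  toLinearMap := N.toSubmodule.subtype
  isIntertwining' _ := rfl

theorem range_subtype_socle {Γ W : Type*} [Group Γ] [AddCommGroup W] [Module F W]
    (τ : Representation F Γ W) :
    LinearMap.range (socle τ).subtype.asModuleHom = moduleSocle F[Γ] τ.asModule := by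
  refine Submodule.ext fun x => ⟨?_, fun hx => ⟨⟨x, hx⟩, rfl⟩⟩
  rintro ⟨y, rfl⟩
  exact y.2

variable {r : ℕ} (L : Fin r → SymRep F) (k : Fin r)

/-- One uniform description of the updated family: the identity in blocks i ≠ k, and in block k the
inclusion of the socle together with the embedding that omits the last letter. It confines the case
distinction to this place. -/
theorem exists_socFamily_apply (i : Fin r) :
    ∃ (κ : Fin (socFamily L k i).deg ↪ Fin (L i).deg)
      (φ : (socFamily L k i).rep.IntertwiningMap
        ((L i).rep.comp (Equiv.Perm.viaEmbeddingHom κ) : Representation F _ _)),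
      Function.Injective φ ∧
      (i ≠ k → Function.Surjective κ ∧ Function.Bijective φ) ∧
      (i = k → (∀ x, x ∈ Set.range κ ↔ (x : ℕ) + 1 ≠ (L i).deg) ∧
        LinearMap.range φ.asModuleHom = moduleSocle F[_] (Representation.asModule
          ((L i).rep.comp (Equiv.Perm.viaEmbeddingHom κ) : Representation F _ _))) := by
  by_cases hi : i = k
  · subst hi
    rw [socFamily, Function.update_self]
    refine ⟨Fin.castLEEmb (Nat.sub_le _ 1), (socle _).subtype, Subtype.val_injective,
      fun h => absurd rfl h, fun _ => ⟨fun x => ⟨?_, fun hx => ?_⟩, range_subtype_socle _⟩⟩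
    · rintro ⟨y, rfl⟩
      have : (y : ℕ) < (L i).deg - 1 := y.2
      change (y : ℕ) + 1 ≠ _
      omega
    · have hx' := x.2
      exact ⟨⟨x, by change (x : ℕ) < (L i).deg - 1; omega⟩, rfl⟩
  · rw [socFamily, Function.update_of_ne hi]
    refine ⟨Function.Embedding.refl _, ⟨LinearMap.id, fun σ => ?_⟩, Function.injective_id,
      fun _ => ⟨Function.surjective_id, Function.bijective_id⟩, fun h => absurd h hi⟩
    have : Equiv.Perm.viaEmbeddingHom (Function.Embedding.refl _) σ = σ := Equiv.ext fun x =>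
      viaEmbeddingHom_apply_image (Function.Embedding.refl _) σ x
    rw [MonoidHom.comp_apply, this]
    rfl

end SocleFamily

/-! ### Isomorphisms of modules as equivalences of representations -/

section Semisimple

variable {F : Type u} [Field F]

theorem Representation.nonempty_equiv_of_linearEquiv {Γ W W' : Type*} [Group Γ] [AddCommGroup W]
    [Module F W] [AddCommGroup W'] [Module F W'] {τ : Representation F Γ W}
    {τ' : Representation F Γ W'} (e : τ.asModule ≃ₗ[F[Γ]] τ'.asModule) : Nonempty (τ.Equiv τ') :=
  ⟨Representation.IntertwiningMap.ofBijective
    ((Representation.IntertwiningMap.equivLinearMapAsModule τ τ').symm e.toLinearMap) e.bijective⟩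

theorem nonempty_socle_equiv {Γ W W' : Type*} [Group Γ] [AddCommGroup W]
    [Module F W] [AddCommGroup W'] [Module F W'] {τ : Representation F Γ W}
    {τ' : Representation F Γ W'} (e : moduleSocle F[Γ] τ.asModule ≃ₗ[F[Γ]] τ'.asModule) :
    Nonempty ((socle τ).toRepresentation.Equiv τ') := by
  have hinj : Function.Injective (socle τ).subtype.asModuleHom := Subtype.val_injective
  have e' := LinearEquiv.ofInjective _ hinj
  rw [range_subtype_socle] at e'
  exact Representation.nonempty_equiv_of_linearEquiv (e'.trans e)

end Semisimple

/-! ### The corners of the two sides -/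

section Sides

variable {F : Type u} [Field F] {G : Type v} [Group G] {r : ℕ} {V : Fin r → Type w}
  [∀ i, AddCommGroup (V i)] [∀ i, Module F (V i)] {ρ : ∀ i, Representation F G (V i)}

/-- The compression of the action of `G_n` to the multiplicity space. -/
def wreathCompress (ρ : ∀ i, Representation F G (V i)) (v : ∀ i, V i)
    (f : ∀ i, Module.Dual F (V i)) {n : ℕ} {d : Fin r → ℕ} (h : ∑ i, d i = n)
    (γ : Wreath G (Fin n)) : F[∀ i, Equiv.Perm (Fin (d i))] := by
  classical
  exact if hσ : ∃ σ, γ.right = youngPerm d h σ then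
    MonoidAlgebra.single hσ.choose (∏ j, f (youngColour d h j)
      (ρ _ (γ.left j) (v (youngColour d h j)))) else 0

variable {v : ∀ i, V i} {f : ∀ i, Module.Dual F (V i)}

theorem wreathCompress_of_eq {n : ℕ} {d : Fin r → ℕ} {h : ∑ i, d i = n} {γ : Wreath G (Fin n)}
    {σ : ∀ i, Equiv.Perm (Fin (d i))} (hσ : γ.right = youngPerm d h σ) :
    wreathCompress ρ v f h γ = MonoidAlgebra.single σ (∏ j, f (youngColour d h j)
      (ρ _ (γ.left j) (v (youngColour d h j)))) := by
  have hex : ∃ σ, γ.right = youngPerm d h σ := ⟨σ, hσ⟩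
  have : hex.choose = σ := youngPerm_injective h (hex.choose_spec.symm.trans hσ)
  rw [wreathCompress, dif_pos hex, this]

theorem wreathCompress_of_ne {n : ℕ} {d : Fin r → ℕ} {h : ∑ i, d i = n} {γ : Wreath G (Fin n)}
    (hσ : ∀ σ, γ.right ≠ youngPerm d h σ) : wreathCompress ρ v f h γ = 0 :=
  dif_neg (by push Not; exact hσ)

theorem lastHom_right {n : ℕ} (x : Wreath G (Fin n) × G) :
    (Wreath.lastHom n x).right = Equiv.Perm.viaEmbeddingHom Fin.castSuccEmb x.1.right := rfl

theorem lastHom_left_castSucc {n : ℕ} (x : Wreath G (Fin n) × G) (j : Fin n) :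
    (Wreath.lastHom n x).left j.castSucc = x.1.left j := Fin.snoc_castSucc (α := fun _ => G) _ _ _

theorem lastHom_left_last {n : ℕ} (x : Wreath G (Fin n) × G) :
    (Wreath.lastHom n x).left (Fin.last n) = x.2 := Fin.snoc_last (α := fun _ => G) _ _

variable (G) in
/-- The base group of `G_{n,1}`. -/
def lastBase (n : ℕ) : (Fin (n + 1) → G) →* Wreath G (Fin n) × G where
  toFun g := (SemidirectProduct.inl (Fin.init g), g (Fin.last n))
  map_one' := rfl
  map_mul' g g' := Prod.ext (map_mul SemidirectProduct.inl (Fin.init g) (Fin.init g')) rfl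

theorem lastHom_lastBase {n : ℕ} (g : Fin (n + 1) → G) :
    Wreath.lastHom n (lastBase G n g) = SemidirectProduct.inl g := by
  refine SemidirectProduct.ext ?_ ?_
  · exact Fin.snoc_init_self (α := fun _ => G) g
  · exact map_one (Equiv.Perm.viaEmbeddingHom (Fin.castSuccEmb (n := n)))

theorem lastHom_inr {n : ℕ} (τ : Equiv.Perm (Fin n)) :
    Wreath.lastHom (G := G) n (SemidirectProduct.inr τ, 1) =
      SemidirectProduct.inr (Equiv.Perm.viaEmbeddingHom Fin.castSuccEmb τ) := by
  refine SemidirectProduct.ext (funext fun j => ?_) rfl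
  refine Fin.lastCases (lastHom_left_last _) (fun j => lastHom_left_castSucc _ _) j

theorem mapDomainAlgHom_comp_apply {Γ Δ Λ : Type*} [Group Γ] [Group Δ] [Group Λ] (φ : Δ →* Λ)
    (ψ : Γ →* Δ) (a : F[Γ]) : MonoidAlgebra.mapDomainAlgHom F F φ
      (MonoidAlgebra.mapDomainAlgHom F F ψ a) = MonoidAlgebra.mapDomainAlgHom F F (φ.comp ψ) a := by
  induction a using MonoidAlgebra.induction_linear with
  | zero => simp
  | add x y hx hy => simp only [map_add, hx, hy]
  | single g c => simp

theorem coeff_map_inl_mul_map_inr {Γ Δ : Type*} [Group Γ] [Group Δ] (a : F[Γ]) (b : F[Δ])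
    (x : Γ × Δ) : (MonoidAlgebra.mapDomainAlgHom F F (MonoidHom.inl Γ Δ) a *
      MonoidAlgebra.mapDomainAlgHom F F (MonoidHom.inr Γ Δ) b).coeff x =
        a.coeff x.1 * b.coeff x.2 := by
  classical
  induction a using MonoidAlgebra.induction_linear with
  | zero => simp
  | add a a' ha ha' =>
    rw [map_add, add_mul, MonoidAlgebra.coeff_add, Finsupp.add_apply, ha, ha',
      MonoidAlgebra.coeff_add, Finsupp.add_apply, add_mul]
  | single g c =>
    induction b using MonoidAlgebra.induction_linear with
    | zero => simp
    | add b b' hb hb' =>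
      rw [map_add, mul_add, MonoidAlgebra.coeff_add, Finsupp.add_apply, hb, hb',
        MonoidAlgebra.coeff_add, Finsupp.add_apply, mul_add]
    | single g' c' =>
      obtain ⟨x, y⟩ := x
      have : MonoidAlgebra.mapDomainAlgHom F F (MonoidHom.inl Γ Δ) (MonoidAlgebra.single g c) *
        MonoidAlgebra.mapDomainAlgHom F F (MonoidHom.inr Γ Δ) (MonoidAlgebra.single g' c') =
          MonoidAlgebra.single (g, g') (c * c') := by simp [MonoidAlgebra.single_mul_single]
      rw [this]
      simp only [MonoidAlgebra.coeff_single, Finsupp.single_apply, Prod.mk.injEq]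
      split_ifs <;> simp_all

/-- Splitting off the last coordinate. This identifies the corner elements of the restricted induced
module with those of the outer tensor products. -/
theorem map_lastBase_pureElement [Finite G] {n : ℕ} (a : Fin (n + 1) → F[G]) :
    MonoidAlgebra.mapDomainAlgHom F F (lastBase G n) (pureElement a) =
      MonoidAlgebra.mapDomainAlgHom F F (MonoidHom.inl (Wreath G (Fin n)) G)
        (MonoidAlgebra.mapDomainAlgHom F F SemidirectProduct.inl
          (pureElement fun j => a j.castSucc)) *
      MonoidAlgebra.mapDomainAlgHom F F (MonoidHom.inr (Wreath G (Fin n)) G) (a (Fin.last n)) := by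
  let c : (Fin (n + 1) → G) →* (Fin n → G) × G :=
    { toFun := fun g => (Fin.init g, g (Fin.last n)), map_one' := rfl, map_mul' := fun _ _ => rfl }
  have hc : Function.Injective c := fun g g' h => by
    rw [← Fin.snoc_init_self g, ← Fin.snoc_init_self g', show Fin.init g = Fin.init g' from
      congrArg Prod.fst h, show g (Fin.last n) = g' (Fin.last n) from congrArg Prod.snd h]
  let m : (Fin n → G) × G →* Wreath G (Fin n) × G :=
    SemidirectProduct.inl.prodMap (MonoidHom.id G)
  have h1 : MonoidAlgebra.mapDomainAlgHom F F c (pureElement a) =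
      MonoidAlgebra.mapDomainAlgHom F F (MonoidHom.inl (Fin n → G) G)
        (pureElement fun j => a j.castSucc) *
      MonoidAlgebra.mapDomainAlgHom F F (MonoidHom.inr (Fin n → G) G) (a (Fin.last n)) := by
    ext x
    obtain ⟨g, rfl⟩ : ∃ g, c g = x := ⟨Fin.snoc x.1 x.2, Prod.ext
      (Fin.init_snoc (α := fun _ => G) _ _) (Fin.snoc_last (α := fun _ => G) _ _)⟩
    rw [MonoidAlgebra.coeff_mapDomainAlgHom_of_injective hc, coeff_map_inl_mul_map_inr,
      coeff_pureElement, coeff_pureElement, Fin.prod_univ_castSucc]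
    rfl
  have h2 := congrArg (MonoidAlgebra.mapDomainAlgHom F F m) h1
  rw [map_mul, mapDomainAlgHom_comp_apply, mapDomainAlgHom_comp_apply,
    mapDomainAlgHom_comp_apply] at h2
  rw [mapDomainAlgHom_comp_apply]
  refine h2.trans ?_
  congr 3

end Sides

theorem Representation.IsIrreducible.comp_of_surjective {F Γ Δ W : Type*} [Field F] [Group Γ]
    [Group Δ] [AddCommGroup W] [Module F W] {τ : Representation F Δ W} (hτ : τ.IsIrreducible)
    {φ : Γ →* Δ} (hφ : Function.Surjective φ) :
    Representation.IsIrreducible (τ.comp φ : Representation F Γ W) := by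
  let e : Subrepresentation (τ.comp φ : Representation F Γ W) ≃o Subrepresentation τ :=
    { toFun := fun N => ⟨N.toSubmodule, fun g x hx => by
        obtain ⟨g, rfl⟩ := hφ g
        exact N.apply_mem_toSubmodule g hx⟩
      invFun := fun N => ⟨N.toSubmodule, fun g _ hx => N.apply_mem_toSubmodule (φ g) hx⟩
      left_inv := fun _ => rfl
      right_inv := fun _ => rfl
      map_rel_iff' := Iff.rfl }
  exact e.isSimpleOrder_iff.2 hτ

theorem isSemisimpleModule_of_range_eq_moduleSocle {A X Y : Type*} [Ring A] [AddCommGroup X]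
    [Module A X] [AddCommGroup Y] [Module A Y] {φ : Y →ₗ[A] X} (hφ : Function.Injective φ)
    (h : LinearMap.range φ = moduleSocle A X) : IsSemisimpleModule A Y := by
  have e := LinearEquiv.ofInjective φ hφ
  rw [h] at e
  have := moduleSocle_isSemisimpleModule A X
  exact IsSemisimpleModule.congr e

/-! ### Comparison of the two sides and the socle of the restriction -/

section BranchCorner

theorem IsModuleCorner.directSum {F Γ K : Type*} [Field F] [Group Γ] [Fintype K] {B : K → Type*}
    [∀ k, Ring (B k)] {W : K → Type*} [∀ k, AddCommGroup (W k)] [∀ k, Module F (W k)]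
    (Z : ∀ k, Representation F Γ (W k)) {Y : K → Type*} [∀ k, AddCommGroup (Y k)]
    [∀ k, Module (B k) (Y k)] {e : K → F[Γ]} {t : ∀ k, F[Γ] → B k} {ι : ∀ k, Y k →+ (Z k).asModule}
    (h : ∀ k, IsModuleCorner (K := Unit) (fun _ => e k) (fun _ => t k) (fun _ => ι k))
    (hne : ∀ k l, k ≠ l → (Z l).asAlgebraHom (e k) = 0) :
    ∃ ι', IsModuleCorner e t (X := (Representation.directSum Z).asModule) (Y := Y) ι' := by
  classical
  let j : ∀ k, (Z k).IntertwiningMap (Representation.directSum Z) := fun k =>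
    ⟨DirectSum.lof F K W k, fun g => LinearMap.ext fun x => by
      simp [Representation.directSum, DirectSum.lmap_lof]⟩
  let p : ∀ k, (Representation.directSum Z).IntertwiningMap (Z k) := fun k =>
    ⟨DirectSum.component F K W k, fun g => LinearMap.ext fun x => by
      exact DirectSum.lmap_apply (fun k => Z k g) x k⟩
  refine ⟨_, IsModuleCorner.of_directSum h (fun k l hkl z => ?_) (fun k => (j k).asModuleHom)
    (fun k => (p k).asModuleHom) (fun k z => ?_) (fun x => ?_)⟩
  · exact LinearMap.congr_fun (hne k l hkl) z
  · exact DirectSum.component.lof_self F k z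
  · change ∑ k, DirectSum.lof F K W k (DirectSum.component F K W k x) = x
    exact DirectSum.sum_univ_of x

variable {F : Type u} [Field F] {G : Type v} [Group G] [Finite G] {r : ℕ} {V : Fin r → Type w}
  [∀ i, AddCommGroup (V i)] [∀ i, Module F (V i)] {ρ : ∀ i, Representation F G (V i)}
  {ε u : Fin r → F[G]} {v : ∀ i, V i} {f : ∀ i, Module.Dual F (V i)}

omit [Finite G] in
theorem exists_wreathCompress_eq (hf : ∀ i, f i (v i) = 1) {n : ℕ} {d : Fin r → ℕ}
    (h : ∑ i, d i = n) (σ : ∀ i, Equiv.Perm (Fin (d i))) :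
    ∃ γ, wreathCompress ρ v f h γ = MonoidAlgebra.single σ 1 := by
  refine ⟨SemidirectProduct.inr (youngPerm d h σ), ?_⟩
  rw [wreathCompress_of_eq (σ := σ) rfl]
  simp [hf]

variable (hf : ∀ i, f i (v i) = 1) (hε : ∀ i x, (ρ i).asAlgebraHom (ε i) x = f i x • v i)
  (hε0 : ∀ i j, j ≠ i → (ρ j).asAlgebraHom (ε i) = 0)
  (hu : ∀ i, u i ∈ TwoSidedIdeal.span {ε i}) (hu1 : ∀ i, (ρ i).asAlgebraHom (u i) = 1)
  (hu0 : ∀ i j, j ≠ i → (ρ j).asAlgebraHom (u i) = 0)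

include hf hε hε0 hu hu1 hu0

/-- The induced module is governed by the outer tensor product of the multiplicity spaces. -/
theorem isModuleCorner_wreathInd_self (L : Fin r → SymRep F) {n : ℕ} (h : ∑ i, (L i).deg = n) :
    IsModuleCorner (K := Unit)
      (fun _ => MonoidAlgebra.mapDomainAlgHom F F SemidirectProduct.inl
        (pureElement fun j => ε (youngColour _ h j)))
      (fun _ => groupAlgebraLift (wreathCompress ρ v f h))
      (X := (wreathInd ρ L h).asModule)
      (Y := fun _ => (outerPiTensor fun i => (L i).rep).asModule)
      (fun _ => (wreathInd ρ L h (SemidirectProduct.inr 1) ∘ₗ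
        wreathEmb ρ L h ∘ₗ blockEmb v).toAddMonoidHom) :=
  isModuleCorner_wreathInd h (MonoidHom.id _) SemidirectProduct.inl (fun _ => rfl) hf hε hε0 hu hu1
    hu0 (K := Unit) (fun _ => 1) (fun _ => MonoidHom.id _)
    (fun _ => wreathCompress ρ v f h)
    (fun _ γ σ hσ => wreathCompress_of_eq (by simpa using hσ))
    (fun _ γ hσ => wreathCompress_of_ne (by simpa using hσ))
    (fun _ _ _ w _ => ⟨rfl, w, rfl⟩)
    (fun _ σ => ⟨SemidirectProduct.inr (youngPerm _ h σ), by simp⟩)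
    (fun w => ⟨(), SemidirectProduct.inr w, w, 1, rfl, by simp⟩)

/-- The restriction of the induced module to `G_{n,1}`. -/
theorem isModuleCorner_wreathInd_lastHom (L : Fin r → SymRep F) {n : ℕ}
    (h : ∑ i, (L i).deg = n + 1)
    (κ : ∀ (k : {k : Fin r // 0 < (L k).deg}) i,
      Fin (socFamily L k.1 i).deg ↪ Fin (L i).deg)
    (z : ∀ k : {k : Fin r // 0 < (L k).deg}, Fin (L k.1).deg)
    (hz : ∀ k, (z k : ℕ) + 1 = (L k.1).deg)
    (s : ∀ _ : {k : Fin r // 0 < (L k).deg}, Equiv.Perm (Fin (n + 1)))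
    (hs : ∀ k, IsBranching h (sum_deg_socFamily L h k.1 k.2) (κ k) k.1 (z k) (s k)) :
    IsModuleCorner
      (fun k => MonoidAlgebra.mapDomainAlgHom F F (lastBase G n)
        (pureElement fun j => ε (youngColour _ h ((s k).symm j))))
      (fun k : {k : Fin r // 0 < (L k).deg} => groupAlgebraLift fun x : Wreath G (Fin n) × G =>
        f k.1 (ρ k.1 x.2 (v k.1)) • wreathCompress ρ v f (sum_deg_socFamily L h k.1 k.2) x.1)
      (X := Representation.asModule ((wreathInd ρ L h).comp (Wreath.lastHom n) :
        Representation F (Wreath G (Fin n) × G) _))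
      (Y := fun k => Representation.asModule
        ((outerPiTensor fun i => (L i).rep).comp (branchHom (κ k)) :
          Representation F (∀ i, Equiv.Perm (Fin (socFamily L k.1 i).deg)) _))
      (fun k => (wreathInd ρ L h (SemidirectProduct.inr (s k)) ∘ₗ
        wreathEmb ρ L h ∘ₗ blockEmb v).toAddMonoidHom) := by
  refine isModuleCorner_wreathInd h (Wreath.lastHom n) (lastBase G n) lastHom_lastBase hf hε hε0
    hu hu1 hu0 s (fun k => branchHom (κ k))
    (fun k x => f k.1 (ρ k.1 x.2 (v k.1)) •
      wreathCompress ρ v f (sum_deg_socFamily L h k.1 k.2) x.1)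
    (fun k γ σ hσ => ?_) (fun k γ hσ => ?_) (fun k l γ w hw => ?_) (fun k σ => ?_) (fun w => ?_)
  -- The last letter has colour k after s k, so its matrix coefficient splits off from the product
  -- over n + 1 letters; the remaining coefficients form the compression for G_n.
  · rw [lastHom_right, (hs k).mul_eq_mul_iff] at hσ
    rw [wreathCompress_of_eq hσ, MonoidAlgebra.smul_single', Fin.prod_univ_castSucc, mul_comm]
    have hχ : ∀ c c' g, c = c' → f c (ρ c g (v c)) = f c' (ρ c' g (v c')) := by
      rintro c _ g rfl
      rfl
    congr 2
    · refine Finset.prod_congr rfl fun j _ => ?_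
      rw [lastHom_left_castSucc]
      exact hχ _ _ _ ((hs k).colour_castSucc j).symm
    · rw [lastHom_left_last]
      exact hχ _ _ _ (hs k).colour_last.symm
  · change f k.1 (ρ k.1 γ.2 (v k.1)) • wreathCompress ρ v f _ γ.1 = 0
    rw [wreathCompress_of_ne fun σ hσ' => hσ σ ?_, smul_zero]
    rw [lastHom_right, (hs k).mul_eq_mul_iff]
    exact hσ'
  · obtain ⟨hkl, hw'⟩ := (hs k).eq_and_mem_range (hs l) (hz k) (hz l) hw
    exact ⟨Subtype.ext hkl, hw'⟩
  · refine ⟨(SemidirectProduct.inr (youngPerm _ (sum_deg_socFamily L h k.1 k.2) σ), 1), ?_⟩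
    rw [lastHom_inr, (hs k).mul_youngPerm, mul_inv_cancel_right]
  -- The block containing the preimage of the last letter selects the double coset of w; it is
  -- nonempty, as it contains y.
  · obtain ⟨⟨k, y⟩, hy⟩ := (youngEquiv (fun i => (L i).deg) h).surjective (w⁻¹ (Fin.last n))
    have hw : w (youngEquiv _ h ⟨k, y⟩) = Fin.last n := by
      rw [hy, Equiv.Perm.inv_def, Equiv.apply_symm_apply]
    obtain ⟨τ, w', hw'⟩ := (hs ⟨k, y.pos⟩).exists_eq_mul hw
    exact ⟨⟨k, y.pos⟩, (SemidirectProduct.inr τ, 1), _, w', lastHom_inr τ, hw'⟩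

/-- The direct sum of outer tensor products. -/
theorem exists_isModuleCorner_directSum (L : Fin r → SymRep F) {n : ℕ}
    (h : ∑ i, (L i).deg = n + 1) :
    ∃ ι, IsModuleCorner
      (fun k : {k : Fin r // 0 < (L k).deg} =>
        MonoidAlgebra.mapDomainAlgHom F F (MonoidHom.inl (Wreath G (Fin n)) G)
          (MonoidAlgebra.mapDomainAlgHom F F SemidirectProduct.inl
            (pureElement fun j => ε (youngColour _ (sum_deg_socFamily L h k.1 k.2) j))) *
        MonoidAlgebra.mapDomainAlgHom F F (MonoidHom.inr (Wreath G (Fin n)) G) (ε k.1))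
      (fun k : {k : Fin r // 0 < (L k).deg} => groupAlgebraLift fun x : Wreath G (Fin n) × G =>
        f k.1 (ρ k.1 x.2 (v k.1)) • wreathCompress ρ v f (sum_deg_socFamily L h k.1 k.2) x.1)
      (X := Representation.asModule (Representation.directSum
        fun k : {k : Fin r // 0 < (L k).deg} =>
          outerTensor (wreathInd ρ (socFamily L k.1) (sum_deg_socFamily L h k.1 k.2)) (ρ k.1)))
      (Y := fun k => Representation.asModule
        (outerPiTensor fun i => (socFamily L k.1 i).rep)) ι := by
  refine IsModuleCorner.directSum _ (fun k => IsModuleCorner.outerTensor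
    (isModuleCorner_wreathInd_self hf hε hε0 hu hu1 hu0 (socFamily L k.1)
      (sum_deg_socFamily L h k.1 k.2)) (exists_wreathCompress_eq hf _) (hf k.1) (hε k.1) (hu k.1)
      (hu1 k.1)) fun k l hkl => ?_
  -- The last tensor factor already separates the summands: ε k kills V l for l ≠ k.
  rw [map_mul, asAlgebraHom_outerTensor_inr, hε0 k.1 l.1 (fun hlk => hkl (Subtype.ext hlk.symm)),
    TensorProduct.map_zero_right, mul_zero]

omit hf hε hε0 hu hu1 hu0

theorem exists_branching_data (L : Fin r → SymRep F) {n : ℕ} (h : ∑ i, (L i).deg = n + 1)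
    (k : {k : Fin r // 0 < (L k).deg}) :
    ∃ (κ : ∀ i, Fin (socFamily L k.1 i).deg ↪ Fin (L i).deg)
      (φ : ∀ i, (socFamily L k.1 i).rep.IntertwiningMap
        ((L i).rep.comp (Equiv.Perm.viaEmbeddingHom (κ i)) : Representation F _ _))
      (z : Fin (L k.1).deg) (s : Equiv.Perm (Fin (n + 1))), (z : ℕ) + 1 = (L k.1).deg ∧
      IsBranching h (sum_deg_socFamily L h k.1 k.2) κ k.1 z s ∧
      (∀ i, Function.Injective (φ i)) ∧ (∀ i, i ≠ k.1 → Function.Bijective (φ i)) ∧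
      LinearMap.range (φ k.1).asModuleHom = moduleSocle F[_] (Representation.asModule
          ((L k.1).rep.comp (Equiv.Perm.viaEmbeddingHom (κ k.1)) : Representation F _ _)) := by
  choose κ φ h1 h2 h3 using exists_socFamily_apply L k.1
  have hk := k.2
  let z : Fin (L k.1).deg := ⟨(L k.1).deg - 1, by omega⟩
  have hz : (z : ℕ) + 1 = (L k.1).deg := Nat.sub_add_cancel hk
  obtain ⟨s, hs⟩ := exists_isBranching h (sum_deg_socFamily L h k.1 k.2) κ k.1 z
    (fun i hi => (h2 i hi).1) fun x => by
      rw [(h3 k.1 rfl).1, ne_eq, ne_eq, Fin.ext_iff]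
      omega
  exact ⟨κ, φ, z, s, hz, hs, h1, fun i hi => (h2 i hi).2, (h3 k.1 rfl).2⟩

variable [IsAlgClosed F]

/-- The socle of the restriction of an induced module to `G_{n,1}`. -/
theorem socle_res_wreathInd (hirr : ∀ i, (ρ i).IsIrreducible)
    (hne : Pairwise fun i j => IsEmpty ((ρ i).Equiv (ρ j))) (L : Fin r → SymRep F)
    (hL : ∀ i, (L i).rep.IsIrreducible ∨ Subsingleton (L i).carrier) (n : ℕ)
    (h : ∑ i, (L i).deg = n + 1) :
    (∀ (k : Fin r) (hk : 0 < (L k).deg),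
      (wreathInd ρ (socFamily L k) (sum_deg_socFamily L h k hk)).IsSemisimpleRepresentation) ∧
    Nonempty ((socle ((wreathInd ρ L h).comp (Wreath.lastHom n))).toRepresentation.Equiv
      (Representation.directSum fun k : {k : Fin r // 0 < (L k).deg} =>
        outerTensor (wreathInd ρ (socFamily L k.1) (sum_deg_socFamily L h k.1 k.2)) (ρ k.1))) := by
  have hfd : ∀ i, FiniteDimensional F (V i) := fun i =>
    have := hirr i
    (ρ i).finiteDimensional_of_isIrreducible
  obtain ⟨ε, u, v, f, hf, hε, hε0, hu, hu1, hu0⟩ := exists_rank_one_idempotents ρ hirr hne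
  choose κ φ z s hz hs hφ hφ' hsoc using exists_branching_data L h
  -- For i ≠ k the embedding of letters is bijective, so restriction along it keeps L i irreducible.
  have hrange : ∀ k, LinearMap.range (outerPiMap (φ k)).asModuleHom =
      moduleSocle F[_] (outerPiTensor fun i => ((L i).rep.comp
        (Equiv.Perm.viaEmbeddingHom (κ k i)) : Representation F _ _)).asModule := fun k => by
    refine range_outerPiMap_eq_moduleSocle (φ k) k.1 (fun i hi => ?_) (hφ' k) (hsoc k)
    refine (hL i).imp (fun hi' => hi'.comp_of_surjective fun w => ?_) id
    have hsurj := (hs k).surjective i hi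
    exact exists_viaEmbeddingHom_eq _ w (fun x => hsurj _) fun y hy => absurd (hsurj y) hy
  have hinj : ∀ k, Function.Injective (outerPiMap (φ k)).asModuleHom := fun k =>
    PiTensorProduct.map_injective (fun i => (φ k i).toLinearMap) (hφ k)
  refine ⟨fun k hk => ?_, ?_⟩
  · rw [Representation.isSemisimpleRepresentation_iff_isSemisimpleModule_asModule]
    refine (isModuleCorner_wreathInd_self hf hε hε0 hu hu1 hu0 (socFamily L k)
      (sum_deg_socFamily L h k hk)).isSemisimpleModule fun _ => ?_
    exact isSemisimpleModule_of_range_eq_moduleSocle (hinj ⟨k, hk⟩) (hrange ⟨k, hk⟩)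
  · have hE := isModuleCorner_wreathInd_lastHom hf hε hε0 hu hu1 hu0 L h κ z hz s hs
    obtain ⟨ι, hZ⟩ := exists_isModuleCorner_directSum hf hε hε0 hu hu1 hu0 L h
    -- The two corner elements agree because after s k the first n letters have the colours of the
    -- smaller family and the last letter has colour k.
    have he : ∀ k : {k : Fin r // 0 < (L k).deg},
        MonoidAlgebra.mapDomainAlgHom F F (MonoidHom.inl (Wreath G (Fin n)) G)
          (MonoidAlgebra.mapDomainAlgHom F F SemidirectProduct.inl
            (pureElement fun j => ε (youngColour _ (sum_deg_socFamily L h k.1 k.2) j))) *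
        MonoidAlgebra.mapDomainAlgHom F F (MonoidHom.inr (Wreath G (Fin n)) G) (ε k.1) =
        MonoidAlgebra.mapDomainAlgHom F F (lastBase G n)
          (pureElement fun j => ε (youngColour _ h ((s k).symm j))) := fun k => by
      rw [map_lastBase_pureElement]
      simp only [(hs k).colour_castSucc, (hs k).colour_last]
    simp only [he] at hZ
    -- The multiplicity spaces of the direct sum embed in those of the restriction with the socles
    -- as images, and all other data coincide.
    obtain ⟨e⟩ := hE.nonempty_moduleSocle_linearEquiv (fun k => (outerPiMap (φ k)).asModuleHom)
      hinj hrange hZ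
    exact nonempty_socle_equiv e

end BranchCorner
theorem mainTheorem8 {F : Type u} [Field F] [IsAlgClosed F] (p : ℕ) [CharP F p]
    {G : Type v} [Group G] [Finite G] {r : ℕ} {V : Fin r → Type w}
    [∀ i, AddCommGroup (V i)] [∀ i, Module F (V i)] (ρ : ∀ i, Representation F G (V i))
    (hirr : ∀ i, (ρ i).IsIrreducible)
    (hne : Pairwise fun i j => IsEmpty ((ρ i).Equiv (ρ j)))
    (μ : Fin r → YoungDiagram) (hμ : ∀ i, IsPRegular p (μ i))
    (n : ℕ) (hn : ∑ i, (μ i).card = n + 1) :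
    (∀ (k : Fin r) (hk : 0 < (μ k).card),
      (wreathInd ρ (socFamily (fun i => dModule F (μ i)) k)
        (sum_deg_socFamily (fun i => dModule F (μ i)) hn k hk)).IsSemisimpleRepresentation) ∧
    Nonempty
      ((socle ((wreathInd ρ (fun i => dModule F (μ i)) hn).comp
          (Wreath.lastHom n))).toRepresentation.Equiv
        (Representation.directSum fun k : {k : Fin r // 0 < (μ k).card} =>
          outerTensor
            (wreathInd ρ (socFamily (fun i => dModule F (μ i)) k.1)
              (sum_deg_socFamily (fun i => dModule F (μ i)) hn k.1 k.2))
            (ρ k.1))) := by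
  exact socle_res_wreathInd hirr hne (fun i => dModule F (μ i))
    (fun i => dModule_isIrreducible_or_subsingleton F (μ i)) n hn

end
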